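/- For a function $f:\{0,1\}^n\to\{\pm1\}$, a decision tree computing $f$ has size equal to its number of leaves; a function $h$ is an $\varepsilon$-approximation of $f$ if $\Pr_{x}[h(x)\ne f(x)]\le\varepsilon$ for uniform $x\in\{0,1\}^n$. A membership query returns $f(x)$ for a point $x$ chosen by the algorithm. A random edge of $f$ is a pair $\big((x,f(x)),(x^{\oplus i},f(x^{\oplus i}))\big)$, where $x\in\{0,1\}^n$ and $i\in\{1,\dots,n\}$ are uniform and independent and $x^{\oplus i}$ is $x$ with its $i$-th coordinate flipped. Theorem. There are a randomized algorithm $A_1$ that accesses an unknown function $f$ through membership queries, an algorithm $A_2$ whose only access to $f$, and only source of randomness, are independent random edges of $f$, and a polynomial $p$, such that both $A\in\{A_1,A_2\}$ satisfy the following for all integers $n\ge1$, $s\ge1$ and all $\varepsilon\in(0,\tfrac12)$, $\delta\in(0,1)$. Whenever $f:\{0,1\}^n\to\{\pm1\}$ is computed by a decision tree of size at most $s$, the algorithm $A$, given $n,s,\varepsilon,\delta$ (the last two through the integers $\lceil 1/\varepsilon\rceil$ and $\lceil 1/\delta\rceil$), always outputs a decision tree within time $$p\big(n,\ s^{\log(s/\varepsilon)\log(1/\varepsilon)},\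 \log(1/\delta)\big),$$ and with probability at least $1-\delta$ this tree is an $\varepsilon$-approximation of $f$. Logarithms are to base $2$; time is counted on a random access machine with unit-cost addition and subtraction on natural numbers, on which a membership query or a random edge costs $O(n)$. -/

import Mathlib

open MeasureTheory

/-! Boolean functions and decision trees. -/

/-- A point of the cube `{0,1}^n`. -/
abbrev Cube (n : ℕ) : Type := Fin n → Bool

/-- The point `x` with its `i`-th coordinate flipped. -/
def Cube.flip {n : ℕ} (x : Cube n) (i : Fin n) : Cube n :=
  Function.update x i (!(x i))

/-- The fraction of the points of the cube at which `f` and `g` differ. The two labels `-1` and `+1`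
of a Boolean function are written `false` and `true`. -/
noncomputable def errorRate {n : ℕ} (f g : Cube n → Bool) : ℝ :=
  ((Finset.univ.filter fun x => f x ≠ g x).card : ℝ) / 2 ^ n

/-- Decision trees over `n` Boolean variables. -/
inductive DTree (n : ℕ) : Type
  | leaf (b : Bool) : DTree n
  | node (i : Fin n) (t₀ t₁ : DTree n) : DTree n

namespace DTree

/-- The number of leaves. -/
def size {n : ℕ} : DTree n → ℕ
  | leaf _ => 1
  | node _ t₀ t₁ => t₀.size + t₁.size

/-- The function computed by a tree. -/
def eval {n : ℕ} : DTree n → Cube n → Bool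
  | leaf b, _ => b
  | node i t₀ t₁, x => if x i then t₁.eval x else t₀.eval x

/-- The description of a tree by natural numbers: its vertices in preorder, a leaf being written
as its label (`0` or `1`) and a query to the variable `i` as `i + 2`. -/
def code {n : ℕ} : DTree n → List ℕ
  | leaf b => [b.toNat]
  | node i t₀ t₁ => ((i : ℕ) + 2) :: (t₀.code ++ t₁.code)

end DTree

/-! A random access machine with an oracle for an unknown Boolean function. It has registers and
an addressable memory, all holding natural numbers; its arithmetic is addition and truncated
subtraction, so that a run of `t` steps lengthens a number by at most `t` bits. -/

/-- Expressions: constants, registers, memory cells at a computed address, sums and truncated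
differences. -/
inductive Expr : Type
  | const (c : ℕ) : Expr
  | reg (r : ℕ) : Expr
  | load (a : Expr) : Expr
  | add (a b : Expr) : Expr
  | sub (a b : Expr) : Expr

/-- Programs. -/
inductive Prog : Type
  /-- do nothing -/
  | skip : Prog
  /-- assign the value of `e` to the register `r` -/
  | set (r : ℕ) (e : Expr) : Prog
  /-- write the value of `e` into the memory cell with address `a` -/
  | store (a e : Expr) : Prog
  /-- sequential composition -/
  | seq (p q : Prog) : Prog
  /-- run `p` if the value of `e` is nonzero, and `q` otherwise -/
  | ite (e : Expr) (p q : Prog) : Prog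
  /-- repeat `p` as long as the value of `e` is nonzero -/
  | loop (e : Expr) (p : Prog) : Prog
  /-- put a uniform random bit into the register `r` -/
  | coin (r : ℕ) : Prog
  /-- membership query: put into the register `r` the label of the point that stands in the `n`
  memory cells from address `a` on -/
  | query (r : ℕ) (a : Expr) : Prog
  /-- write a fresh random edge into memory, from address `a` on -/
  | edge (a : Expr) : Prog

namespace Prog

/-- The program draws no random edges: it uses membership queries and random bits only. -/
def UsesOnlyQueries : Prog → Prop
  | skip | set _ _ | store _ _ | coin _ | query _ _ => True
  | seq p q | ite _ p q => p.UsesOnlyQueries ∧ q.UsesOnlyQueries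
  | loop _ p => p.UsesOnlyQueries
  | edge _ => False

/-- The program makes no membership queries and flips no coins: random edges are its only access to
the unknown function, and its only source of randomness. -/
def UsesOnlyEdges : Prog → Prop
  | skip | set _ _ | store _ _ | edge _ => True
  | seq p q | ite _ p q => p.UsesOnlyEdges ∧ q.UsesOnlyEdges
  | loop _ p => p.UsesOnlyEdges
  | coin _ | query _ _ => False

end Prog

/-- States of the machine: the registers, the memory, and the number of random draws made. -/
structure MState : Type where
  reg : ℕ → ℕ
  mem : ℕ → ℕ
  draws : ℕ

namespace Expr

/-- The value of an expression in a state. -/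
def eval (σ : MState) : Expr → ℕ
  | const c => c
  | reg r => σ.reg r
  | load a => σ.mem (a.eval σ)
  | add a b => a.eval σ + b.eval σ
  | sub a b => a.eval σ - b.eval σ

/-- The time to evaluate an expression: one unit for each constant, access or operation. -/
def cost : Expr → ℕ
  | const _ => 1
  | reg _ => 1
  | load a => a.cost + 1
  | add a b => a.cost + b.cost + 1
  | sub a b => a.cost + b.cost + 1

end Expr

namespace MState

/-- Assign `v` to the register `r`. -/
def setReg (σ : MState) (r v : ℕ) : MState :=
  { σ with reg := Function.update σ.reg r v }

/-- Write `v` into the memory cell `a`. -/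
def setMem (σ : MState) (a v : ℕ) : MState :=
  { σ with mem := Function.update σ.mem a v }

/-- Write the list `L` into the memory cells `a, a + 1, …`. -/
def setBlock (σ : MState) (a : ℕ) (L : List ℕ) : MState :=
  { σ with mem := fun k => if a ≤ k ∧ k < a + L.length then L.getD (k - a) 0 else σ.mem k }

/-- The list `L` stands in the memory cells `a, a + 1, …`. -/
def HasBlock (σ : MState) (a : ℕ) (L : List ℕ) : Prop :=
  ∀ k < L.length, σ.mem (a + k) = L.getD k 0

/-- The point of the cube in the memory cells `a, …, a + n - 1`, nonzero cells being read as `1`. -/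
def point (σ : MState) (n a : ℕ) : Cube n :=
  fun j => decide (σ.mem (a + j) ≠ 0)

/-- Record that one more random draw has been made. -/
def tick (σ : MState) : MState :=
  { σ with draws := σ.draws + 1 }

end MState

/-- The random edge `((x, f x), (y, f y))`, with `y` the point `x` with its `i`-th coordinate
flipped, as a list of `2 n + 2` bits. -/
def edgeBlock {n : ℕ} (f : Cube n → Bool) (x : Cube n) (i : Fin n) : List ℕ :=
  List.ofFn (fun j => (x j).toNat) ++ [(f x).toNat] ++
    (List.ofFn (fun j => ((x.flip i) j).toNat) ++ [(f (x.flip i)).toNat])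

/-- What one random draw may use: a point and a coordinate (for a random edge), and a bit
(for a coin flip). -/
abbrev Draw (n : ℕ) : Type := (Cube n × Fin n) × Bool

/-- `Exec f ω p σ t σ'`: with unknown function `f` and sequence of random draws `ω`, the program `p`
started in the state `σ` halts in the state `σ'` after `t` time units. Each instruction costs one
unit on top of the evaluation of its expressions, plus one unit for every memory cell that an
oracle call reads or writes. Each random draw is used at most once. -/
inductive Exec {n : ℕ} (f : Cube n → Bool) (ω : ℕ → Draw n) :
    Prog → MState → ℕ → MState → Prop
  | skip (σ : MState) : Exec f ω Prog.skip σ 1 σ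
  | set (σ : MState) (r : ℕ) (e : Expr) :
      Exec f ω (Prog.set r e) σ (e.cost + 1) (σ.setReg r (e.eval σ))
  | store (σ : MState) (a e : Expr) :
      Exec f ω (Prog.store a e) σ (a.cost + e.cost + 1) (σ.setMem (a.eval σ) (e.eval σ))
  | seq {p q : Prog} {σ σ₁ σ₂ : MState} {t₁ t₂ : ℕ} :
      Exec f ω p σ t₁ σ₁ → Exec f ω q σ₁ t₂ σ₂ → Exec f ω (Prog.seq p q) σ (t₁ + t₂) σ₂
  | iteTrue {e : Expr} {p q : Prog} {σ σ' : MState} {t : ℕ} :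
      e.eval σ ≠ 0 → Exec f ω p σ t σ' → Exec f ω (Prog.ite e p q) σ (e.cost + 1 + t) σ'
  | iteFalse {e : Expr} {p q : Prog} {σ σ' : MState} {t : ℕ} :
      e.eval σ = 0 → Exec f ω q σ t σ' → Exec f ω (Prog.ite e p q) σ (e.cost + 1 + t) σ'
  | loopDone {e : Expr} {p : Prog} {σ : MState} :
      e.eval σ = 0 → Exec f ω (Prog.loop e p) σ (e.cost + 1) σ
  | loopStep {e : Expr} {p : Prog} {σ σ₁ σ₂ : MState} {t₁ t₂ : ℕ} :
      e.eval σ ≠ 0 → Exec f ω p σ t₁ σ₁ → Exec f ω (Prog.loop e p) σ₁ t₂ σ₂ →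
      Exec f ω (Prog.loop e p) σ (e.cost + 1 + t₁ + t₂) σ₂
  | coin (σ : MState) (r : ℕ) :
      Exec f ω (Prog.coin r) σ 1 ((σ.setReg r (ω σ.draws).2.toNat).tick)
  | query (σ : MState) (r : ℕ) (a : Expr) :
      Exec f ω (Prog.query r a) σ (a.cost + 1 + n)
        (σ.setReg r (f (σ.point n (a.eval σ))).toNat)
  | edge (σ : MState) (a : Expr) :
      Exec f ω (Prog.edge a) σ (a.cost + 1 + (2 * n + 2))
        ((σ.setBlock (a.eval σ)
          (edgeBlock f (ω σ.draws).1.1 (ω σ.draws).1.2)).tick)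

/-- The initial state: `n`, the size `s`, and the rounded inverses `⌈1/ε⌉`, `⌈1/δ⌉` of the accuracy
and confidence parameters in the registers `0, 1, 2, 3`; everything else is zero. -/
noncomputable def initState (n s : ℕ) (ε δ : ℝ) : MState where
  reg := fun r => [n, s, ⌈1 / ε⌉₊, ⌈1 / δ⌉₊].getD r 0
  mem := fun _ => 0
  draws := 0

/-- Started on the parameters `s, ε, δ`, the program halts after `t` time units, with the
description of the decision tree `h` in memory, from the address given by register `0` on. -/
def Returns {n : ℕ} (f : Cube n → Bool) (ω : ℕ → Draw n) (P : Prog) (s : ℕ) (ε δ : ℝ)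
    (t : ℕ) (h : DTree n) : Prop :=
  ∃ σ : MState, Exec f ω P (initState n s ε δ) t σ ∧ σ.HasBlock (σ.reg 0) h.code

/-- The law of a sequence of independent random draws, each of them uniform. -/
noncomputable def drawLaw (n : ℕ) [NeZero n] : Measure (ℕ → Draw n) :=
  Measure.infinitePi fun _ => (PMF.uniformOfFintype (Draw n)).toMeasure

/-- The program `P` properly learns size-`s` decision trees over `{0,1}^n` under the uniform
distribution, to accuracy `ε` with confidence `1 - δ`, in time `T`: whenever the unknown function
is computed by a decision tree with at most `s` leaves, every run returns a decision tree within
time `T`, and with probability at least `1 - δ` that tree is an `ε`-approximation. -/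
def ProperlyLearns (P : Prog) (n : ℕ) [NeZero n] (s : ℕ) (ε δ T : ℝ) : Prop :=
  ∀ f : Cube n → Bool, (∃ g : DTree n, g.size ≤ s ∧ g.eval = f) →
    (∀ ω : ℕ → Draw n, ∃ (t : ℕ) (h : DTree n), Returns f ω P s ε δ t h ∧ (t : ℝ) ≤ T) ∧
    1 - δ ≤ (drawLaw n).real
      {ω | ∃ (t : ℕ) (h : DTree n), Returns f ω P s ε δ t h ∧ errorRate h.eval f ≤ ε}

/-! Call the fraction of points at which flipping a variable changes `f` its influence, and let g be
a tree of size s for `f`. Two operations make g shallow and free of weak variables. Fixing all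
variables of influence at most τ to suitable constants changes g on at most a fraction sτ of the
cube (`exists_mix`, by averaging over the constants and replacing one coordinate at a time). Cutting
at depth d costs at most s/2^d (`DTree.exists_truncation`). With τ = ε/(16s) and 2^d ≥ 16s/ε the
total error is at most ε/8 (`DTree.exists_approx`).

It is therefore enough to minimize the empirical error over trees of depth d on a set V that
contains all influential variables. V consists of the directions in which a sensitive edge has been
seen. A variable of influence above τ is missed by m draws with probability at most (1 - τ/n)^m. A
variable with a sensitive edge must be queried by g, so V has at most s elements on every run, which
makes the time bound deterministic. At most (2n)^(2^d) functions have trees of depth d. Exponential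
moments and a union bound over all of them, so that dependence between V and the sample is harmless,
separate error at most ε/8 from error at least ε by the empirical threshold ε/4 (`learning_bound`).

The minimizer is found by dynamic programming. The sequences of at most d literals over V form a
2|V|-ary heap, and each vertex records the sample points that satisfy its literals. The best tree of
the remaining depth at a vertex is a leaf, or a query whose subtrees are optimal at two children, so
one pass from the last vertex to the root solves the problem (`run_solveVertex`, `run_minimize`).
The heap has fewer than (2s)^(d+1) vertices. As d = log(s/ε) + O(1) and log(1/ε) ≥ 1, this is at
most a fixed power of the permitted bound (`growth_bounds`) once s ≥ 2. For s = 1 the bound no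
longer depends on ε, but then `f` is constant and one label suffices.

The machine part rests on `Run`, a total-correctness predicate with an exact rule for each
instruction and a variant rule for loops (`run_loop`). -/

/-! ### Program logic -/

/-- The program `P` halts from `σ`, in a time and a state that satisfy `Q`. -/
def Run {n : ℕ} (f : Cube n → Bool) (ω : ℕ → Draw n) (P : Prog) (σ : MState)
    (Q : ℕ → MState → Prop) : Prop :=
  ∃ t σ', Exec f ω P σ t σ' ∧ Q t σ'

namespace MState

variable (σ : MState) (r v a b : ℕ)

@[simp] theorem setReg_reg (r' : ℕ) :
    (σ.setReg r v).reg r' = if r' = r then v else σ.reg r' := by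
  simp [setReg, Function.update_apply]

@[simp] theorem setReg_mem : (σ.setReg r v).mem = σ.mem := rfl
@[simp] theorem setReg_draws : (σ.setReg r v).draws = σ.draws := rfl
@[simp] theorem setMem_reg : (σ.setMem a v).reg = σ.reg := rfl
@[simp] theorem setMem_draws : (σ.setMem a v).draws = σ.draws := rfl

@[simp] theorem setMem_mem : (σ.setMem a v).mem b = if b = a then v else σ.mem b := by
  simp [setMem, Function.update_apply]

@[simp] theorem tick_reg : σ.tick.reg = σ.reg := rfl
@[simp] theorem tick_mem : σ.tick.mem = σ.mem := rfl
@[simp] theorem tick_draws : σ.tick.draws = σ.draws + 1 := rfl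
@[simp] theorem setBlock_reg (L : List ℕ) : (σ.setBlock a L).reg = σ.reg := rfl
@[simp] theorem setBlock_draws (L : List ℕ) : (σ.setBlock a L).draws = σ.draws := rfl

theorem setBlock_mem (L : List ℕ) : (σ.setBlock a L).mem b =
    if a ≤ b ∧ b < a + L.length then L.getD (b - a) 0 else σ.mem b := rfl

/-- The states agree on the registers below `b`. -/
def Agree (b : ℕ) (σ τ : MState) : Prop := ∀ r < b, τ.reg r = σ.reg r

theorem Agree.rfl {b : ℕ} {σ : MState} : Agree b σ σ := fun _ _ => Eq.refl _

theorem Agree.trans {b : ℕ} {σ τ υ : MState} (h : Agree b σ τ) (h' : Agree b τ υ) :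
    Agree b σ υ := fun r hr => (h' r hr).trans (h r hr)

theorem Agree.mono {b c : ℕ} {σ τ : MState} (h : Agree b σ τ) (hc : c ≤ b) : Agree c σ τ :=
  fun r hr => h r (hr.trans_le hc)

theorem Agree.setReg {b : ℕ} {σ τ : MState} (h : Agree b σ τ) {r : ℕ} (hr : b ≤ r) (v : ℕ) :
    Agree b σ (τ.setReg r v) := fun r' hr' => by
  rw [setReg_reg, if_neg (by omega), h r' hr']

theorem Agree.setMem {b : ℕ} {σ τ : MState} (h : Agree b σ τ) (a v : ℕ) :
    Agree b σ (τ.setMem a v) := h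

end MState

section Run

variable {n : ℕ} {f : Cube n → Bool} {ω : ℕ → Draw n} {σ : MState} {Q R : ℕ → MState → Prop}

theorem Run.mono {P : Prog} (h : Run f ω P σ Q) (hQ : ∀ t τ, Q t τ → R t τ) : Run f ω P σ R := by
  obtain ⟨t, τ, h1, h2⟩ := h
  exact ⟨t, τ, h1, hQ t τ h2⟩

theorem run_skip : Run f ω Prog.skip σ Q ↔ Q 1 σ :=
  ⟨fun ⟨_, _, h, hQ⟩ => by cases h; exact hQ, fun h => ⟨_, _, Exec.skip σ, h⟩⟩

theorem run_set {r : ℕ} {e : Expr} :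
    Run f ω (Prog.set r e) σ Q ↔ Q (e.cost + 1) (σ.setReg r (e.eval σ)) :=
  ⟨fun ⟨_, _, h, hQ⟩ => by cases h; exact hQ, fun h => ⟨_, _, Exec.set σ r e, h⟩⟩

theorem run_store {a e : Expr} :
    Run f ω (Prog.store a e) σ Q ↔
      Q (a.cost + e.cost + 1) (σ.setMem (a.eval σ) (e.eval σ)) :=
  ⟨fun ⟨_, _, h, hQ⟩ => by cases h; exact hQ, fun h => ⟨_, _, Exec.store σ a e, h⟩⟩

theorem run_coin {r : ℕ} :
    Run f ω (Prog.coin r) σ Q ↔ Q 1 ((σ.setReg r (ω σ.draws).2.toNat).tick) :=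
  ⟨fun ⟨_, _, h, hQ⟩ => by cases h; exact hQ, fun h => ⟨_, _, Exec.coin σ r, h⟩⟩

theorem run_query {r : ℕ} {a : Expr} :
    Run f ω (Prog.query r a) σ Q ↔
      Q (a.cost + 1 + n) (σ.setReg r (f (σ.point n (a.eval σ))).toNat) :=
  ⟨fun ⟨_, _, h, hQ⟩ => by cases h; exact hQ, fun h => ⟨_, _, Exec.query σ r a, h⟩⟩

theorem run_edge {a : Expr} :
    Run f ω (Prog.edge a) σ Q ↔
      Q (a.cost + 1 + (2 * n + 2)) ((σ.setBlock (a.eval σ)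
          (edgeBlock f (ω σ.draws).1.1 (ω σ.draws).1.2)).tick) :=
  ⟨fun ⟨_, _, h, hQ⟩ => by cases h; exact hQ, fun h => ⟨_, _, Exec.edge σ a, h⟩⟩

theorem run_seq {p q : Prog} :
    Run f ω (Prog.seq p q) σ Q ↔
      Run f ω p σ fun t τ => Run f ω q τ fun t' τ' => Q (t + t') τ' :=
  ⟨fun ⟨_, _, h, hQ⟩ => by cases h with | seq h1 h2 => exact ⟨_, _, h1, _, _, h2, hQ⟩,
    fun ⟨_, _, h1, _, _, h2, hQ⟩ => ⟨_, _, Exec.seq h1 h2, hQ⟩⟩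

theorem run_ite {e : Expr} {p q : Prog} :
    Run f ω (Prog.ite e p q) σ Q ↔
      if e.eval σ ≠ 0 then Run f ω p σ fun t τ => Q (e.cost + 1 + t) τ
      else Run f ω q σ fun t τ => Q (e.cost + 1 + t) τ := by
  constructor
  · rintro ⟨_, _, h, hQ⟩
    cases h with
    | iteTrue he h => rw [if_pos he]; exact ⟨_, _, h, hQ⟩
    | iteFalse he h => rw [if_neg (not_not.2 he)]; exact ⟨_, _, h, hQ⟩
  · intro h
    split_ifs at h with he
    · obtain ⟨_, _, h, hQ⟩ := h
      exact ⟨_, _, Exec.iteTrue he h, hQ⟩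
    · obtain ⟨_, _, h, hQ⟩ := h
      exact ⟨_, _, Exec.iteFalse (not_not.1 he) h, hQ⟩

/-- A loop whose body decreases a variant takes at most (variant) times (body) steps. -/
theorem run_loop {e : Expr} {p : Prog} (Inv : ℕ → MState → Prop) (N T : ℕ)
    (hz : ∀ σ, Inv 0 σ → e.eval σ = 0)
    (hb : ∀ i < N, ∀ σ, Inv (i + 1) σ → e.eval σ ≠ 0 ∧
      Run f ω p σ fun t τ => t ≤ T ∧ Inv i τ) (h0 : Inv N σ) :
    Run f ω (Prog.loop e p) σ fun t τ =>
      t ≤ N * (T + e.cost + 1) + e.cost + 1 ∧ Inv 0 τ := by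
  induction N generalizing σ with
  | zero => exact ⟨_, _, Exec.loopDone (hz σ h0), by omega, h0⟩
  | succ N ih =>
    obtain ⟨hne, t, τ, h1, ht, h2⟩ := hb N (by omega) σ h0
    obtain ⟨t', τ', h3, ht', h4⟩ := ih (fun i hi => hb i (by omega)) h2
    refine ⟨_, _, Exec.loopStep hne h1 h3, ?_, h4⟩
    rw [Nat.succ_mul]
    omega

/-- The body is run with the register `r` going up from `0` to the value of the register `b`. -/
def Prog.forUp (r b : ℕ) (p : Prog) : Prog :=
  .seq (.set r (.const 0)) (.loop (.sub (.reg b) (.reg r))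
    (.seq p (.set r (.add (.reg r) (.const 1)))))

/-- The body is run with the register `r` going down from the value of the register `b`
to `0`. -/
def Prog.forDown (r b : ℕ) (p : Prog) : Prog :=
  .seq (.set r (.reg b)) (.loop (.reg r)
    (.seq (.set r (.sub (.reg r) (.const 1))) p))

/-- `run_loop` counts the passes that remain, so the invariant is used at `N - k`. A pass costs 8
units beyond its body: 4 for the test and 4 for the increment. -/
theorem run_forUp {r b : ℕ} {p : Prog} (Inv : ℕ → MState → Prop) (N T : ℕ)
    (hN : ∀ i ≤ N, ∀ τ, Inv i τ → τ.reg b = N ∧ τ.reg r = i)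
    (hb : ∀ i < N, ∀ τ, Inv i τ → Run f ω p τ fun t υ =>
      t ≤ T ∧ υ.reg r = i ∧ Inv (i + 1) (υ.setReg r (i + 1)))
    (h0 : Inv 0 (σ.setReg r 0)) :
    Run f ω (Prog.forUp r b p) σ fun t τ => t ≤ N * (T + 8) + 6 ∧ Inv N τ := by
  rw [Prog.forUp, run_seq, run_set]
  refine (run_loop (Inv := fun k τ => k ≤ N ∧ Inv (N - k) τ) N (T + 4) ?_ ?_ ?_).mono ?_
  · rintro τ ⟨-, h⟩
    obtain ⟨h1, h2⟩ := hN _ (by omega) τ h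
    simp [Expr.eval, h1, h2]
  · rintro k hk τ ⟨hk', h⟩
    obtain ⟨h1, h2⟩ := hN _ (by omega) τ h
    refine ⟨by simp only [Expr.eval, h1, h2]; omega, ?_⟩
    rw [run_seq]
    refine (hb _ (by omega) τ h).mono ?_
    rintro t υ ⟨ht, hr, hI⟩
    rw [run_set]
    refine ⟨by simp only [Expr.cost]; omega, by omega, ?_⟩
    simp only [Expr.eval, hr]
    rwa [show N - (k + 1) + 1 = N - k by omega] at hI ⊢
  · simpa [Expr.eval] using h0
  · rintro t τ ⟨ht, -, hI⟩
    simp only [Expr.cost] at ht ⊢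
    refine ⟨?_, by simpa using hI⟩
    have : N * (T + 4 + (1 + 1 + 1) + 1) = N * (T + 8) := by ring
    omega

/-- The counter is decremented before the body, which therefore sees `i` while the invariant passes
from `i + 1` to `i`. -/
theorem run_forDown {r b : ℕ} {p : Prog} (Inv : ℕ → MState → Prop) (N T : ℕ)
    (hσ : σ.reg b = N)
    (hN : ∀ i ≤ N, ∀ τ, Inv i τ → τ.reg r = i)
    (hb : ∀ i < N, ∀ τ, Inv (i + 1) τ → Run f ω p (τ.setReg r i) fun t υ =>
      t ≤ T ∧ Inv i υ)
    (h0 : Inv N (σ.setReg r N)) :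
    Run f ω (Prog.forDown r b p) σ fun t τ => t ≤ N * (T + 6) + 4 ∧ Inv 0 τ := by
  rw [Prog.forDown, run_seq, run_set]
  refine (run_loop (Inv := fun k τ => k ≤ N ∧ Inv k τ) N (T + 4) ?_ ?_ ?_).mono ?_
  · rintro τ ⟨-, h⟩
    simp [Expr.eval, hN 0 (by omega) τ h]
  · rintro k hk τ ⟨hk', h⟩
    have h2 := hN _ hk' τ h
    refine ⟨by simp [Expr.eval, h2], ?_⟩
    rw [run_seq, run_set]
    simp only [Expr.eval, h2, Nat.add_sub_cancel]
    refine (hb _ hk τ h).mono ?_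
    rintro t υ ⟨ht, hI⟩
    exact ⟨by simp only [Expr.cost]; omega, by omega, hI⟩
  · simp only [Expr.eval, hσ]
    exact ⟨le_rfl, h0⟩
  · rintro t τ ⟨ht, -, hI⟩
    simp only [Expr.cost] at ht ⊢
    refine ⟨?_, hI⟩
    have : N * (T + 4 + 1 + 1) = N * (T + 6) := by ring
    omega

end Run

/-! ### Decision trees -/

namespace DTree

variable {n : ℕ}

/-- The depth of a tree. -/
def depth : DTree n → ℕ
  | leaf _ => 0
  | node _ t₀ t₁ => max t₀.depth t₁.depth + 1

/-- The variables queried by a tree. -/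
def vars : DTree n → Finset (Fin n)
  | leaf _ => ∅
  | node i t₀ t₁ => insert i (t₀.vars ∪ t₁.vars)

theorem size_pos (t : DTree n) : 1 ≤ t.size := by
  induction t with
  | leaf b => exact le_rfl
  | node i t₀ t₁ h₀ h₁ => simp only [size]; omega

/-- A binary tree has one leaf more than it has queries. This bounds by `s` both the variables that
get fixed in the approximation and those that the search branches on. -/
theorem card_vars_lt (t : DTree n) : t.vars.card < t.size := by
  induction t with
  | leaf b => simp [vars, size]
  | node i t₀ t₁ h₀ h₁ =>
    have h1 := Finset.card_insert_le i (t₀.vars ∪ t₁.vars)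
    have h2 := Finset.card_union_le t₀.vars t₁.vars
    simp only [vars, size]
    omega

theorem length_code (t : DTree n) : t.code.length + 1 = 2 * t.size := by
  induction t with
  | leaf b => rfl
  | node i t₀ t₁ h₀ h₁ => simp only [code, size, List.length_cons, List.length_append]; omega

theorem size_le_two_pow (t : DTree n) {d : ℕ} (h : t.depth ≤ d) : t.size ≤ 2 ^ d := by
  induction t generalizing d with
  | leaf b => exact Nat.one_le_two_pow
  | node i t₀ t₁ h₀ h₁ =>
    simp only [depth] at h
    obtain ⟨d, rfl⟩ : ∃ e, d = e + 1 := ⟨d - 1, by omega⟩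
    have := h₀ (d := d) (by omega)
    have := h₁ (d := d) (by omega)
    simp only [size, pow_succ]
    omega

theorem eval_congr (t : DTree n) {x y : Cube n} (h : ∀ i ∈ t.vars, x i = y i) :
    t.eval x = t.eval y := by
  induction t with
  | leaf b => rfl
  | node i t₀ t₁ h₀ h₁ =>
    simp only [vars, Finset.mem_insert, Finset.mem_union] at h
    simp only [eval, h i (Or.inl rfl), h₀ fun j hj => h j (Or.inr (Or.inl hj)),
      h₁ fun j hj => h j (Or.inr (Or.inr hj))]

/-- The weight of the sample points that `t` misclassifies. -/
def miss (m : ℕ) (xs : ℕ → Cube n) (ys : ℕ → Bool) (mk : ℕ → ℕ) (t : DTree n) : ℕ :=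
  ∑ j ∈ Finset.range m, if t.eval (xs j) = ys j then 0 else mk j

variable {m : ℕ} {xs : ℕ → Cube n} {ys : ℕ → Bool} {mk mk₀ mk₁ : ℕ → ℕ}

/-- As marks are 0 or 1, truncated subtraction keeps a marked point marked in exactly one child, the
one to which the query sends it. Additivity of errors is what makes dynamic programming possible. -/
theorem miss_node {i : Fin n} (t₀ t₁ : DTree n) (h : ∀ j < m, mk j ≤ 1)
    (h₀ : ∀ j < m, mk₀ j = mk j - (xs j i).toNat)
    (h₁ : ∀ j < m, mk₁ j = mk j - (1 - (xs j i).toNat)) :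
    (node i t₀ t₁).miss m xs ys mk = t₀.miss m xs ys mk₀ + t₁.miss m xs ys mk₁ := by
  simp only [miss, ← Finset.sum_add_distrib]
  refine Finset.sum_congr rfl fun j hj => ?_
  rw [Finset.mem_range] at hj
  have := h j hj
  rw [h₀ j hj, h₁ j hj]
  cases hx : xs j i <;> simp only [eval, hx, Bool.toNat_true, Bool.toNat_false] <;>
    simp only [Bool.false_eq_true, if_false, if_true] <;> split_ifs <;> omega

theorem miss_leaf (b : Bool) (h : ∀ j < m, mk j ≤ 1) :
    (leaf b : DTree n).miss m xs ys mk =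
      ∑ j ∈ Finset.range m, (mk j - (if b then (ys j).toNat else 1 - (ys j).toNat)) := by
  refine Finset.sum_congr rfl fun j hj => ?_
  rw [Finset.mem_range] at hj
  have := h j hj
  cases b <;> cases hy : ys j <;> simp [eval] <;> omega

end DTree

/-! ### Empirical error minimization on the machine -/

/-- The shape of the data on which the search for the best tree works: `m` labelled sample points
`xs j`, `ys j` in blocks of length `w`, a list of `M` variables `vl k` at the address `VB`, and
from the address `NB` on a heap of vertices, each having a block of `W` cells, of which the first
`I` have children. -/
structure Shape (n : ℕ) where
  m : ℕ
  w : ℕ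
  VB : ℕ
  NB : ℕ
  M : ℕ
  I : ℕ
  W : ℕ
  xs : ℕ → Cube n
  ys : ℕ → Bool
  vl : ℕ → Fin n
  hw : n < w
  hVB : n + m * w ≤ VB
  hNB : VB + M ≤ NB
  hI : M = 0 → I ≤ 1
  hW : m + 3 ≤ W

namespace Shape

variable {n : ℕ} (S : Shape n)

/-- The address of the block of the vertex `v`. -/
def blk (v : ℕ) : ℕ := S.NB + v * S.W

theorem blk_succ (v : ℕ) : S.blk (v + 1) = S.blk v + S.W := by simp only [blk, Nat.succ_mul]; omega

theorem blk_add (v k : ℕ) : S.blk (v + k) = S.blk v + k * S.W := by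
  simp only [blk, Nat.add_mul]; omega

theorem blk_le {u v : ℕ} (h : u < v) : S.blk u + S.W ≤ S.blk v := by
  obtain ⟨k, rfl⟩ : ∃ k, v = (u + 1) + k := ⟨v - (u + 1), by omega⟩
  rw [blk_add, blk_succ]; omega

theorem NB_le (v : ℕ) : S.NB ≤ S.blk v := Nat.le_add_right _ _

theorem sample_lt {j k : ℕ} (hj : j < S.m) (hk : k ≤ n) :
    n + j * S.w + k < S.NB := by

  have h1 := S.hVB
  have h2 := S.hNB
  have h3 := S.hw
  have : (j + 1) * S.w ≤ S.m * S.w := Nat.mul_le_mul_right _ hj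
  rw [Nat.succ_mul] at this
  omega

/-- The data stand in registers and memory. -/
structure Data (σ : MState) : Prop where
  r0 : σ.reg 0 = n
  r9 : σ.reg 9 = S.m
  r10 : σ.reg 10 = S.w
  r11 : σ.reg 11 = S.VB
  r12 : σ.reg 12 = S.NB
  r13 : σ.reg 13 = S.M
  r15 : σ.reg 15 = S.I
  r17 : σ.reg 17 = S.W
  hx : ∀ j < S.m, ∀ k : Fin n, σ.mem (n + j * S.w + k) = (S.xs j k).toNat
  hy : ∀ j < S.m, σ.mem (n + j * S.w + n) = (S.ys j).toNat
  hv : ∀ k < S.M, σ.mem (S.VB + k) = S.vl k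

variable {S}

/-- The passes over the heap write only to registers from `18` on and to addresses from `NB` on, so
the data survive them. -/
theorem Data.congr {σ τ : MState} (h : S.Data σ) (ha : MState.Agree 18 σ τ)
    (hm : ∀ a < S.NB, τ.mem a = σ.mem a) : S.Data τ where
  r0 := (ha _ (by norm_num)).trans h.r0
  r9 := (ha _ (by norm_num)).trans h.r9
  r10 := (ha _ (by norm_num)).trans h.r10
  r11 := (ha _ (by norm_num)).trans h.r11
  r12 := (ha _ (by norm_num)).trans h.r12
  r13 := (ha _ (by norm_num)).trans h.r13
  r15 := (ha _ (by norm_num)).trans h.r15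
  r17 := (ha _ (by norm_num)).trans h.r17
  hx j hj k := (hm _ (S.sample_lt hj k.2.le)).trans (h.hx j hj k)
  hy j hj := (hm _ (S.sample_lt hj le_rfl)).trans (h.hy j hj)
  hv k hk := (hm _ (by have := S.hNB; omega)).trans (h.hv k hk)

end Shape

/-! ### Forward pass: the sample points that reach each vertex of the heap -/

section Programs

local notation "R" => Expr.reg
local notation "C" => Expr.const
local infixl:65 " ∔ " => Expr.add
local infixl:65 " ∸ " => Expr.sub
local infixr:60 " ;; " => Prog.seq

/-- Compute the marks of two children, that stand at the address in register `20`, from the marks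
of the parent, at the address in register `19`. -/
def splitMarks : Prog :=
  .set 22 (R 0 ∔ .load (R 11 ∔ R 21)) ;;
  .forUp 23 9 (
    .store (R 20 ∔ R 23) (.load (R 19 ∔ R 23) ∸ .load (R 22)) ;;
    .store (R 20 ∔ R 17 ∔ R 23) (.load (R 19 ∔ R 23) ∸ (C 1 ∸ .load (R 22))) ;;
    .set 22 (R 22 ∔ R 10))

/-- Compute the marks of all children of a vertex. -/
def expandVertex : Prog :=
  .forUp 21 13 (splitMarks ;; .set 20 (R 20 ∔ R 17 ∔ R 17))

/-- Compute the marks of all vertices. -/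
def expandAll : Prog :=
  .forUp 23 9 (.store (R 12 ∔ R 23) (C 1)) ;;
  .set 19 (R 12) ;;
  .set 20 (R 12 ∔ R 17) ;;
  .forUp 18 15 (expandVertex ;; .set 19 (R 19 ∔ R 17))

end Programs

section Forward

open Shape

variable {n : ℕ} {f : Cube n → Bool} {ω : ℕ → Draw n} {S : Shape n}

/-- Register `22` walks through the copies of one coordinate in the successive sample blocks. The
sample and the parent's marks lie below `c`, so nothing still to be read is overwritten. -/
theorem run_splitMarks {σ : MState} (hD : S.Data σ) {q c k : ℕ} (hq : σ.reg 19 = q)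
    (hc : σ.reg 20 = c) (hk : σ.reg 21 = k) (hkM : k < S.M) (hqc : q + S.m ≤ c)
    (hcN : S.NB ≤ c) :
    Run f ω splitMarks σ fun t τ => t ≤ S.m * 40 + 14 ∧ MState.Agree 22 σ τ ∧
      (∀ a < c, τ.mem a = σ.mem a) ∧
      ∀ j < S.m, τ.mem (c + j) = σ.mem (q + j) - (S.xs j (S.vl k)).toNat ∧
        τ.mem (c + S.W + j) = σ.mem (q + j) - (1 - (S.xs j (S.vl k)).toNat) := by
  rw [splitMarks, run_seq, run_set]
  refine (run_forUp (N := S.m) (T := 30) (fun j τ => MState.Agree 22 σ τ ∧ τ.reg 23 = j ∧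
      τ.reg 22 = n + j * S.w + S.vl k ∧
      (∀ a < c, τ.mem a = σ.mem a) ∧
      ∀ j' < j, τ.mem (c + j') = σ.mem (q + j') - (S.xs j' (S.vl k)).toNat ∧
        τ.mem (c + S.W + j') = σ.mem (q + j') - (1 - (S.xs j' (S.vl k)).toNat)) ?_ ?_ ?_).mono ?_
  · rintro i - τ ⟨ha, h23, -⟩
    exact ⟨(ha 9 (by norm_num)).trans hD.r9, h23⟩
  · rintro j hj τ ⟨ha, h23, h22, hm, hr⟩
    have hx : τ.mem (n + j * S.w + S.vl k) = (S.xs j (S.vl k)).toNat := by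
      rw [hm _ ((S.sample_lt hj (S.vl k).2.le).trans_le hcN), hD.hx j hj]
    have h19 : τ.reg 19 = q := (ha _ (by norm_num)).trans hq
    have h20 : τ.reg 20 = c := (ha _ (by norm_num)).trans hc
    have h17 : τ.reg 17 = S.W := (ha _ (by norm_num)).trans hD.r17
    have h10 : τ.reg 10 = S.w := (ha _ (by norm_num)).trans hD.r10
    have hqj : τ.mem (q + j) = σ.mem (q + j) := hm _ (by omega)
    have hW := S.hW
    have hne : q + j ≠ c + j := by omega
    have hne' : n + j * S.w + S.vl k ≠ c + j := by
      have := (S.sample_lt hj (S.vl k).2.le); omega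
    simp only [run_seq, run_store, run_set, Expr.eval, Expr.cost, MState.setMem_reg,
      MState.setReg_reg, MState.setMem_mem, MState.setReg_mem, h19, h20, h22, h23, h17, h10, hx, hqj,
      if_neg hne, if_neg hne']
    refine ⟨by norm_num, by simp, ?_, by simp, by simp; ring, ?_, ?_⟩
    · exact (((ha.setMem _ _).setMem _ _).setReg (by norm_num) _).setReg (by norm_num) _
    · intro a hac
      rw [if_neg (by omega), if_neg (by omega), hm a hac]
    · intro j' hj'
      rcases Nat.lt_succ_iff_lt_or_eq.1 hj' with h | rfl
      · rw [if_neg (by omega), if_neg (by omega), if_neg (by omega), if_neg (by omega)]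
        exact hr j' h
      · rw [if_neg (by omega), if_pos rfl, if_pos rfl]
        exact ⟨rfl, rfl⟩
  · refine ⟨(MState.Agree.rfl.setReg (by norm_num) _).setReg (by norm_num) _, by simp, ?_,
      fun _ _ => rfl, by simp⟩
    simp [Expr.eval, hD.r0, hD.r11, hk, hD.hv k hkM]
  · rintro t τ ⟨ht, ha, -, -, hm, hr⟩
    simp only [Expr.cost]
    exact ⟨by omega, ha, hm, hr⟩

theorem run_expandVertex {σ : MState} (hD : S.Data σ) {u v : ℕ} (hq : σ.reg 19 = S.blk u)
    (hc : σ.reg 20 = S.blk v) (huv : u < v) :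
    Run f ω expandVertex σ fun t τ => t ≤ S.M * (S.m * 40 + 28) + 6 ∧ MState.Agree 20 σ τ ∧
      τ.reg 20 = S.blk (v + 2 * S.M) ∧
      (∀ a < S.blk v, τ.mem a = σ.mem a) ∧
      ∀ k < S.M, ∀ j < S.m,
        τ.mem (S.blk (v + 2 * k) + j) =
          σ.mem (S.blk u + j) - (S.xs j (S.vl k)).toNat ∧
        τ.mem (S.blk (v + 2 * k + 1) + j) =
          σ.mem (S.blk u + j) - (1 - (S.xs j (S.vl k)).toNat) := by
  rw [expandVertex]
  have hblk := S.blk_le huv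
  have hNB := S.NB_le v
  have hW := S.hW
  refine (run_forUp (N := S.M) (T := S.m * 40 + 20) (fun k τ => MState.Agree 20 σ τ ∧
      τ.reg 21 = k ∧ τ.reg 20 = S.blk (v + 2 * k) ∧ (∀ a < S.blk v, τ.mem a = σ.mem a) ∧
      ∀ k' < k, ∀ j < S.m,
        τ.mem (S.blk (v + 2 * k') + j) =
          σ.mem (S.blk u + j) - (S.xs j (S.vl k')).toNat ∧
        τ.mem (S.blk (v + 2 * k' + 1) + j) =
          σ.mem (S.blk u + j) - (1 - (S.xs j (S.vl k')).toNat)) ?_ ?_ ?_).mono ?_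
  · rintro i - τ ⟨ha, h21, -⟩
    exact ⟨(ha 13 (by norm_num)).trans hD.r13, h21⟩
  · rintro k hk τ ⟨ha, h21, h20, hm, hr⟩
    rw [run_seq]
    have hDτ : S.Data τ := hD.congr (ha.mono (by norm_num)) fun a h => hm a (h.trans_le hNB)
    have hvk : S.blk v ≤ S.blk (v + 2 * k) := by rw [S.blk_add]; omega
    refine (run_splitMarks hDτ ((ha _ (by norm_num)).trans hq) h20 h21 hk
      (by omega) (by omega)).mono ?_
    rintro t υ ⟨ht, ha', hm', hr'⟩
    have h20' : υ.reg 20 = S.blk (v + 2 * k) := (ha' _ (by norm_num)).trans h20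
    have h17' : υ.reg 17 = S.W := (ha' _ (by norm_num)).trans hDτ.r17
    have h21' : υ.reg 21 = k := (ha' _ (by norm_num)).trans h21
    simp only [run_set, Expr.eval, Expr.cost, h20', h17']
    refine ⟨by omega, by simp [h21'], ?_, by simp, ?_, ?_, ?_⟩
    · exact ((ha.trans (ha'.mono (by norm_num))).setReg (by norm_num) _).setReg (by norm_num) _
    · simp only [MState.setReg_reg]
      norm_num
      rw [show v + 2 * (k + 1) = v + 2 * k + 1 + 1 by ring, S.blk_succ, S.blk_succ]
    · intro a h
      exact (hm' a (by omega)).trans (hm a h)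
    · intro k' hk' j hj
      simp only [MState.setReg_mem]
      have hqj : τ.mem (S.blk u + j) = σ.mem (S.blk u + j) := hm _ (by omega)
      rcases Nat.lt_succ_iff_lt_or_eq.1 hk' with h | rfl
      · have h1 := S.blk_le (show v + 2 * k' < v + 2 * k by omega)
        have h2 := S.blk_le (show v + 2 * k' + 1 < v + 2 * k by omega)
        rw [hm' _ (by omega), hm' _ (by omega)]
        exact hr k' h j hj
      · rw [S.blk_succ, ← hqj]
        exact hr' j hj
  · refine ⟨MState.Agree.rfl.setReg (by norm_num) _, by simp, by simpa using hc,
      fun _ _ => rfl, by simp⟩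
  · rintro t τ ⟨ht, ha, -, h20, hm, hr⟩
    exact ⟨ht, ha, h20, hm, hr⟩

/-- The marks `mk v j` of the vertices stand in memory, and those of the children refine those of
the parent. -/
structure Shape.Marked (S : Shape n) (mk : ℕ → ℕ → ℕ) : Prop where
  root : ∀ j < S.m, mk 0 j = 1
  child : ∀ u < S.I, ∀ k < S.M, ∀ j < S.m,
    mk (2 * S.M * u + 1 + 2 * k) j = mk u j - (S.xs j (S.vl k)).toNat ∧
    mk (2 * S.M * u + 1 + 2 * k + 1) j = mk u j - (1 - (S.xs j (S.vl k)).toNat)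

/-- The children of `u` are the `2M` vertices from `2Mu + 1` on, a pair for each listed variable.
Blocks are thus written consecutively, and a parent is complete before it is expanded. Register `20`
ends just past the last vertex, where the backward pass starts. -/
theorem run_expandAll {σ : MState} (hD : S.Data σ) :
    Run f ω expandAll σ fun t τ =>
      t ≤ S.I * (S.M * (S.m * 40 + 28) + 18) + S.m * 14 + 30 ∧ MState.Agree 18 σ τ ∧
      τ.reg 20 = S.blk (2 * S.M * S.I + 1) ∧
      (∀ a < S.NB, τ.mem a = σ.mem a) ∧
      S.Marked fun v j => τ.mem (S.blk v + j) := by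
  have hW := S.hW
  rw [expandAll, run_seq]
  refine (run_forUp (N := S.m) (T := 6) (fun j τ => MState.Agree 18 σ τ ∧ τ.reg 23 = j ∧
      (∀ a < S.NB, τ.mem a = σ.mem a) ∧ ∀ j' < j, τ.mem (S.NB + j') = 1) ?_ ?_ ?_).mono ?_
  · rintro i - τ ⟨ha, h23, -⟩
    exact ⟨(ha 9 (by norm_num)).trans hD.r9, h23⟩
  · rintro j hj τ ⟨ha, h23, hm, hr⟩
    have h12 : τ.reg 12 = S.NB := (ha _ (by norm_num)).trans hD.r12
    simp only [run_store, Expr.eval, Expr.cost, h12, h23]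
    refine ⟨by norm_num, by simpa, (ha.setMem _ _).setReg (by norm_num) _, by simp, ?_, ?_⟩
    · intro a h
      simp only [MState.setReg_mem, MState.setMem_mem]
      rw [if_neg (by omega), hm a h]
    · intro j' hj'
      simp only [MState.setReg_mem, MState.setMem_mem]
      split_ifs with h
      · rfl
      · exact hr j' (by omega)
  · exact ⟨MState.Agree.rfl.setReg (by norm_num) _, by simp, fun _ _ => rfl, by simp⟩
  rintro t0 τ ⟨ht0, ha, -, hm, hr⟩
  have h12 : τ.reg 12 = S.NB := (ha _ (by norm_num)).trans hD.r12
  have h17 : τ.reg 17 = S.W := (ha _ (by norm_num)).trans hD.r17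
  simp only [run_seq, run_set, Expr.eval, Expr.cost, h12, MState.setReg_reg, h17]
  refine (run_forUp (N := S.I) (T := S.M * (S.m * 40 + 28) + 10) (fun u υ =>
      MState.Agree 18 σ υ ∧ υ.reg 18 = u ∧ υ.reg 19 = S.blk u ∧
      υ.reg 20 = S.blk (2 * S.M * u + 1) ∧ (∀ a < S.NB, υ.mem a = σ.mem a) ∧
      (∀ j < S.m, υ.mem (S.blk 0 + j) = 1) ∧
      ∀ u' < u, ∀ k < S.M, ∀ j < S.m,
        υ.mem (S.blk (2 * S.M * u' + 1 + 2 * k) + j) =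
          υ.mem (S.blk u' + j) - (S.xs j (S.vl k)).toNat ∧
        υ.mem (S.blk (2 * S.M * u' + 1 + 2 * k + 1) + j) =
          υ.mem (S.blk u' + j) - (1 - (S.xs j (S.vl k)).toNat)) ?_ ?_ ?_).mono ?_
  · rintro i - υ ⟨ha, h18, -⟩
    exact ⟨(ha 15 (by norm_num)).trans hD.r15, h18⟩
  · rintro u hu υ ⟨ha, h18, h19, h20, hm, h0, hr⟩
    -- Vertices up to `u` precede the children of `u`. If no variable is listed, this holds because
    -- `hI` allows only the root to be expanded.
    have hu' : ∀ u' ≤ u, u' < 2 * S.M * u + 1 := by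
      intro u' hu'
      rcases Nat.eq_zero_or_pos S.M with h | h
      · have := S.hI h; omega
      · nlinarith
    rw [run_seq]
    have hDυ : S.Data υ := hD.congr ha hm
    refine (run_expandVertex hDυ h19 h20 (hu' u le_rfl)).mono ?_
    rintro t ρ ⟨ht, ha', h20', hm', hr'⟩
    have h19' : ρ.reg 19 = S.blk u := (ha' _ (by norm_num)).trans h19
    have h18' : ρ.reg 18 = u := (ha' _ (by norm_num)).trans h18
    have h17' : ρ.reg 17 = S.W := (ha' _ (by norm_num)).trans hDυ.r17
    have hold : ∀ u' ≤ u, ∀ j < S.m, ρ.mem (S.blk u' + j) = υ.mem (S.blk u' + j) := by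
      intro u' hu'' j hj
      have := S.blk_le (hu' u' hu'')
      exact hm' _ (by omega)
    simp only [run_set, Expr.eval, Expr.cost, h19', h17']
    refine ⟨by omega, by simp [h18'], ?_, by simp, ?_, ?_, ?_, ?_, ?_⟩
    · exact ((ha.trans (ha'.mono (by norm_num))).setReg (by norm_num) _).setReg (by norm_num) _
    · simp [S.blk_succ]
    · simp only [MState.setReg_reg]
      norm_num
      rw [h20']
      congr 1
      ring
    · intro a h
      exact (hm' a (h.trans_le (S.NB_le _))).trans (hm a h)
    · intro j hj
      exact (hold 0 (Nat.zero_le _) j hj).trans (h0 j hj)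
    · intro u' hu'' k hk j hj
      simp only [MState.setReg_mem]
      rcases Nat.lt_succ_iff_lt_or_eq.1 hu'' with h | rfl
      · have hlt : 2 * S.M * u' + 1 + 2 * k + 1 < 2 * S.M * u + 1 := by nlinarith
        have h1 := S.blk_le hlt
        have h2 := S.blk_le ((Nat.lt_succ_self _).trans hlt)
        rw [hold u' h.le j hj, hm' _ (by omega), hm' _ (by omega)]
        exact hr u' h k hk j hj
      · rw [hold u' le_rfl j hj]
        exact hr' k hk j hj
  · refine ⟨?_, by simp, by simp [Shape.blk], by simp [Shape.blk], hm, ?_, by simp⟩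
    · exact ((ha.setReg (by norm_num) _).setReg (by norm_num) _).setReg (by norm_num) _
    · simpa [Shape.blk] using hr
  · rintro t υ ⟨ht, ha, -, -, h20, hm, h0, hr⟩
    refine ⟨?_, ha, h20, hm, h0, hr⟩
    have : S.I * (S.M * (S.m * 40 + 28) + 10 + 8) = S.I * (S.M * (S.m * 40 + 28) + 18) := by ring
    omega

end Forward

/-! ### Backward pass: optimal trees by dynamic programming -/

section Programs

local notation "R" => Expr.reg
local notation "C" => Expr.const
local infixl:65 " ∔ " => Expr.add
local infixl:65 " ∸ " => Expr.sub
local infixr:60 " ;; " => Prog.seq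

/-- Copy a block from the address in register `24` to the address in register `25`; its length is
in register `26`. -/
def copyBlock : Prog :=
  .forUp 27 26 (.store (R 25 ∔ R 27) (.load (R 24 ∔ R 27)))

/-- Write the better one of the two leaves, with its error, into the block of a vertex. -/
def bestLeaf : Prog :=
  .set 22 (R 0 ∔ R 0) ;;
  .set 24 (C 0) ;;
  .set 25 (C 0) ;;
  .forUp 23 9 (
    .set 24 (R 24 ∔ (.load (R 19 ∔ R 23) ∸ .load (R 22))) ;;
    .set 25 (R 25 ∔ (.load (R 19 ∔ R 23) ∸ (C 1 ∸ .load (R 22)))) ;;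
    .set 22 (R 22 ∔ R 10)) ;;
  .ite (R 25 ∸ R 24)
    (.store (R 19 ∔ R 9) (R 24) ;; .store (R 19 ∔ R 9 ∔ C 2) (C 1))
    (.store (R 19 ∔ R 9) (R 25) ;; .store (R 19 ∔ R 9 ∔ C 2) (C 0)) ;;
  .store (R 19 ∔ R 9 ∔ C 1) (C 1)

/-- Replace the tree of a vertex by the one made of the trees of two children, if that has a
smaller error. -/
def trySplit : Prog :=
  .set 22 (.load (R 20 ∔ R 9) ∔ .load (R 20 ∔ R 17 ∔ R 9)) ;;
  .ite (.load (R 19 ∔ R 9) ∸ R 22)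
    (.store (R 19 ∔ R 9) (R 22) ;;
    .store (R 19 ∔ R 9 ∔ C 2) (.load (R 11 ∔ R 21) ∔ C 2) ;;
    .set 24 (R 20 ∔ R 9 ∔ C 2) ;;
    .set 25 (R 19 ∔ R 9 ∔ C 3) ;;
    .set 26 (.load (R 20 ∔ R 9 ∔ C 1)) ;;
    copyBlock ;;
    .set 25 (R 25 ∔ R 26) ;;
    .set 24 (R 20 ∔ R 17 ∔ R 9 ∔ C 2) ;;
    .set 26 (.load (R 20 ∔ R 17 ∔ R 9 ∔ C 1)) ;;
    copyBlock ;;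
    .store (R 19 ∔ R 9 ∔ C 1) (R 25 ∔ R 26 ∸ (R 19 ∔ R 9 ∔ C 2)))
    .skip

/-- Try all splits of a vertex. -/
def trySplits : Prog :=
  .forDown 21 13 (.set 20 (R 20 ∸ R 17 ∸ R 17) ;; trySplit)

/-- Compute the trees of all vertices, from the last one to the root. -/
def minimize : Prog :=
  .set 19 (R 20) ;;
  .forDown 18 16 (
    .set 19 (R 19 ∸ R 17) ;;
    bestLeaf ;;
    .ite (R 15 ∸ R 18) trySplits .skip)

/-- Find the best tree and return it. -/
def searchTree : Prog :=
  expandAll ;; minimize ;; .set 0 (R 12 ∔ R 9 ∔ C 2)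

end Programs

section Backward

variable {n : ℕ} {f : Cube n → Bool} {ω : ℕ → Draw n} {S : Shape n}

/-- The target ends before the source begins, so no cell is overwritten before it is read. -/
theorem run_copyBlock {σ : MState} {src dst : ℕ} {L : List ℕ} (h24 : σ.reg 24 = src)
    (h25 : σ.reg 25 = dst) (h26 : σ.reg 26 = L.length) (hL : σ.HasBlock src L)
    (hd : dst + L.length ≤ src) :
    Run f ω copyBlock σ fun t τ => t ≤ L.length * 16 + 6 ∧ MState.Agree 27 σ τ ∧
      (∀ a, a < dst ∨ dst + L.length ≤ a → τ.mem a = σ.mem a) ∧ τ.HasBlock dst L := by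
  rw [copyBlock]
  refine (run_forUp (N := L.length) (T := 8) (fun k τ => MState.Agree 27 σ τ ∧ τ.reg 27 = k ∧
      (∀ a, a < dst ∨ dst + L.length ≤ a → τ.mem a = σ.mem a) ∧
      ∀ k' < k, τ.mem (dst + k') = L.getD k' 0) ?_ ?_ ?_).mono ?_
  · rintro i - τ ⟨ha, h27, -⟩
    exact ⟨(ha 26 (by norm_num)).trans h26, h27⟩
  · rintro k hk τ ⟨ha, h27, hm, hr⟩
    have h24' : τ.reg 24 = src := (ha _ (by norm_num)).trans h24
    have h25' : τ.reg 25 = dst := (ha _ (by norm_num)).trans h25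
    simp only [run_store, Expr.eval, Expr.cost, h24', h25', h27]
    refine ⟨by norm_num, by simpa, (ha.setMem _ _).setReg (by norm_num) _, by simp, ?_, ?_⟩
    · intro a h
      simp only [MState.setReg_mem, MState.setMem_mem]
      rw [if_neg (by omega), hm a h]
    · intro k' hk'
      simp only [MState.setReg_mem, MState.setMem_mem]
      rcases Nat.lt_succ_iff_lt_or_eq.1 hk' with h | rfl
      · rw [if_neg (by omega), hr k' h]
      · rw [if_pos rfl, hm _ (by omega), hL _ hk]
  · exact ⟨MState.Agree.rfl.setReg (by norm_num) _, by simp, fun _ _ => rfl, by simp⟩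
  · rintro t τ ⟨ht, ha, -, hm, hr⟩
    exact ⟨by omega, ha, hm, hr⟩

/-- The tree `t` and its error stand in the block at `q`. -/
structure Shape.Stored (S : Shape n) (σ : MState) (mk : ℕ → ℕ) (q : ℕ) (t : DTree n) : Prop where
  err : σ.mem (q + S.m) = t.miss S.m S.xs S.ys mk
  len : σ.mem (q + S.m + 1) = t.code.length
  code : σ.HasBlock (q + S.m + 2) t.code
  fits : S.m + 2 + t.code.length ≤ S.W

theorem Shape.Stored.congr {σ τ : MState} {mk : ℕ → ℕ} {q : ℕ} {t : DTree n}
    (h : S.Stored σ mk q t) (hm : ∀ a, q + S.m ≤ a → a < q + S.W → τ.mem a = σ.mem a) :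
    S.Stored τ mk q t where
  err := by have := S.hW; rw [hm _ (by omega) (by omega), h.err]
  len := by have := S.hW; rw [hm _ (by omega) (by omega), h.len]
  code k hk := by have := h.fits; rw [hm _ (by omega) (by omega), h.code k hk]
  fits := h.fits

/-- Registers `24` and `25` accumulate the errors of the leaves `true` and `false`: truncated
subtraction removes the points that the leaf labels correctly. -/
theorem run_bestLeaf {σ : MState} (hD : S.Data σ) {q : ℕ} (hq : σ.reg 19 = q)
    {mk : ℕ → ℕ} (hmk : ∀ j < S.m, σ.mem (q + j) = mk j) (h1 : ∀ j < S.m, mk j ≤ 1) :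
    Run f ω bestLeaf σ fun t τ => t ≤ S.m * 45 + 60 ∧ MState.Agree 20 σ τ ∧
      τ.reg 20 = σ.reg 20 ∧
      (∀ a, a < q + S.m ∨ q + S.W ≤ a → τ.mem a = σ.mem a) ∧
      ∃ b, S.Stored τ mk q (.leaf b) ∧ ∀ b', (DTree.leaf b : DTree n).miss S.m S.xs S.ys mk ≤
        (DTree.leaf b' : DTree n).miss S.m S.xs S.ys mk := by
  have hW := S.hW
  simp only [bestLeaf, run_seq, run_set]
  refine (run_forUp (N := S.m) (T := 35) (fun j τ => MState.Agree 22 σ τ ∧ τ.reg 23 = j ∧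
      τ.reg 22 = n + j * S.w + n ∧ τ.mem = σ.mem ∧
      τ.reg 24 = ∑ j' ∈ Finset.range j, (mk j' - (S.ys j').toNat) ∧
      τ.reg 25 = ∑ j' ∈ Finset.range j, (mk j' - (1 - (S.ys j').toNat))) ?_ ?_ ?_).mono ?_
  · rintro i - τ ⟨ha, h23, -⟩
    exact ⟨(ha 9 (by norm_num)).trans hD.r9, h23⟩
  · rintro j hj τ ⟨ha, h23, h22, hm, h24, h25⟩
    have h19 : τ.reg 19 = q := (ha _ (by norm_num)).trans hq
    have h10 : τ.reg 10 = S.w := (ha _ (by norm_num)).trans hD.r10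
    simp only [run_seq, run_set, Expr.eval, Expr.cost, MState.setReg_reg, MState.setReg_mem,
      h19, h22, h23, h10, h24, h25, hm, hmk j hj, hD.hy j hj]
    refine ⟨by norm_num, by simp, ?_, by simp, by simp; ring, trivial, ?_, ?_⟩
    · exact (((ha.setReg (by norm_num) _).setReg (by norm_num) _).setReg (by norm_num) _).setReg
        (by norm_num) _
    · rw [Finset.sum_range_succ]; simp
    · rw [Finset.sum_range_succ]; simp [hmk j hj, hD.hy j hj]
  · refine ⟨?_, by simp, by simp [Expr.eval, hD.r0], by simp, by simp [Expr.eval],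
      by simp [Expr.eval]⟩
    exact (((MState.Agree.rfl.setReg (by norm_num) _).setReg (by norm_num) _).setReg
      (by norm_num) _).setReg (by norm_num) _
  rintro t τ ⟨ht, ha, -, -, hm, h24, h25⟩
  have h19 : τ.reg 19 = q := (ha _ (by norm_num)).trans hq
  have h9 : τ.reg 9 = S.m := (ha _ (by norm_num)).trans hD.r9
  have h20 : τ.reg 20 = σ.reg 20 := ha _ (by norm_num)
  have e1 := DTree.miss_leaf (n := n) (xs := S.xs) (ys := S.ys) true h1
  have e0 := DTree.miss_leaf (n := n) (xs := S.xs) (ys := S.ys) false h1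
  simp only [if_true, Bool.false_eq_true, if_false] at e0 e1
  rw [← e1] at h24
  rw [← e0] at h25
  rw [run_ite]
  split_ifs with hc
  all_goals
    simp only [run_seq, run_store, Expr.eval, Expr.cost, MState.setMem_reg,
      h19, h9, h24, h25] at hc ⊢
    refine ⟨by omega, ha.mono (by norm_num), h20, fun a h => ?_, ?_⟩
    · simp only [MState.setMem_mem, hm]
      rw [if_neg (by omega), if_neg (by omega), if_neg (by omega)]
  · refine ⟨true, ⟨?_, ?_, ?_, by simp [DTree.code]; omega⟩, ?_⟩
    · simp
    · simp [DTree.code]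
    · intro k hk
      have : k = 0 := by simpa [DTree.code] using hk
      subst this
      simp [DTree.code]
    · rintro (_ | _)
      · omega
      · exact le_rfl
  · refine ⟨false, ⟨?_, ?_, ?_, by simp [DTree.code]; omega⟩, ?_⟩
    · simp
    · simp [DTree.code]
    · intro k hk
      have : k = 0 := by simpa [DTree.code] using hk
      subst this
      simp [DTree.code]
    · rintro (_ | _)
      · exact le_rfl
      · omega

/-- In preorder the code of a node is its query followed by the two codes of the subtrees, so two
copies assemble it. The vertex's block lies below the children's blocks, which stay intact. If the
node is no improvement, the stored tree already satisfies both inequalities. -/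
theorem run_trySplit {σ : MState} (hD : S.Data σ) {q c k : ℕ} (hq : σ.reg 19 = q)
    (hc : σ.reg 20 = c) (hk : σ.reg 21 = k) (hkM : k < S.M) (hqN : S.NB ≤ q)
    (hqc : q + S.W ≤ c) {mk mk₀ mk₁ : ℕ → ℕ} {t t₀ t₁ : DTree n} (hS : S.Stored σ mk q t)
    (hS₀ : S.Stored σ mk₀ c t₀) (hS₁ : S.Stored σ mk₁ (c + S.W) t₁)
    (hfit : S.m + 2 + (t₀.code.length + t₁.code.length + 1) ≤ S.W)
    (hnode : (DTree.node (S.vl k) t₀ t₁).miss S.m S.xs S.ys mk =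
      t₀.miss S.m S.xs S.ys mk₀ + t₁.miss S.m S.xs S.ys mk₁) {d : ℕ} (hd : t.depth ≤ d)
    (hd' : (DTree.node (S.vl k) t₀ t₁).depth ≤ d) :
    Run f ω trySplit σ fun T τ => T ≤ S.W * 16 + 120 ∧ MState.Agree 22 σ τ ∧
      (∀ a, a < q + S.m ∨ q + S.W ≤ a → τ.mem a = σ.mem a) ∧
      ∃ t' : DTree n, t'.depth ≤ d ∧ S.Stored τ mk q t' ∧
        t'.miss S.m S.xs S.ys mk ≤ t.miss S.m S.xs S.ys mk ∧
        t'.miss S.m S.xs S.ys mk ≤ (DTree.node (S.vl k) t₀ t₁).miss S.m S.xs S.ys mk := by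
  have hvl := S.hNB
  simp only [trySplit, run_seq, run_set]
  rw [run_ite]
  split_ifs with hcond
  · simp only [run_seq, run_store, run_set, Expr.eval, Expr.cost, MState.setMem_reg,
      MState.setReg_reg, MState.setMem_mem, MState.setReg_mem, hq, hc, hk, hD.r9, hD.r17, hD.r11,
      hS₀.err, hS₁.err] at hcond ⊢
    norm_num at hcond ⊢
    rw [hS.err] at hcond
    have hv : σ.mem (S.VB + k) = S.vl k := hD.hv k hkM
    rw [if_neg (show S.VB + k ≠ q + S.m by omega), hv]
    refine (run_copyBlock (L := t₀.code) (src := c + S.m + 2) (dst := q + S.m + 3)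
      (by simp) (by simp) ?_ ?_ (by omega)).mono ?_
    · simp only [MState.setReg_reg, if_true]
      rw [if_neg (by omega), if_neg (by omega), hS₀.len]
    · intro k' hk'
      simp only [MState.setReg_mem, MState.setMem_mem]
      rw [if_neg (by omega), if_neg (by omega), hS₀.code k' hk']
    rintro T1 τ ⟨hT1, ha, hm, hL⟩
    have a9 : τ.reg 9 = S.m := (ha 9 (by norm_num)).trans (by simp [hD.r9])
    have a17 : τ.reg 17 = S.W := (ha 17 (by norm_num)).trans (by simp [hD.r17])
    have a19 : τ.reg 19 = q := (ha 19 (by norm_num)).trans (by simp [hq])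
    have a20 : τ.reg 20 = c := (ha 20 (by norm_num)).trans (by simp [hc])
    have a25 : τ.reg 25 = q + S.m + 3 := (ha 25 (by norm_num)).trans (by simp)
    have a26 : τ.reg 26 = t₀.code.length := by
      rw [ha 26 (by norm_num)]
      simp only [MState.setReg_reg, if_true]
      rw [if_neg (by omega), if_neg (by omega), hS₀.len]
    have hmem : ∀ a, q + S.W ≤ a → τ.mem a = σ.mem a := by
      intro a h
      rw [hm a (by omega)]
      simp only [MState.setReg_mem, MState.setMem_mem]
      rw [if_neg (by omega), if_neg (by omega)]
    simp only [a9, a17, a20, a25, a26]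
    refine (run_copyBlock (L := t₁.code) (src := c + S.W + S.m + 2)
      (dst := q + S.m + 3 + t₀.code.length) (by simp) (by simp) ?_ ?_ (by omega)).mono ?_
    · simp only [MState.setReg_reg, if_true]
      rw [hmem _ (by omega), hS₁.len]
    · intro k' hk'
      simp only [MState.setReg_mem]
      rw [hmem _ (by omega), hS₁.code k' hk']
    rintro T2 υ ⟨hT2, ha', hm', hL'⟩
    have b9 : υ.reg 9 = S.m := (ha' 9 (by norm_num)).trans (by simp [a9])
    have b19 : υ.reg 19 = q := (ha' 19 (by norm_num)).trans (by simp [a19])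
    have b25 : υ.reg 25 = q + S.m + 3 + t₀.code.length := (ha' 25 (by norm_num)).trans (by simp)
    have b26 : υ.reg 26 = t₁.code.length := by
      rw [ha' 26 (by norm_num)]
      simp only [MState.setReg_reg, if_true]
      rw [hmem _ (by omega), hS₁.len]
    have hlow : ∀ a, a < q + S.m + 3 → υ.mem a = if a = q + S.m + 2 then (S.vl k : ℕ) + 2
        else if a = q + S.m then t₀.miss S.m S.xs S.ys mk₀ + t₁.miss S.m S.xs S.ys mk₁
        else σ.mem a := by
      intro a h
      rw [hm' a (by omega)]
      simp only [MState.setReg_mem]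
      rw [hm a (by omega)]
      simp
    have hmid : υ.HasBlock (q + S.m + 3) t₀.code := by
      intro k' hk'
      rw [hm' _ (by omega)]
      exact hL k' hk'
    refine ⟨by omega, ?_, ?_, .node (S.vl k) t₀ t₁, hd', ⟨?_, ?_, ?_, ?_⟩, by omega, le_rfl⟩
    · intro r hr
      rw [MState.setMem_reg, ha' r (by omega)]
      simp only [MState.setReg_reg]
      rw [if_neg (by omega), if_neg (by omega), if_neg (by omega), ha r (by omega)]
      simp only [MState.setReg_reg, MState.setMem_reg]
      rw [if_neg (by omega), if_neg (by omega), if_neg (by omega), if_neg (by omega)]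
    · intro a h
      simp only [b19, b9]
      rw [if_neg (by omega)]
      rcases h with h | h
      · rw [hlow a (by omega), if_neg (by omega), if_neg (by omega)]
      · rw [hm' a (by omega)]
        exact hmem a h
    · simp only [MState.setMem_mem, b19, b9]
      rw [if_neg (by omega), hlow _ (by omega), if_neg (by omega), if_pos rfl, hnode]
    · simp only [MState.setMem_mem, b19, b9, if_true, b25, b26, DTree.code, List.length_cons,
        List.length_append]
      omega
    · intro k' hk'
      simp only [MState.setMem_mem, b19, b9]
      rw [if_neg (by omega)]
      simp only [DTree.code, List.length_cons, List.length_append] at hk'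
      rcases k' with _ | k'
      · rw [hlow _ (by omega), if_pos rfl]
        simp [DTree.code]
      · simp only [DTree.code, List.getD_cons_succ]
        by_cases hlt : k' < t₀.code.length
        · rw [List.getD_append _ _ _ _ hlt, ← hmid k' hlt]
          congr 1; omega
        · rw [List.getD_append_right _ _ _ _ (by omega), ← hL' (k' - t₀.code.length) (by omega)]
          congr 1; omega
    · simpa [DTree.code] using hfit
  · simp only [Expr.eval, MState.setReg_reg, MState.setReg_mem, hq, hc, hD.r9, hD.r17,
      hS₀.err, hS₁.err] at hcond
    norm_num at hcond
    rw [hS.err] at hcond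
    rw [run_skip]
    refine ⟨by simp only [Expr.cost]; omega, MState.Agree.rfl.setReg (by norm_num) _,
      fun _ _ => rfl, t, hd, hS.congr fun _ _ _ => rfl, le_rfl, ?_⟩
    rw [hnode]
    omega

/-- Going down through the variables, register `20` retreats over the pairs of children and stops at
the first one, exactly where the children of the preceding vertex end. -/
theorem run_trySplits {σ : MState} (hD : S.Data σ) {v u : ℕ} (hq : σ.reg 19 = S.blk v)
    (hc : σ.reg 20 = S.blk (u + 2 * S.M)) (huv : v < u) {mk : ℕ → ℕ → ℕ} {t : DTree n}
    (hS : S.Stored σ (mk v) (S.blk v) t) {T : ℕ → DTree n} {h d : ℕ} (hd : h < d)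
    (hWd : S.m + 2 + 2 * 2 ^ d ≤ S.W) (hT : ∀ k < 2 * S.M, (T k).depth ≤ h)
    (ht : t.depth ≤ h + 1)
    (hTS : ∀ k < 2 * S.M, S.Stored σ (mk (u + k)) (S.blk (u + k)) (T k))
    (hnode : ∀ k < S.M, ∀ t₀ t₁, (DTree.node (S.vl k) t₀ t₁).miss S.m S.xs S.ys (mk v) =
      t₀.miss S.m S.xs S.ys (mk (u + 2 * k)) + t₁.miss S.m S.xs S.ys (mk (u + 2 * k + 1))) :
    Run f ω trySplits σ fun s τ => s ≤ S.M * (S.W * 16 + 140) + 4 ∧ MState.Agree 20 σ τ ∧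
      τ.reg 20 = S.blk u ∧
      (∀ a, a < S.blk v + S.m ∨ S.blk v + S.W ≤ a → τ.mem a = σ.mem a) ∧
      ∃ t' : DTree n, t'.depth ≤ h + 1 ∧ S.Stored τ (mk v) (S.blk v) t' ∧
        t'.miss S.m S.xs S.ys (mk v) ≤ t.miss S.m S.xs S.ys (mk v) ∧
        ∀ k < S.M, t'.miss S.m S.xs S.ys (mk v) ≤
          (DTree.node (S.vl k) (T (2 * k)) (T (2 * k + 1))).miss S.m S.xs S.ys (mk v) := by
  rw [trySplits]
  have hblk := S.blk_le huv
  have hNB := S.NB_le v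
  refine (run_forDown (N := S.M) (T := S.W * 16 + 130) (fun k τ => MState.Agree 20 σ τ ∧
      τ.reg 21 = k ∧ τ.reg 20 = S.blk (u + 2 * k) ∧
      (∀ a, a < S.blk v + S.m ∨ S.blk v + S.W ≤ a → τ.mem a = σ.mem a) ∧
      ∃ t' : DTree n, t'.depth ≤ h + 1 ∧ S.Stored τ (mk v) (S.blk v) t' ∧
        t'.miss S.m S.xs S.ys (mk v) ≤ t.miss S.m S.xs S.ys (mk v) ∧
        ∀ k' < S.M, k ≤ k' → t'.miss S.m S.xs S.ys (mk v) ≤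
          (DTree.node (S.vl k') (T (2 * k')) (T (2 * k' + 1))).miss S.m S.xs S.ys (mk v))
      hD.r13 (fun i _ τ h => h.2.1) ?_ ?_).mono ?_
  · rintro k hk τ ⟨ha, h21, h20, hm, t', ht', hSt, hle, hall⟩
    have hDτ : S.Data τ := hD.congr (ha.mono (by norm_num)) fun a h => hm a (by omega)
    rw [run_seq, run_set]
    have hb : τ.reg 20 - S.W - S.W = S.blk (u + 2 * k) := by
      rw [h20, show u + 2 * (k + 1) = u + 2 * k + 1 + 1 by ring, S.blk_succ, S.blk_succ]
      omega
    have hu1 := S.blk_le (show v < u + 2 * k by omega)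
    have hu2 := S.blk_le (show v < u + 2 * k + 1 by omega)
    have hnd : (DTree.node (S.vl k) (T (2 * k)) (T (2 * k + 1))).depth ≤ h + 1 := by
      have := hT (2 * k) (by omega)
      have := hT (2 * k + 1) (by omega)
      simp only [DTree.depth]; omega
    -- The new tree has at most `2 ^ d` leaves, hence a code shorter than `2 * 2 ^ d`, which fits
    -- into the block by `hWd`.
    have hsz := DTree.size_le_two_pow _ (hnd.trans (show h + 1 ≤ d from hd))
    have hlen := DTree.length_code (DTree.node (S.vl k) (T (2 * k)) (T (2 * k + 1)))
    simp only [DTree.code, List.length_cons, List.length_append] at hlen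
    refine (run_trySplit (q := S.blk v) (c := S.blk (u + 2 * k)) (k := k) (mk := mk v)
      (mk₀ := mk (u + 2 * k)) (mk₁ := mk (u + 2 * k + 1)) (t := t') (t₀ := T (2 * k))
      (t₁ := T (2 * k + 1)) (d := h + 1) ?_ ?_ ?_ ?_ hk hNB hu1 ?_ ?_ ?_ (by omega)
      (hnode k hk _ _) ht' hnd).mono ?_
    · exact hDτ.congr ((MState.Agree.rfl.setReg (by norm_num) _).setReg (by norm_num) _)
        fun _ _ => rfl
    · simpa using (ha _ (by norm_num)).trans hq
    · simp [Expr.eval, hDτ.r17, hb]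
    · simp
    · exact hSt.congr fun _ _ _ => rfl
    · exact (hTS (2 * k) (by omega)).congr fun a h1 _ => hm a (by omega)
    · rw [← S.blk_succ] 
      exact (hTS (2 * k + 1) (by omega)).congr fun a h1 _ => hm a
        (by rw [← Nat.add_assoc] at h1; omega)
    · rintro s υ ⟨hs, ha', hm', t'', hd'', hS'', hle1, hle2⟩
      simp only [Expr.cost]
      refine ⟨by omega, ?_, ?_, ?_, ?_, t'', hd'', hS'', hle1.trans hle, ?_⟩
      · refine MState.Agree.trans ?_ (ha'.mono (by norm_num))
        exact (ha.setReg (by norm_num) _).setReg (by norm_num) _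
      · rw [ha' _ (by norm_num)]; simp
      · rw [ha' _ (by norm_num)]; simp [Expr.eval, hDτ.r17, hb]
      · intro a h
        rw [hm' a h]
        exact hm a h
      · intro k' hk' hkk
        rcases hkk.eq_or_lt with rfl | hlt
        · exact hle2
        · exact hle1.trans (hall k' hk' hlt)
  · refine ⟨MState.Agree.rfl.setReg (by norm_num) _, by simp, by simpa using hc,
      fun _ _ => rfl, t, ht, hS.congr fun _ _ _ => rfl, le_rfl, fun k h1 h2 => by omega⟩
  · rintro s τ ⟨hs, ha, -, h20, hm, t', h1, h2, h3, h4⟩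
    refine ⟨?_, ha, h20, hm, t', h1, h2, h3, fun k hk => h4 k hk (Nat.zero_le _)⟩
    have : S.M * (S.W * 16 + 130 + 6) ≤ S.M * (S.W * 16 + 140) := Nat.mul_le_mul_left _ (by omega)
    omega

/-- The number of vertices of depth less than `k` in a `B`-ary heap. -/
def heapSize (B : ℕ) : ℕ → ℕ
  | 0 => 0
  | k + 1 => B * heapSize B k + 1

theorem heapSize_le_succ (B k : ℕ) : heapSize B k ≤ heapSize B (k + 1) := by
  induction k with
  | zero => exact Nat.zero_le _
  | succ k ih =>
    simp only [heapSize] at ih ⊢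
    exact Nat.succ_le_succ (Nat.mul_le_mul_left _ ih)

theorem heapSize_mono (B : ℕ) : Monotone (heapSize B) :=
  monotone_nat_of_le_succ (heapSize_le_succ B)

/-- The vertices of depth `k` form the interval from `heapSize B k` to just before `heapSize B (k +
1)`. The level of a vertex determines the depth allowed to its tree. -/
theorem exists_level {B v d : ℕ} (h : v < heapSize B (d + 1)) :
    ∃ k ≤ d, heapSize B k ≤ v ∧ v < heapSize B (k + 1) := by
  induction d with
  | zero => exact ⟨0, le_rfl, Nat.zero_le _, h⟩
  | succ d ih =>
    by_cases h' : v < heapSize B (d + 1)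
    · obtain ⟨k, hk, h1⟩ := ih h'
      exact ⟨k, by omega, h1⟩
    · exact ⟨d + 1, le_rfl, not_lt.1 h', h⟩

theorem level_unique {B v k l : ℕ} (h1 : heapSize B k ≤ v) (h2 : v < heapSize B (k + 1))
    (h3 : heapSize B l ≤ v) (h4 : v < heapSize B (l + 1)) : k = l := by
  rcases lt_trichotomy k l with h | h | h
  · have := heapSize_mono B (show k + 1 ≤ l from h); omega
  · exact h
  · have := heapSize_mono B (show l + 1 ≤ k from h); omega

/-- A vertex `v` other than the root is a child of `(v - 1) / (2M)`, and passing to a child never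
increases a mark. -/
theorem Shape.Marked.le_one {mk : ℕ → ℕ → ℕ} (h : S.Marked mk) {v : ℕ}
    (hv : v < 2 * S.M * S.I + 1) : ∀ j < S.m, mk v j ≤ 1 := by
  induction v using Nat.strong_induction_on with
  | _ v ih =>
    intro j hj
    rcases Nat.eq_zero_or_pos v with rfl | hpos
    · exact (h.root j hj).le
    have hM : 0 < 2 * S.M := by
      rcases Nat.eq_zero_or_pos S.M with h0 | h0
      · rw [h0] at hv; omega
      · omega
    set u := (v - 1) / (2 * S.M) with hu
    set c := (v - 1) % (2 * S.M) with hc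
    have hdiv : 2 * S.M * u + c = v - 1 := Nat.div_add_mod _ _
    have hcl : c < 2 * S.M := Nat.mod_lt _ hM
    have huI : u < S.I := Nat.div_lt_of_lt_mul (by omega)
    have huv : u < v := by
      have : u ≤ v - 1 := Nat.div_le_self _ _
      omega
    have hu1 := ih u huv (huv.trans hv) j hj
    obtain ⟨h1, h2⟩ := h.child u huI (c / 2) (by omega) j hj
    rcases Nat.even_or_odd' c with ⟨e, he | he⟩
    · rw [show 2 * S.M * u + 1 + 2 * (c / 2) = v by omega] at h1
      omega
    · rw [show 2 * S.M * u + 1 + 2 * (c / 2) + 1 = v by omega] at h2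
      omega

/-- The block of the vertex `v` holds a tree of depth at most `h` that has the least error, on the
points that reach the vertex, among those with variables on the list. -/
def Shape.Solved (S : Shape n) (mk : ℕ → ℕ → ℕ) (σ : MState) (v h : ℕ) : Prop :=
  ∃ t : DTree n, t.depth ≤ h ∧ S.Stored σ (mk v) (S.blk v) t ∧
    ∀ t' : DTree n, t'.depth ≤ h → (∀ i ∈ t'.vars, ∃ k < S.M, S.vl k = i) →
      t.miss S.m S.xs S.ys (mk v) ≤ t'.miss S.m S.xs S.ys (mk v)

theorem Shape.Solved.congr {mk : ℕ → ℕ → ℕ} {σ τ : MState} {v h : ℕ} (hS : S.Solved mk σ v h)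
    (hm : ∀ a, S.blk v ≤ a → τ.mem a = σ.mem a) : S.Solved mk τ v h := by
  obtain ⟨t, h1, h2, h3⟩ := hS
  exact ⟨t, h1, h2.congr fun a ha _ => hm a (by omega), h3⟩

/-- The blocks of all vertices from `v` on are solved, for trees that reach to the depth `d`. -/
def Shape.SolvedFrom (S : Shape n) (mk : ℕ → ℕ → ℕ) (d : ℕ) (σ : MState) (v : ℕ) : Prop :=
  ∀ u, v ≤ u → ∀ k ≤ d, heapSize (2 * S.M) k ≤ u → u < heapSize (2 * S.M) (k + 1) →
    S.Solved mk σ u (d - k)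

/-- The optimality principle: the best tree is the best leaf or a query with optimal subtrees,
because the errors of subtrees add. The `min` in the value of register `20` records that this
register moves only at vertices with children. -/
theorem run_solveVertex {σ : MState} (hD : S.Data σ) {mk : ℕ → ℕ → ℕ} (hmk : S.Marked mk)
    {d v : ℕ} (hI : S.I = heapSize (2 * S.M) d) (hWd : S.m + 2 + 2 * 2 ^ d ≤ S.W)
    (hv : v < 2 * S.M * S.I + 1) (hmem : ∀ j < S.m, σ.mem (S.blk v + j) = mk v j)
    (h18 : σ.reg 18 = v) (h19 : σ.reg 19 = S.blk v)
    (h20 : σ.reg 20 = S.blk (2 * S.M * min (v + 1) S.I + 1))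
    (hS : S.SolvedFrom mk d σ (v + 1)) :
    Run f ω (.seq bestLeaf (.ite (.sub (.reg 15) (.reg 18)) trySplits .skip)) σ fun s τ =>
      s ≤ S.M * (S.W * 16 + 140) + S.m * 45 + 80 ∧ MState.Agree 20 σ τ ∧
      τ.reg 20 = S.blk (2 * S.M * min v S.I + 1) ∧
      (∀ a, a < S.blk v + S.m ∨ S.blk v + S.W ≤ a → τ.mem a = σ.mem a) ∧
      S.SolvedFrom mk d τ v := by
  have hone := hmk.le_one hv
  have hNB := S.NB_le v
  rw [run_seq]
  refine (run_bestLeaf hD h19 hmem hone).mono ?_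
  rintro s τ ⟨hs, ha, h20', hm, b, hSt, hopt⟩
  have hDτ : S.Data τ := hD.congr (ha.mono (by norm_num)) fun a h => hm a (by omega)
  have t18 : τ.reg 18 = v := (ha _ (by norm_num)).trans h18
  have hlater : ∀ {ρ : MState}, (∀ a, a < S.blk v + S.m ∨ S.blk v + S.W ≤ a →
      ρ.mem a = σ.mem a) → (∀ k ≤ d, heapSize (2 * S.M) k ≤ v → v < heapSize (2 * S.M) (k + 1) →
      S.Solved mk ρ v (d - k)) → S.SolvedFrom mk d ρ v := by
    intro ρ hρ hv' u hu k hk h1 h2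
    rcases hu.eq_or_lt with rfl | hlt
    · exact hv' k hk h1 h2
    · exact (hS u hlt k hk h1 h2).congr fun a h => hρ a (by have := S.blk_le hlt; omega)
  obtain ⟨k, hkd, hk1, hk2⟩ := exists_level (B := 2 * S.M) (d := d) (v := v)
    (by simpa [heapSize, ← hI] using hv)
  rw [run_ite]
  split_ifs with hc
  · simp only [Expr.eval, hDτ.r15, t18] at hc
    have hvI : v < S.I := by omega
    -- `I` is the number of vertices of depth less than `d`, so a vertex before `I` has a level
    -- below it.
    have hkd' : k < d := by
      refine lt_of_le_of_ne hkd ?_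
      rintro rfl
      omega
    have hvu : v < 2 * S.M * v + 1 := by
      rcases Nat.eq_zero_or_pos S.M with h | h
      · have := S.hI h; omega
      · nlinarith
    -- The recursion of `heapSize` places the children of a vertex of level `k` in level `k + 1`,
    -- and they come after `v`, so they are already solved.
    have hsol : ∀ c < 2 * S.M, S.Solved mk τ (2 * S.M * v + 1 + c) (d - (k + 1)) := by
      intro c hc'
      have e1 : 2 * S.M * heapSize (2 * S.M) k ≤ 2 * S.M * v := Nat.mul_le_mul_left _ hk1
      have e2 : 2 * S.M * (v + 1) ≤ 2 * S.M * heapSize (2 * S.M) (k + 1) :=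
        Nat.mul_le_mul_left _ hk2
      rw [Nat.mul_succ] at e2
      refine (hS _ (by omega) (k + 1) hkd' (by simp only [heapSize]; omega)
        (by rw [heapSize]; omega)).congr fun a h => hm a ?_
      have := S.blk_le (show v < 2 * S.M * v + 1 + c by omega)
      omega
    have hch : ∀ c, ∃ t : DTree n, c < 2 * S.M → t.depth ≤ d - (k + 1) ∧
        S.Stored τ (mk (2 * S.M * v + 1 + c)) (S.blk (2 * S.M * v + 1 + c)) t ∧
        ∀ t' : DTree n, t'.depth ≤ d - (k + 1) → (∀ i ∈ t'.vars, ∃ k < S.M, S.vl k = i) →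
          t.miss S.m S.xs S.ys (mk (2 * S.M * v + 1 + c)) ≤
            t'.miss S.m S.xs S.ys (mk (2 * S.M * v + 1 + c)) := by
      -- Indices that belong to no child get a dummy leaf, so that `choose` yields a total function.
      intro c
      by_cases hc' : c < 2 * S.M
      · obtain ⟨t, ht⟩ := hsol c hc'
        exact ⟨t, fun _ => ht⟩
      · exact ⟨.leaf b, fun h => absurd h hc'⟩
    choose T hT using hch
    have hnode : ∀ k < S.M, ∀ t₀ t₁ : DTree n,
        (DTree.node (S.vl k) t₀ t₁).miss S.m S.xs S.ys (mk v) =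
          t₀.miss S.m S.xs S.ys (mk (2 * S.M * v + 1 + 2 * k)) +
            t₁.miss S.m S.xs S.ys (mk (2 * S.M * v + 1 + 2 * k + 1)) := fun k hk t₀ t₁ =>
      DTree.miss_node t₀ t₁ hone (fun j hj => (hmk.child v hvI k hk j hj).1)
        (fun j hj => (hmk.child v hvI k hk j hj).2)
    refine (run_trySplits hDτ (v := v) (u := 2 * S.M * v + 1) (mk := mk) (T := T)
      (h := d - (k + 1)) (d := d) ((ha _ (by norm_num)).trans h19) ?_ hvu hSt
      (by omega) hWd (fun c hc' => (hT c hc').1) (Nat.zero_le _) (fun c hc' => (hT c hc').2.1)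
      hnode).mono ?_
    · rw [h20', h20, min_eq_left (by omega)]
      congr 1; ring
    rintro s' υ ⟨hs', ha', h20'', hm', t', hd', hSt', hle, hall⟩
    have hmυ : ∀ a, a < S.blk v + S.m ∨ S.blk v + S.W ≤ a → υ.mem a = σ.mem a :=
      fun a h => (hm' a h).trans (hm a h)
    refine ⟨by simp only [Expr.cost]; omega, ha.trans ha', ?_, hmυ, hlater hmυ ?_⟩
    · rw [h20'', min_eq_left hvI.le]
    · intro l hl h1 h2
      obtain rfl := level_unique hk1 hk2 h1 h2
      refine ⟨t', by omega, hSt', ?_⟩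
      -- A competing leaf loses to the best leaf. A competing query does not get worse when its
      -- subtrees are replaced by the stored optimal ones, and that node has been tried.
      rintro (b' | ⟨i, t₀, t₁⟩) hdep hvars
      · exact hle.trans (hopt b')
      · obtain ⟨c, hcM, rfl⟩ := hvars i (by simp [DTree.vars])
        simp only [DTree.depth] at hdep
        refine (hall c hcM).trans ?_
        rw [hnode c hcM, hnode c hcM]
        refine Nat.add_le_add ((hT _ (by omega)).2.2 t₀ (by omega) fun i hi => ?_)
          ((hT _ (by omega)).2.2 t₁ (by omega) fun i hi => ?_)
        · exact hvars i (by simp [DTree.vars, hi])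
        · exact hvars i (by simp [DTree.vars, hi])
  · simp only [Expr.eval, hDτ.r15, t18] at hc
    rw [run_skip]
    refine ⟨by simp only [Expr.cost]; omega, ha, ?_, hm, hlater hm ?_⟩
    · rw [h20', h20, min_eq_right (by omega), min_eq_right (by omega)]
    · intro l hl h1 h2
      have hld : l = d := by
        by_contra hne
        have := heapSize_mono (2 * S.M) (show l + 1 ≤ d by omega)
        omega
      subst hld
      refine ⟨.leaf b, Nat.zero_le _, hSt, ?_⟩
      rintro (b' | ⟨i, t₀, t₁⟩) hdep hvars
      · exact hopt b'
      · simp [DTree.depth] at hdep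

/-- Children have larger numbers than their parent, so decreasing order meets every vertex after its
children. Solving a vertex leaves all marks in place, since trees are stored behind the marks of the
block. -/
theorem run_minimize {σ : MState} (hD : S.Data σ) {mk : ℕ → ℕ → ℕ} (hmk : S.Marked mk)
    {d : ℕ} (hI : S.I = heapSize (2 * S.M) d) (hWd : S.m + 2 + 2 * 2 ^ d ≤ S.W)
    (hmem : ∀ v < 2 * S.M * S.I + 1, ∀ j < S.m, σ.mem (S.blk v + j) = mk v j)
    (h16 : σ.reg 16 = 2 * S.M * S.I + 1) (h20 : σ.reg 20 = S.blk (2 * S.M * S.I + 1)) :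
    Run f ω minimize σ fun s τ =>
      s ≤ (2 * S.M * S.I + 1) * (S.M * (S.W * 16 + 140) + S.m * 45 + 100) + 10 ∧
      MState.Agree 18 σ τ ∧ S.Solved mk τ 0 d := by
  rw [minimize, run_seq, run_set]
  have hIT : S.I ≤ 2 * S.M * S.I + 1 := by
    rcases Nat.eq_zero_or_pos S.M with h | h
    · have := S.hI h; omega
    · nlinarith
  refine (run_forDown (N := 2 * S.M * S.I + 1)
    (T := S.M * (S.W * 16 + 140) + S.m * 45 + 90) (fun v τ => MState.Agree 18 σ τ ∧
      τ.reg 18 = v ∧ τ.reg 19 = S.blk v ∧ τ.reg 20 = S.blk (2 * S.M * min v S.I + 1) ∧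
      (∀ a < S.NB, τ.mem a = σ.mem a) ∧
      (∀ v < 2 * S.M * S.I + 1, ∀ j < S.m, τ.mem (S.blk v + j) = mk v j) ∧
      S.SolvedFrom mk d τ v) (by simpa using h16) (fun _ _ _ h => h.2.1) ?_ ?_).mono ?_
  · rintro v hv τ ⟨ha, h18, h19, h20, hm, hma, hS⟩
    have hDτ : S.Data τ := hD.congr ha hm
    rw [run_seq, run_set]
    refine (run_solveVertex (v := v) (mk := mk) (d := d) ?_ hmk hI hWd hv ?_ ?_ ?_ ?_ ?_).mono ?_
    · exact hDτ.congr ((MState.Agree.rfl.setReg (by norm_num) _).setReg (by norm_num) _)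
        fun _ _ => rfl
    · exact hma v hv
    · simp
    · simp [Expr.eval, h19, hDτ.r17, S.blk_succ]
    · simpa using h20
    · exact fun u hu k hk h1 h2 => (hS u hu k hk h1 h2).congr fun _ _ => rfl
    · rintro s υ ⟨hs, ha', h20', hm', hS'⟩
      refine ⟨by simp only [Expr.cost]; omega, ?_, ?_, ?_, h20', ?_, ?_, hS'⟩
      · exact ((ha.setReg (by norm_num) _).setReg (by norm_num) _).trans (ha'.mono (by norm_num))
      · rw [ha' _ (by norm_num)]; simp
      · rw [ha' _ (by norm_num)]; simp [Expr.eval, h19, hDτ.r17, S.blk_succ]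
      · intro a h
        rw [hm' a (by have := S.NB_le v; omega)]
        exact hm a h
      · intro u hu j hj
        have hW := S.hW
        rw [hm' _ ?_]
        · exact hma u hu j hj
        · rcases lt_trichotomy u v with h | rfl | h
          · have := S.blk_le h; omega
          · omega
          · have := S.blk_le h; omega
  · refine ⟨(MState.Agree.rfl.setReg (by norm_num) _).setReg (by norm_num) _, by simp,
      by simp [Expr.eval, h20], ?_, fun _ _ => rfl, hmem, ?_⟩
    · simpa [min_eq_right hIT] using h20
    · intro u hu k hk h1 h2
      have := heapSize_mono (2 * S.M) (show k + 1 ≤ d + 1 by omega)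
      simp only [heapSize, ← hI] at this h2
      omega
  · rintro s τ ⟨hs, ha, -, -, -, -, -, hS⟩
    refine ⟨?_, ha, by simpa using hS 0 le_rfl 0 (Nat.zero_le _) le_rfl (Nat.succ_pos _)⟩
    simp only [Expr.cost]
    have : (2 * S.M * S.I + 1) * (S.M * (S.W * 16 + 140) + S.m * 45 + 90 + 6) ≤
      (2 * S.M * S.I + 1) * (S.M * (S.W * 16 + 140) + S.m * 45 + 100) := Nat.mul_le_mul_left _ (by omega)
    omega

/-- At the root every sample point has mark 1, so weighted error there is empirical error. The code
of the root's tree starts after `m` marks, the error and the code length. -/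
theorem run_searchTree {σ : MState} (hD : S.Data σ)
    {d : ℕ} (hI : S.I = heapSize (2 * S.M) d) (hWd : S.m + 2 + 2 * 2 ^ d ≤ S.W)
    (h16 : σ.reg 16 = 2 * S.M * S.I + 1) :
    Run f ω searchTree σ fun s τ =>
      s ≤ 3 * (2 * S.M * S.I + 1 + S.I) * (S.M * (S.W * 16 + 140) + S.m * 45 + 100) ∧
      ∃ t : DTree n, τ.HasBlock (τ.reg 0) t.code ∧ t.depth ≤ d ∧
        ∀ t' : DTree n, t'.depth ≤ d → (∀ i ∈ t'.vars, ∃ k < S.M, S.vl k = i) →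
          t.miss S.m S.xs S.ys (fun _ => 1) ≤ t'.miss S.m S.xs S.ys (fun _ => 1) := by
  rw [searchTree, run_seq]
  refine (run_expandAll hD).mono ?_
  rintro s τ ⟨hs, ha, h20, hm, hmk⟩
  rw [run_seq]
  refine (run_minimize (hD.congr ha hm) hmk hI hWd (fun _ _ _ _ => rfl)
    ((ha _ (by norm_num)).trans h16) h20).mono ?_
  rintro s' υ ⟨hs', ha', t, hdep, hSt, hopt⟩
  rw [run_set]
  have u9 : υ.reg 9 = S.m := (ha' _ (by norm_num)).trans ((ha _ (by norm_num)).trans hD.r9)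
  have u12 : υ.reg 12 = S.NB := (ha' _ (by norm_num)).trans ((ha _ (by norm_num)).trans hD.r12)
  have hmiss : ∀ t : DTree n, t.miss S.m S.xs S.ys (fun j => τ.mem (S.blk 0 + j)) =
      t.miss S.m S.xs S.ys (fun _ => 1) := fun t =>
    Finset.sum_congr rfl fun j hj => by
      have := hmk.root j (Finset.mem_range.1 hj)
      simp only at this ⊢
      rw [this]
  refine ⟨?_, t, ?_, hdep, fun t' h1 h2 => ?_⟩
  · simp only [Expr.cost]
    have hW := S.hW
    have e0 : S.M * (S.m * 40 + 28) ≤ 3 * (S.M * (S.W * 16 + 140)) := by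
      have : S.M * (S.m * 40 + 28) ≤ S.M * (3 * (S.W * 16 + 140)) := Nat.mul_le_mul_left _ (by omega)
      calc _ ≤ _ := this
        _ = _ := by ring
    have e2 : S.I * (S.M * (S.m * 40 + 28) + 18) ≤
        S.I * (3 * (S.M * (S.W * 16 + 140) + S.m * 45 + 100)) := Nat.mul_le_mul_left _ (by omega)
    have hX : S.m * 45 + 100 ≤ S.M * (S.W * 16 + 140) + S.m * 45 + 100 := by omega
    generalize S.M * (S.W * 16 + 140) + S.m * 45 + 100 = X at *
    have e3 : 3 * (2 * S.M * S.I + 1 + S.I) * X =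
      (2 * S.M * S.I + 1) * X + S.I * (3 * X) + 2 * ((2 * S.M * S.I) * X) + 2 * X := by ring
    omega
  · intro k hk
    simp only [Expr.eval, MState.setReg_reg, u9, u12, MState.setReg_mem, if_true]
    have := hSt.code k hk
    simpa [Shape.blk] using this
  · have := hopt t' h1 h2
    rwa [hmiss, hmiss] at this

end Backward

/-! ### Parameters, memory layout and the search on a given sample -/

section Programs

local notation "R" => Expr.reg
local notation "C" => Expr.const
local infixl:65 " ∔ " => Expr.add
local infixl:65 " ∸ " => Expr.sub
local infixr:60 " ;; " => Prog.seq

/-- Add the product of the registers `a` and `b` to the register `r`. -/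
def addMul (r a b : ℕ) : Prog := .forUp 18 b (.set r (R r ∔ R a))

/-- Double the register `r`, and count the doublings in the register `c`, until the register `b`
is reached. -/
def doubleUpTo (r c b : ℕ) : Prog :=
  .loop (R b ∸ R r) (.set r (R r ∔ R r) ;; .set c (R c ∔ C 1))

/-- Compute depth, sample size and layout from the parameters of the learner. -/
def setParams : Prog :=
  addMul 4 1 2 ;;
  .set 4 (R 4 ∔ R 4) ;; .set 4 (R 4 ∔ R 4) ;; .set 4 (R 4 ∔ R 4) ;; .set 4 (R 4 ∔ R 4) ;;
  .set 5 (C 1) ;; doubleUpTo 5 6 4 ;;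
  .set 24 (C 1) ;; doubleUpTo 24 7 3 ;;
  addMul 8 0 5 ;;
  .set 25 (R 8 ∔ R 8 ∔ R 7) ;;
  addMul 9 8 25 ;;
  .set 10 (R 0 ∔ R 0 ∔ C 2) ;;
  .set 11 (R 0) ;; addMul 11 10 9 ;;
  .set 12 (R 11 ∔ R 0)

/-- List the marked variables. -/
def listVars : Prog :=
  .set 13 (C 0) ;;
  .forUp 23 0 (.ite (.load (R 23)) (.store (R 11 ∔ R 13) (R 23) ;; .set 13 (R 13 ∔ C 1)) .skip)

/-- Compute the size of the heap and of its blocks. -/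
def setHeap : Prog :=
  .set 14 (R 13 ∔ R 13) ;;
  .set 15 (C 0) ;;
  .set 16 (C 0) ;;
  .set 24 (R 6 ∔ C 1) ;;
  .forUp 19 24 (
    .set 15 (R 16) ;;
    .set 16 (C 1) ;;
    addMul 16 15 14) ;;
  .set 17 (R 9 ∔ R 5 ∔ R 5 ∔ C 3)

/-- Find the tree of least empirical error on a given sample. -/
def learnFromSample : Prog := listVars ;; setHeap ;; searchTree

end Programs

section Setup

variable {n : ℕ} {f : Cube n → Bool} {ω : ℕ → Draw n}

theorem MState.ext' {σ τ : MState} (h1 : ∀ r, σ.reg r = τ.reg r) (h2 : σ.mem = τ.mem)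
    (h3 : σ.draws = τ.draws) : σ = τ := by
  obtain ⟨a, b, c⟩ := σ
  obtain ⟨a', b', c'⟩ := τ
  obtain rfl : a = a' := funext h1
  obtain rfl : b = b' := h2
  obtain rfl : c = c' := h3
  rfl

/-- Multiplication is repeated addition, at a time linear in the factor in `b` only. The final state
is given by an equation so that calls can be chained by substitution. -/
theorem run_addMul {σ : MState} {r a b : ℕ} (hr : r ≠ 18) (ha : a ≠ 18) (hb : b ≠ 18)
    (har : a ≠ r) (hbr : b ≠ r) :
    Run f ω (addMul r a b) σ fun t τ => t ≤ σ.reg b * 12 + 6 ∧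
      τ = (σ.setReg r (σ.reg r + σ.reg b * σ.reg a)).setReg 18 (σ.reg b) := by
  rw [addMul]
  refine (run_forUp (N := σ.reg b) (T := 4) (fun i τ =>
    τ = (σ.setReg r (σ.reg r + i * σ.reg a)).setReg 18 i) ?_ ?_ ?_).mono fun t τ h => h
  · rintro i - τ rfl
    simp [hb, hbr]
  · rintro i - τ rfl
    rw [run_set]
    refine ⟨by simp [Expr.cost], by simp [hr.symm], MState.ext' (fun k => ?_) rfl rfl⟩
    simp only [Expr.eval, MState.setReg_reg, hr, if_false, if_true, ha, har]
    split_ifs <;> first | rfl | ring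
  · refine MState.ext' (fun k => ?_) rfl rfl
    simp only [MState.setReg_reg]
    split_ifs with h1 h2 <;> simp_all

/-- Doubling from 1 gives the rounded-up logarithm and the corresponding power of two without any
division. -/
theorem run_doubleUpTo {σ : MState} {r c b : ℕ} (hrc : r ≠ c) (hrb : r ≠ b) (hbc : b ≠ c)
    (hr : σ.reg r = 1) (hc : σ.reg c = 0) :
    Run f ω (doubleUpTo r c b) σ fun t τ => t ≤ Nat.clog 2 (σ.reg b) * 12 + 4 ∧
      τ = (σ.setReg r (2 ^ Nat.clog 2 (σ.reg b))).setReg c (Nat.clog 2 (σ.reg b)) := by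
  rw [doubleUpTo]
  set k := Nat.clog 2 (σ.reg b) with hk
  refine (run_loop (N := k) (T := 8) (fun i τ => i ≤ k ∧
    τ = (σ.setReg r (2 ^ (k - i))).setReg c (k - i)) ?_ ?_ ?_).mono ?_
  · rintro τ ⟨-, rfl⟩
    have := Nat.le_pow_clog (b := 2) (by norm_num) (σ.reg b)
    rw [← hk] at this
    simp [Expr.eval, hbc, hrb.symm, hrc]
    omega
  · rintro i hi τ ⟨hik, rfl⟩
    have hlt : 2 ^ (k - (i + 1)) < σ.reg b := Nat.pow_lt_of_lt_clog (by omega)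
    refine ⟨?_, ?_⟩
    · simp [Expr.eval, hbc, hrb.symm, hrc]
      omega
    · simp only [run_seq, run_set]
      refine ⟨by simp [Expr.cost], by omega, MState.ext' (fun l => ?_) rfl rfl⟩
      have e1 : 2 ^ (k - i) = 2 ^ (k - (i + 1)) + 2 ^ (k - (i + 1)) := by
        rw [show k - i = k - (i + 1) + 1 by omega, pow_succ]; ring
      simp only [Expr.eval, MState.setReg_reg, hrc, if_false, if_true, e1]
      split_ifs <;> first | rfl | omega
  · refine ⟨le_rfl, MState.ext' (fun l => ?_) rfl rfl⟩
    simp only [MState.setReg_reg]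
    split_ifs with h1 h2 <;> simp_all
  · rintro t τ ⟨ht, -, rfl⟩
    simp only [Expr.cost] at ht
    exact ⟨by omega, by simp⟩

set_option maxHeartbeats 1000000 in
-- The values of `d`, `P` and `m` are those that `learning_bound` requires. The sample starts at
-- address `n`, as the cells before it hold the marks of the variables. Its blocks have length `2n +
-- 2` to accommodate a whole random edge.
theorem run_setParams {σ : MState} {s N Δ d l P m : ℕ}
    (h0 : σ.reg 0 = n) (h1 : σ.reg 1 = s) (h2 : σ.reg 2 = N) (h3 : σ.reg 3 = Δ)
    (hz : ∀ r, 4 ≤ r → σ.reg r = 0) (hd : d = Nat.clog 2 (16 * (s * N)))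
    (hl : l = Nat.clog 2 Δ) (hP : P = n * 2 ^ d) (hm : m = (P + P + l) * P) :
    Run f ω setParams σ fun t τ =>
      t ≤ 12 * (N + d + l + 2 ^ d + (P + P + l) + m) + 200 ∧
      τ.reg 0 = n ∧ τ.reg 5 = 2 ^ d ∧ τ.reg 6 = d ∧ τ.reg 9 = m ∧ τ.reg 10 = 2 * n + 2 ∧
      τ.reg 11 = n + m * (2 * n + 2) ∧ τ.reg 12 = n + m * (2 * n + 2) + n ∧
      τ.mem = σ.mem ∧ τ.draws = σ.draws := by
  have z4 := hz 4 (by norm_num)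
  have z6 := hz 6 (by norm_num)
  have z7 := hz 7 (by norm_num)
  have z8 := hz 8 (by norm_num)
  have z9 := hz 9 (by norm_num)
  simp only [setParams, run_seq, run_set]
  refine (run_addMul (by norm_num) (by norm_num) (by norm_num) (by norm_num)
    (by norm_num)).mono ?_
  rintro t1 τ1 ⟨ht1, rfl⟩
  refine (run_doubleUpTo (by norm_num) (by norm_num) (by norm_num)
    (by simp [Expr.eval]) (by simp [z6])).mono ?_
  rintro t2 τ2 ⟨ht2, rfl⟩
  have hK : s * N + s * N + (s * N + s * N) + (s * N + s * N + (s * N + s * N)) +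
      (s * N + s * N + (s * N + s * N) + (s * N + s * N + (s * N + s * N))) = 16 * (s * N) := by
    ring
  simp only [Expr.eval, MState.setReg_reg, h1, h2, z4] at ht2 ⊢
  norm_num at ht2 ⊢
  rw [Nat.mul_comm N s, hK, ← hd] at ht2 ⊢
  refine (run_doubleUpTo (by norm_num) (by norm_num) (by norm_num)
    (by simp) (by simp [z7])).mono ?_
  rintro t3 τ3 ⟨ht3, rfl⟩
  simp only [MState.setReg_reg] at ht3 ⊢
  norm_num at ht3 ⊢
  rw [h3, ← hl] at ht3 ⊢
  refine (run_addMul (by norm_num) (by norm_num) (by norm_num) (by norm_num)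
    (by norm_num)).mono ?_
  rintro t4 τ4 ⟨ht4, rfl⟩
  simp only [MState.setReg_reg] at ht4 ⊢
  norm_num at ht4 ⊢
  rw [z8, h0, Nat.zero_add, Nat.mul_comm _ n, ← hP]
  refine (run_addMul (by norm_num) (by norm_num) (by norm_num) (by norm_num)
    (by norm_num)).mono ?_
  rintro t5 τ5 ⟨ht5, rfl⟩
  simp only [MState.setReg_reg] at ht5 ⊢
  norm_num at ht5 ⊢
  rw [z9, h0, Nat.zero_add, ← hm]
  refine (run_addMul (by norm_num) (by norm_num) (by norm_num) (by norm_num)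
    (by norm_num)).mono ?_
  rintro t6 τ6 ⟨ht6, rfl⟩
  simp only [MState.setReg_reg] at ht6 ⊢
  norm_num at ht6 ⊢
  rw [h2] at ht1
  simp only [Expr.cost, h0]
  refine ⟨?_, ?_, ?_, ?_⟩
  · clear hP hm hd hl hK
    generalize 2 ^ d = D at *
    omega
  · trivial
  · rw [two_mul]
  · rw [two_mul]
    exact ⟨Or.inl rfl, rfl⟩

open Classical in
theorem run_listVars [NeZero n] {σ : MState} {VB : ℕ} (h0 : σ.reg 0 = n) (h11 : σ.reg 11 = VB)
    (hVB : n ≤ VB) :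
    Run f ω listVars σ fun t τ => t ≤ n * 30 + 10 ∧
      (∀ r, r ≠ 13 → r ≠ 23 → τ.reg r = σ.reg r) ∧ (∀ a < VB, τ.mem a = σ.mem a) ∧
      ∃ vl : ℕ → Fin n, (∀ k < τ.reg 13, τ.mem (VB + k) = vl k) ∧
        τ.reg 13 ≤ (Finset.univ.filter fun i : Fin n => σ.mem i ≠ 0).card ∧
        ∀ i : Fin n, σ.mem i ≠ 0 → ∃ k < τ.reg 13, vl k = i := by
  simp only [listVars, run_seq, run_set]
  refine (run_forUp (N := n) (T := 20) (fun i τ => τ.reg 23 = i ∧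
    (∀ r, r ≠ 13 → r ≠ 23 → τ.reg r = σ.reg r) ∧ (∀ a < VB, τ.mem a = σ.mem a) ∧
      ∃ vl : ℕ → Fin n, (∀ k < τ.reg 13, τ.mem (VB + k) = vl k) ∧
        τ.reg 13 ≤ (Finset.univ.filter fun j : Fin n => (j : ℕ) < i ∧ σ.mem j ≠ 0).card ∧
        ∀ j : Fin n, (j : ℕ) < i → σ.mem j ≠ 0 → ∃ k < τ.reg 13, vl k = j) ?_ ?_ ?_).mono ?_
  · rintro i - τ ⟨h23, hr, -⟩
    exact ⟨(hr 0 (by norm_num) (by norm_num)).trans h0, h23⟩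
  · rintro i hi τ ⟨h23, hr, hm, vl, hvl, hcard, hall⟩
    have t11 : τ.reg 11 = VB := (hr 11 (by norm_num) (by norm_num)).trans h11
    have hmi : τ.mem i = σ.mem i := hm i (by omega)
    rw [run_ite]
    simp only [Expr.eval, h23, hmi, run_seq, run_store, run_set, run_skip, Expr.cost, t11,
      MState.setMem_reg]
    split_ifs with hc
    · refine ⟨by norm_num, by simp [h23], by simp, ?_, ?_,
        fun k => if k = τ.reg 13 then ⟨i, hi⟩ else vl k, ?_, ?_, ?_⟩
      · intro r h1 h2
        simp [h1, h2, hr r h1 h2]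
      · intro a ha
        simp only [MState.setReg_mem, MState.setMem_mem]
        rw [if_neg (by omega), hm a ha]
      · intro k hk
        simp only [MState.setReg_reg, MState.setReg_mem, MState.setMem_mem] at hk ⊢
        norm_num at hk
        by_cases hk' : k = τ.reg 13
        · simp [hk']
        · rw [if_neg (by omega), if_neg hk', hvl k (by omega)]
      · simp only [MState.setReg_reg]
        norm_num
        refine (Nat.succ_le_succ hcard).trans (Nat.succ_le_of_lt (Finset.card_lt_card ?_))
        rw [Finset.ssubset_iff_of_subset]
        · exact ⟨⟨i, hi⟩, by simp [hc], by simp⟩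
        · intro j hj
          simp only [Finset.mem_filter, Finset.mem_univ, true_and] at hj ⊢
          exact ⟨by omega, hj.2⟩
      · intro j hj hne
        simp only [MState.setReg_reg]
        norm_num
        rcases Nat.lt_succ_iff_lt_or_eq.1 hj with h | h
        · obtain ⟨k, hk, rfl⟩ := hall j h hne
          exact ⟨k, by omega, by rw [if_neg (by omega)]⟩
        · exact ⟨τ.reg 13, by omega, by simp [← h]⟩
    · refine ⟨by norm_num, trivial, by simp, ?_, hm, vl, by simpa using hvl, ?_, ?_⟩
      · intro r h1 h2
        simp [h2, hr r h1 h2]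
      · simp only [MState.setReg_reg]
        norm_num
        refine hcard.trans (Finset.card_le_card ?_)
        intro j hj
        simp only [Finset.mem_filter, Finset.mem_univ, true_and] at hj ⊢
        exact ⟨by omega, hj.2⟩
      · intro j hj hne
        simp only [MState.setReg_reg]
        norm_num
        rcases Nat.lt_succ_iff_lt_or_eq.1 hj with h | h
        · exact hall j h hne
        · rw [h] at hne
          exact absurd hne hc
  -- The list is empty at first, so its enumeration may be any function.
  · refine ⟨by simp, fun r h1 h2 => by simp [h1, h2], fun _ _ => rfl, fun _ => 0, ?_, ?_, ?_⟩ <;>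
      simp [Expr.eval]
  · rintro t τ ⟨ht, -, hr, hm, vl, hvl, hcard, hall⟩
    refine ⟨by simp only [Expr.cost]; omega, hr, hm, vl, hvl, ?_, fun i => hall i i.2⟩
    simpa using hcard

/-- The strict inequality leaves room for the `+ 1` in the recursion: one unit of slack becomes `2s`
units after multiplication. -/
theorem heapSize_lt_pow {M s : ℕ} (hs : 1 ≤ s) (hM : M ≤ s) (k : ℕ) :
    heapSize (2 * M) k < (2 * s) ^ k := by
  induction k with
  | zero => simp [heapSize]
  | succ k ih =>
    rw [heapSize, pow_succ]
    have h1 : 2 * M * heapSize (2 * M) k ≤ 2 * s * heapSize (2 * M) k :=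
      Nat.mul_le_mul_right _ (by omega)
    have h2 : 2 * s * (heapSize (2 * M) k + 1) ≤ 2 * s * (2 * s) ^ k := Nat.mul_le_mul_left _ ih
    have h3 : 2 * s * (heapSize (2 * M) k + 1) = 2 * s * heapSize (2 * M) k + 2 * s := by ring
    have h4 : (2 * s) ^ k * (2 * s) = 2 * s * (2 * s) ^ k := Nat.mul_comm _ _
    omega

/-- The recursion of `heapSize` is iterated `d + 1` times, register `15` keeping the previous
iterate. Both sizes come out of one loop, and initially `i - 1` truncates to 0, in agreement with
the zero stored there. -/
theorem run_setHeap {σ : MState} {M d m D : ℕ} (h5 : σ.reg 5 = D) (h6 : σ.reg 6 = d)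
    (h9 : σ.reg 9 = m) (h13 : σ.reg 13 = M) :
    Run f ω setHeap σ fun t τ => t ≤ (d + 1) * (M * 24 + 40) + 50 ∧ MState.Agree 14 σ τ ∧
      τ.mem = σ.mem ∧ τ.reg 15 = heapSize (2 * M) d ∧ τ.reg 16 = heapSize (2 * M) (d + 1) ∧
      τ.reg 17 = m + D + D + 3 := by
  simp only [setHeap, run_seq, run_set]
  refine (run_forUp (N := d + 1) (T := M * 24 + 20) (fun i τ => MState.Agree 14 σ τ ∧
    τ.mem = σ.mem ∧ τ.reg 14 = 2 * M ∧ τ.reg 15 = heapSize (2 * M) (i - 1) ∧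
    τ.reg 16 = heapSize (2 * M) i ∧ τ.reg 19 = i ∧ τ.reg 24 = d + 1) ?_ ?_ ?_).mono ?_
  · rintro i - τ ⟨-, -, -, -, -, h19, h24⟩
    exact ⟨h24, h19⟩
  · rintro i hi τ ⟨ha, hm, h14, h15, h16, h19, h24⟩
    simp only [run_seq, run_set]
    refine (run_addMul (by norm_num) (by norm_num) (by norm_num) (by norm_num)
      (by norm_num)).mono ?_
    rintro t υ ⟨ht, rfl⟩
    simp only [MState.setReg_reg, Expr.eval, h14, h16] at ht ⊢
    norm_num at ht ⊢
    refine ⟨by simp only [Expr.cost]; omega, h19, ?_, hm, ?_, h24⟩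
    · exact ((((ha.setReg (by norm_num) _).setReg (by norm_num) _).setReg (by norm_num) _).setReg
        (by norm_num) _).setReg (by norm_num) _
    · rw [heapSize]; ring
  · refine ⟨?_, rfl, ?_, ?_, ?_, ?_, ?_⟩
    · exact ((((MState.Agree.rfl.setReg (by norm_num) _).setReg (by norm_num) _).setReg
        (by norm_num) _).setReg (by norm_num) _).setReg (by norm_num) _
    · simp [Expr.eval, h13, two_mul]
    all_goals simp [Expr.eval, heapSize, h6]
  · rintro t τ ⟨ht, ha, hm, -, h15, h16, -, -⟩
    have t9 : τ.reg 9 = m := (ha _ (by norm_num)).trans h9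
    have t5 : τ.reg 5 = D := (ha _ (by norm_num)).trans h5
    refine ⟨?_, ha.setReg (by norm_num) _, hm, ?_, ?_, ?_⟩
    · simp only [Expr.cost]
      have : (d + 1) * (M * 24 + 20 + 8) ≤ (d + 1) * (M * 24 + 40) :=
        Nat.mul_le_mul_left _ (by omega)
      omega
    · simpa using h15
    · simpa using h16
    · simp [Expr.eval, t9, t5]

theorem learn_time_le {n M m D d H Y t₁ t₂ t₃ : ℕ} (hY : 1 ≤ Y) (hM : M ≤ Y) (hm : m ≤ Y)
    (hD : D ≤ Y) (hn : n ≤ Y) (hd : d + 1 ≤ Y) (hH : 2 * M * H + 1 + H ≤ 2 * Y)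
    (hs : t₁ ≤ n * 30 + 10) (ht : t₂ ≤ (d + 1) * (M * 24 + 40) + 50)
    (hu : t₃ ≤ 3 * (2 * M * H + 1 + H) * (M * ((m + D + D + 3) * 16 + 140) + m * 45 + 100)) :
    t₁ + (t₂ + t₃) ≤ 4000 * Y ^ 3 := by
  have hYY : Y ≤ Y ^ 2 := Nat.le_self_pow (by norm_num) _
  have hYYY : Y ^ 2 ≤ Y ^ 3 := Nat.pow_le_pow_right hY (by norm_num)
  have b2 : (d + 1) * (M * 24 + 40) ≤ Y * (64 * Y) := Nat.mul_le_mul hd (by linarith)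
  have b3 : M * ((m + D + D + 3) * 16 + 140) ≤ Y * (236 * Y) := Nat.mul_le_mul hM (by linarith)
  have b4 : 3 * (2 * M * H + 1 + H) * (M * ((m + D + D + 3) * 16 + 140) + m * 45 + 100) ≤
      (6 * Y) * (381 * Y ^ 2) := Nat.mul_le_mul (by linarith) (by nlinarith)
  nlinarith

open Classical in
theorem run_learnFromSample [NeZero n] {σ : MState} {d m w s Y : ℕ} (xs : ℕ → Cube n)
    (ys : ℕ → Bool) (h0 : σ.reg 0 = n) (h5 : σ.reg 5 = 2 ^ d) (h6 : σ.reg 6 = d)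
    (h9 : σ.reg 9 = m) (h10 : σ.reg 10 = w) (h11 : σ.reg 11 = n + m * w)
    (h12 : σ.reg 12 = n + m * w + n) (hw : n < w)
    (hx : ∀ j < m, ∀ k : Fin n, σ.mem (n + j * w + k) = (xs j k).toNat)
    (hy : ∀ j < m, σ.mem (n + j * w + n) = (ys j).toNat) (hs : 1 ≤ s)
    (hcard : (Finset.univ.filter fun i : Fin n => σ.mem i ≠ 0).card ≤ s)
    (hY : n + m + 2 ^ d + (2 * s) ^ (d + 1) ≤ Y) :
    Run f ω learnFromSample σ fun t τ => t ≤ 4000 * Y ^ 3 ∧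
      ∃ h : DTree n, τ.HasBlock (τ.reg 0) h.code ∧ h.depth ≤ d ∧
        ∀ t' : DTree n, t'.depth ≤ d → (∀ i ∈ t'.vars, σ.mem i ≠ 0) →
          h.miss m xs ys (fun _ => 1) ≤ t'.miss m xs ys (fun _ => 1) := by
  rw [learnFromSample, run_seq]
  refine (run_listVars h0 h11 (Nat.le_add_right _ _)).mono ?_
  rintro t1 τ ⟨ht1, hr, hm, vl, hvl, hM, hall⟩
  set M := τ.reg 13 with hMdef
  rw [run_seq]
  refine (run_setHeap ((hr 5 (by norm_num) (by norm_num)).trans h5)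
    ((hr 6 (by norm_num) (by norm_num)).trans h6)
    ((hr 9 (by norm_num) (by norm_num)).trans h9) hMdef.symm).mono ?_
  rintro t2 υ ⟨ht2, ha, hm2, h15, h16, h17⟩
  -- The list fits into the `n` cells reserved between the sample and the heap.
  have hMn : M ≤ n := hM.trans ((Finset.card_le_univ _).trans_eq (Fintype.card_fin n))
  let S : Shape n :=
    { m := m, w := w, VB := n + m * w, NB := n + m * w + n, M := M, I := heapSize (2 * M) d
      W := m + 2 ^ d + 2 ^ d + 3, xs := xs, ys := ys, vl := vl, hw := hw, hVB := le_rfl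
      hNB := by omega
      hI := by
        intro h
        rw [h]
        cases d <;> simp [heapSize]
      hW := by omega }
  have hreg : ∀ r < 14, r ≠ 13 → υ.reg r = σ.reg r := fun r h1 h2 =>
    (ha r h1).trans (hr r h2 (by omega))
  have hmem : ∀ a < n + m * w, υ.mem a = σ.mem a := fun a h => by rw [hm2]; exact hm a h
  have hlt : ∀ j < m, ∀ k ≤ n, n + j * w + k < n + m * w := by
    intro j hj k hk
    have : (j + 1) * w ≤ m * w := Nat.mul_le_mul_right _ hj
    rw [Nat.succ_mul] at this
    omega
  have hD : S.Data υ :=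
    { r0 := (hreg 0 (by norm_num) (by norm_num)).trans h0
      r9 := (hreg 9 (by norm_num) (by norm_num)).trans h9
      r10 := (hreg 10 (by norm_num) (by norm_num)).trans h10
      r11 := (hreg 11 (by norm_num) (by norm_num)).trans h11
      r12 := (hreg 12 (by norm_num) (by norm_num)).trans h12
      r13 := ha 13 (by norm_num)
      r15 := h15
      r17 := h17
      hx := fun j hj k => (hmem _ (hlt j hj k k.2.le)).trans (hx j hj k)
      hy := fun j hj => (hmem _ (hlt j hj n le_rfl)).trans (hy j hj)
      hv := fun k hk => by rw [hm2]; exact hvl k hk }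
  refine (run_searchTree hD (d := d) rfl (by simp only [S]; omega) h16).mono ?_
  rintro t3 ρ ⟨ht3, h, hb, hdep, hopt⟩
  refine ⟨?_, h, hb, hdep, fun t' h1 h2 => hopt t' h1 fun i hi => hall i (h2 i hi)⟩
  -- The heap is bounded through the number of marked variables, at most `s`; branching over all `n`
  -- variables would be too slow.
  have hMs : M ≤ s := hM.trans hcard
  have e1 := heapSize_lt_pow hs hMs d
  have e2 := heapSize_lt_pow hs hMs (d + 1)
  have e3 : (2 * s) ^ d ≤ (2 * s) ^ (d + 1) := Nat.pow_le_pow_right (by omega) (by omega)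
  have e4 : s ≤ (2 * s) ^ (d + 1) := by
    have := Nat.le_self_pow (n := d + 1) (by omega) (2 * s)
    omega
  have e5 : d < 2 ^ d := Nat.lt_two_pow_self
  rw [heapSize] at e2
  have hMY : M ≤ Y := by omega
  have hY1 : 1 ≤ Y := by omega
  have hYY : Y ≤ Y ^ 2 := Nat.le_self_pow (by norm_num) _
  have hYYY : Y ^ 2 ≤ Y ^ 3 := Nat.pow_le_pow_right hY1 (by norm_num)
  simp only [S] at ht3
  have hmY : m ≤ Y := by omega
  have hDY : 2 ^ d ≤ Y := by omega
  have hnY : n ≤ Y := by omega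
  have hHY : 2 * M * heapSize (2 * M) d + 1 + heapSize (2 * M) d ≤ 2 * Y := by omega
  exact learn_time_le (hs := ht1) (ht := ht2) (hu := ht3) hY1 hMY hmY hDY hnY (by omega) hHY

end Setup

/-! ### Sampling by queries and by random edges -/

section Programs

local notation "R" => Expr.reg
local notation "C" => Expr.const
local infixl:65 " ∔ " => Expr.add
local infixl:65 " ∸ " => Expr.sub
local infixr:60 " ;; " => Prog.seq

/-- Mark the directions in which the point at the address in register `19`, that has its label in
register `22`, is sensitive. -/
def markSensitive : Prog :=
  .forUp 21 0 (
    .store (R 19 ∔ R 21) (C 1 ∸ .load (R 19 ∔ R 21)) ;;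
    .query 23 (R 19) ;;
    .store (R 19 ∔ R 21) (C 1 ∸ .load (R 19 ∔ R 21)) ;;
    .store (R 21) (.load (R 21) ∔ ((R 22 ∸ R 23) ∔ (R 23 ∸ R 22))))

/-- Draw random points, with their labels, and mark the directions in which they are sensitive. -/
def sampleQueries : Prog :=
  .set 19 (R 0) ;;
  .forUp 20 9 (
    .forUp 21 0 (.coin 22 ;; .store (R 19 ∔ R 21) (R 22)) ;;
    .query 22 (R 19) ;;
    .store (R 19 ∔ R 0) (R 22) ;;
    markSensitive ;;
    .set 19 (R 19 ∔ R 10))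

/-- Mark the direction of the edge at the address in register `19`. -/
def markDirection : Prog :=
  .forUp 21 0 (.store (R 21) (.load (R 21) ∔
    ((.load (R 19 ∔ R 21) ∸ .load (R 19 ∔ R 0 ∔ C 1 ∔ R 21)) ∔
      (.load (R 19 ∔ R 0 ∔ C 1 ∔ R 21) ∸ .load (R 19 ∔ R 21)))))

/-- Draw random edges, and mark the directions of the sensitive ones. -/
def sampleEdges : Prog :=
  .set 19 (R 0) ;;
  .forUp 20 9 (
    .edge (R 19) ;;
    .ite ((.load (R 19 ∔ R 0) ∸ .load (R 19 ∔ R 0 ∔ C 1 ∔ R 0)) ∔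
      (.load (R 19 ∔ R 0 ∔ C 1 ∔ R 0) ∸ .load (R 19 ∔ R 0))) markDirection .skip ;;
    .set 19 (R 19 ∔ R 10))

end Programs

section Sampling

variable {n : ℕ} {f : Cube n → Bool} {ω : ℕ → Draw n}

theorem toNat_sub_add_sub (a b : Bool) :
    (a.toNat - b.toNat) + (b.toNat - a.toNat) = if a = b then 0 else 1 := by
  cases a <;> cases b <;> rfl

theorem Cube.flip_apply (x : Cube n) (i j : Fin n) : x.flip i j = if j = i then !(x i) else x j := by
  simp [Cube.flip, Function.update_apply]

theorem MState.point_eq {σ : MState} {a : ℕ} {x : Cube n}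
    (h : ∀ k : Fin n, σ.mem (a + k) = (x k).toNat) : σ.point n a = x := by
  funext k
  simp only [MState.point, h]
  cases x k <;> rfl

/-- The labelled points `xs j` stand in memory, for `j < m`, in blocks of length `w`. -/
def HasSample (f : Cube n → Bool) (w m : ℕ) (xs : ℕ → Cube n) (mem : ℕ → ℕ) : Prop :=
  ∀ j < m, (∀ k : Fin n, mem (n + j * w + k) = (xs j k).toNat) ∧
    mem (n + j * w + n) = (f (xs j)).toNat

theorem HasSample.succ {w m : ℕ} {xs : ℕ → Cube n} {mem mem' : ℕ → ℕ}
    (h : HasSample f w m xs mem) (hw : n < w)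
    (hm : ∀ a, n ≤ a → a < n + m * w → mem' a = mem a)
    (hx : ∀ k : Fin n, mem' (n + m * w + k) = (xs m k).toNat)
    (hy : mem' (n + m * w + n) = (f (xs m)).toNat) : HasSample f w (m + 1) xs mem' := by
  intro j hj
  rcases Nat.lt_succ_iff_lt_or_eq.1 hj with h' | rfl
  · have : (j + 1) * w ≤ m * w := Nat.mul_le_mul_right _ h'
    rw [Nat.succ_mul] at this
    refine ⟨fun k => ?_, ?_⟩
    · have := k.2
      rw [hm _ (by omega) (by omega)]; exact (h j h').1 k
    · rw [hm _ (by omega) (by omega)]; exact (h j h').2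
  · exact ⟨hx, hy⟩

/-- Each coordinate is flipped in place, queried and flipped back. The two truncated differences of
the labels add up to 1 exactly if the labels differ. Marks accumulate, and only whether they are
nonzero matters. -/
theorem run_markSensitive {σ : MState} {p : ℕ} {x : Cube n} (h0 : σ.reg 0 = n)
    (h19 : σ.reg 19 = p) (hp : n ≤ p) (hx : ∀ k : Fin n, σ.mem (p + k) = (x k).toNat)
    (h22 : σ.reg 22 = (f x).toNat) :
    Run f ω markSensitive σ fun t τ => t ≤ n * (n + 50) + 6 ∧ MState.Agree 21 σ τ ∧
      τ.draws = σ.draws ∧ (∀ a, n ≤ a → τ.mem a = σ.mem a) ∧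
      ∀ i : Fin n, τ.mem i = σ.mem i + if f x = f (x.flip i) then 0 else 1 := by
  rw [markSensitive]
  refine (run_forUp (N := n) (T := n + 42) (fun i τ => MState.Agree 21 σ τ ∧ τ.reg 21 = i ∧
    τ.reg 22 = (f x).toNat ∧ τ.draws = σ.draws ∧ (∀ a, n ≤ a → τ.mem a = σ.mem a) ∧
    ∀ k : Fin n, τ.mem k = σ.mem k + if (k : ℕ) < i ∧ f x ≠ f (x.flip k) then 1 else 0)
    ?_ ?_ ?_).mono ?_
  · rintro i - τ ⟨ha, h21, -⟩
    exact ⟨(ha _ (by norm_num)).trans h0, h21⟩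
  · rintro i hi τ ⟨ha, h21, t22, hd, hm, hr⟩
    have t19 : τ.reg 19 = p := (ha _ (by norm_num)).trans h19
    have hxi : τ.mem (p + i) = (x ⟨i, hi⟩).toNat := by rw [hm _ (by omega)]; exact hx ⟨i, hi⟩
    simp only [run_seq, run_store, run_query, Expr.eval, Expr.cost, MState.setReg_reg,
      MState.setMem_reg, MState.setReg_mem, MState.setMem_mem, t19, h21, t22, hxi]
    norm_num
    have hpt : (τ.setMem (p + i) (1 - (x ⟨i, hi⟩).toNat)).point n p = x.flip ⟨i, hi⟩ := by
      refine MState.point_eq fun k => ?_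
      rw [MState.setMem_mem, Cube.flip_apply]
      by_cases hk : k = ⟨i, hi⟩
      · subst hk
        rw [if_pos rfl, if_pos rfl]
        cases x ⟨i, hi⟩ <;> rfl
      · have hk' : (k : ℕ) ≠ i := fun h => hk (Fin.ext h)
        rw [if_neg (by omega), if_neg hk, hm _ (by omega), hx]
    rw [hpt, toNat_sub_add_sub]
    refine ⟨by omega, ?_, hd, ?_, ?_⟩
    · refine MState.Agree.setReg ?_ (by norm_num) _
      exact ((((ha.setMem _ _).setReg (by norm_num) _).setMem _ _).setMem _ _)
    · intro a h
      rw [if_neg (by omega)]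
      split_ifs with h'
      · rw [h', ← hm _ (by omega), hxi]
        cases x ⟨i, hi⟩ <;> rfl
      · exact hm a h
    · intro k
      have hk := k.2
      rw [if_neg (by omega : ¬ p = 0), if_neg (by omega : ¬ p = 0),
        if_neg (by omega : ¬ (k : ℕ) = p + i), if_neg (by omega : ¬ (k : ℕ) = p + i)]
      rcases lt_trichotomy (k : ℕ) i with h | h | h
      · rw [if_neg h.ne, hr k]
        simp [h, h.le]
      · have hki : k = ⟨i, hi⟩ := Fin.ext h
        subst hki
        have := hr ⟨i, hi⟩
        simp only [lt_irrefl, false_and, if_false, Nat.add_zero] at this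
        simp [this]
      · rw [if_neg h.ne', hr k]
        simp [show ¬ (k : ℕ) < i by omega, show ¬ (k : ℕ) ≤ i by omega]
  · exact ⟨MState.Agree.rfl.setReg (by norm_num) _, by simp, by simpa using h22, rfl,
      fun _ _ => rfl, by simp⟩
  · rintro t τ ⟨ht, ha, -, -, hd, hm, hr⟩
    refine ⟨ht.trans_eq (by ring), ha, hd, hm, fun i => ?_⟩
    rw [hr i]
    simp [i.2]

/-- Queries consume no draws, so the `j`-th point is made of the coins `j * n, …, j * n + n - 1`. -/
theorem run_sampleQueries {σ : MState} {m : ℕ} (h0 : σ.reg 0 = n) (h9 : σ.reg 9 = m)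
    (h10 : σ.reg 10 = 2 * n + 2) (hmem : ∀ a < n, σ.mem a = 0) (hdr : σ.draws = 0)
    (xs : ℕ → Cube n) (hxs : ∀ j k, xs j k = (ω (j * n + k)).2) :
    Run f ω sampleQueries σ fun t τ => t ≤ m * (n * (n + 70) + 80) + 10 ∧ MState.Agree 19 σ τ ∧
      HasSample f (2 * n + 2) m xs τ.mem ∧
      ∀ i : Fin n, τ.mem i ≠ 0 ↔ ∃ j < m, f (xs j) ≠ f ((xs j).flip i) := by
  rw [sampleQueries, run_seq, run_set]
  refine (run_forUp (N := m) (T := n * (n + 70) + 70) (fun j τ => MState.Agree 19 σ τ ∧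
    τ.reg 20 = j ∧ τ.reg 19 = n + j * (2 * n + 2) ∧ τ.draws = j * n ∧
    HasSample f (2 * n + 2) j xs τ.mem ∧
      ∀ i : Fin n, τ.mem i ≠ 0 ↔ ∃ j' < j, f (xs j') ≠ f ((xs j').flip i)) ?_ ?_ ?_).mono ?_
  · rintro i - τ ⟨ha, h20, -⟩
    exact ⟨(ha _ (by norm_num)).trans h9, h20⟩
  · rintro j hj τ ⟨ha, h20, h19, hd, hs, hV⟩
    set p := n + j * (2 * n + 2) with hp
    rw [run_seq]
    refine (run_forUp (N := n) (T := 10) (fun k υ => MState.Agree 21 τ υ ∧ υ.reg 21 = k ∧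
      υ.draws = j * n + k ∧ (∀ a < p, υ.mem a = τ.mem a) ∧
      ∀ l : Fin n, (l : ℕ) < k → υ.mem (p + l) = (xs j l).toNat) ?_ ?_ ?_).mono ?_
    · rintro i - υ ⟨ha', h21, -⟩
      exact ⟨(ha' _ (by norm_num)).trans ((ha _ (by norm_num)).trans h0), h21⟩
    · rintro k hk υ ⟨ha', h21, hd', hm, hx⟩
      have t19 : υ.reg 19 = p := (ha' _ (by norm_num)).trans h19
      simp only [run_seq, run_coin, run_store, Expr.eval, Expr.cost, MState.setReg_reg,
        MState.tick_reg, t19, h21, hd']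
      norm_num
      refine ⟨h21, ?_, by rw [hd', Nat.add_assoc], ?_, ?_⟩
      · refine MState.Agree.setReg ?_ (by norm_num) _
        exact ha'.setReg (r := 22) (by norm_num) _
      · intro a h
        rw [if_neg (by omega)]
        exact hm a h
      · intro l hl
        split_ifs with h
        · rw [hxs, h]
        · exact hx l (by omega)
    · exact ⟨MState.Agree.rfl.setReg (by norm_num) _, by simp, by simpa using hd,
        fun _ _ => rfl, by simp⟩
    rintro t1 υ ⟨ht1, ha1, -, hd1, hm1, hx1⟩
    have hx1' : ∀ l : Fin n, υ.mem (p + l) = (xs j l).toNat := fun l => hx1 l l.2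
    have u19 : υ.reg 19 = p := (ha1 _ (by norm_num)).trans h19
    have u0 : υ.reg 0 = n := (ha1 _ (by norm_num)).trans ((ha _ (by norm_num)).trans h0)
    simp only [run_seq, run_query, run_store, Expr.eval, Expr.cost, MState.setReg_reg, u19, u0,
      MState.point_eq hx1', Nat.reduceEqDiff, reduceIte]
    refine (run_markSensitive (p := p) (x := xs j) (by simpa using u0) (by simpa using u19)
      (by omega) (fun k => ?_) (by simp)).mono ?_
    · simp only [MState.setMem_mem, MState.setReg_mem]
      have := k.2
      rw [if_neg (by omega), hx1']
    rintro t2 ρ ⟨ht2, ha2, hd2, hm2, hr2⟩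
    have v19 : ρ.reg 19 = p := (ha2 _ (by norm_num)).trans (by simpa using u19)
    have v20 : ρ.reg 20 = j := (ha2 _ (by norm_num)).trans
      (by simpa using (ha1 _ (by norm_num)).trans h20)
    have v10 : ρ.reg 10 = 2 * n + 2 := (ha2 _ (by norm_num)).trans
      (by simpa using (ha1 _ (by norm_num)).trans ((ha _ (by norm_num)).trans h10))
    have hlow : ∀ a < p, n ≤ a → ρ.mem a = τ.mem a := by
      intro a h h'
      rw [hm2 a h', MState.setMem_mem, MState.setReg_mem, if_neg (by omega), hm1 a h]
    simp only [run_set, Expr.eval, Expr.cost, v19, v10]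
    refine ⟨?_, by simpa using v20, ?_, by simp, ?_, ?_, ?_, ?_⟩
    · have : n * (n + 70) = n * (n + 50) + n * 20 := by ring
      omega
    · refine MState.Agree.setReg (MState.Agree.setReg ?_ (by norm_num) _) (by norm_num) _
      refine (ha.trans (ha1.mono (by norm_num))).trans ?_
      intro r hr
      rw [ha2 r (by omega)]
      simp only [MState.setMem_reg, MState.setReg_reg]
      rw [if_neg (by omega)]
    · simp only [MState.setReg_reg, reduceIte]
      rw [hp]; ring
    · simp only [MState.setReg_draws, hd2, MState.setMem_draws, hd1]
      ring
    · refine hs.succ (by omega) (fun a h1 h2 => hlow a (by omega) h1) (fun k => ?_) ?_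
      · have := k.2
        simp only [MState.setReg_mem]
        rw [hm2 _ (by omega), MState.setMem_mem, MState.setReg_mem, if_neg (by omega)]
        exact hx1' k
      · simp only [MState.setReg_mem]
        rw [hm2 _ (by omega), MState.setMem_mem, if_pos rfl]
    · intro i
      have := i.2
      simp only [MState.setReg_mem]
      rw [hr2 i, MState.setMem_mem, MState.setReg_mem, if_neg (by omega), hm1 _ (by omega)]
      have hVi := hV i
      constructor
      · intro hne
        by_cases hj' : f (xs j) = f ((xs j).flip i)
        · rw [if_pos hj'] at hne
          obtain ⟨j', h1, h2⟩ := hVi.1 (by omega)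
          exact ⟨j', by omega, h2⟩
        · exact ⟨j, by omega, hj'⟩
      · rintro ⟨j', h1, h2⟩
        rcases Nat.lt_succ_iff_lt_or_eq.1 h1 with h | rfl
        · have := hVi.2 ⟨j', h, h2⟩
          omega
        · rw [if_neg h2]; omega
  · refine ⟨(MState.Agree.rfl.setReg (by norm_num) _).setReg (by norm_num) _, by simp,
      by simp [Expr.eval, h0], by simp [hdr], fun j hj => absurd hj (Nat.not_lt_zero _), ?_⟩
    intro i
    simp [hmem i i.2]
  · rintro t τ ⟨ht, ha, -, -, -, hs, hV⟩
    refine ⟨?_, ha, hs, hV⟩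
    have : m * (n * (n + 70) + 70 + 8) ≤ m * (n * (n + 70) + 80) :=
      Nat.mul_le_mul_left _ (by omega)
    simp only [Expr.cost]
    omega

theorem getD_ofFn_append (g : Fin n → ℕ) (L : List ℕ) (k : Fin n) :
    (List.ofFn g ++ L).getD k 0 = g k := by
  rw [List.getD_append _ _ _ _ (by simp), List.getD_eq_getElem _ _ (by simp)]
  simp

theorem edgeBlock_eq (x : Cube n) (i : Fin n) : edgeBlock f x i =
    List.ofFn (fun j => (x j).toNat) ++ ((f x).toNat ::
      (List.ofFn (fun j => ((x.flip i) j).toNat) ++ [(f (x.flip i)).toNat])) := by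
  simp [edgeBlock]

theorem edgeBlock_length (x : Cube n) (i : Fin n) : (edgeBlock f x i).length = 2 * n + 2 := by
  simp [edgeBlock_eq]; omega

theorem edgeBlock_point (x : Cube n) (i k : Fin n) :
    (edgeBlock f x i).getD k 0 = (x k).toNat := by
  rw [edgeBlock_eq, getD_ofFn_append]

theorem edgeBlock_label (x : Cube n) (i : Fin n) :
    (edgeBlock f x i).getD n 0 = (f x).toNat := by
  rw [edgeBlock_eq, List.getD_append_right _ _ _ _ (by simp)]
  simp

theorem edgeBlock_point' (x : Cube n) (i k : Fin n) :
    (edgeBlock f x i).getD (n + 1 + k) 0 = (x.flip i k).toNat := by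
  rw [edgeBlock_eq, List.getD_append_right _ _ _ _ (by simp; omega), List.length_ofFn,
    show n + 1 + (k : ℕ) - n = k + 1 by omega, List.getD_cons_succ, getD_ofFn_append]

theorem edgeBlock_label' (x : Cube n) (i : Fin n) :
    (edgeBlock f x i).getD (n + 1 + n) 0 = (f (x.flip i)).toNat := by
  rw [edgeBlock_eq, List.getD_append_right _ _ _ _ (by simp), List.length_ofFn,
    show n + 1 + n - n = n + 1 by omega, List.getD_cons_succ,
    List.getD_append_right _ _ _ _ (by simp)]
  simp

/-- A random edge does not name its direction; it is the only coordinate in which the endpoints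
differ. -/
theorem run_markDirection {σ : MState} {p : ℕ} {x : Cube n} {i : Fin n} (h0 : σ.reg 0 = n)
    (h19 : σ.reg 19 = p) (hp : n ≤ p) (hx : ∀ k : Fin n, σ.mem (p + k) = (x k).toNat)
    (hx' : ∀ k : Fin n, σ.mem (p + n + 1 + k) = (x.flip i k).toNat) :
    Run f ω markDirection σ fun t τ => t ≤ n * 60 + 6 ∧ MState.Agree 21 σ τ ∧
      τ.draws = σ.draws ∧ (∀ a, n ≤ a → τ.mem a = σ.mem a) ∧
      ∀ k : Fin n, τ.mem k = σ.mem k + if k = i then 1 else 0 := by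
  rw [markDirection]
  refine (run_forUp (N := n) (T := 50) (fun c τ => MState.Agree 21 σ τ ∧ τ.reg 21 = c ∧
    τ.draws = σ.draws ∧ (∀ a, n ≤ a → τ.mem a = σ.mem a) ∧
    ∀ k : Fin n, τ.mem k = σ.mem k + if (k : ℕ) < c ∧ k = i then 1 else 0)
    ?_ ?_ ?_).mono ?_
  · rintro c - τ ⟨ha, h21, -⟩
    exact ⟨(ha _ (by norm_num)).trans h0, h21⟩
  · rintro c hc τ ⟨ha, h21, hd, hm, hr⟩
    have t19 : τ.reg 19 = p := (ha _ (by norm_num)).trans h19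
    have t0 : τ.reg 0 = n := (ha _ (by norm_num)).trans h0
    have hxc : τ.mem (p + c) = (x ⟨c, hc⟩).toNat := by rw [hm _ (by omega)]; exact hx ⟨c, hc⟩
    have hxc' : τ.mem (p + n + 1 + c) = (x.flip i ⟨c, hc⟩).toNat := by
      rw [hm _ (by omega)]; exact hx' ⟨c, hc⟩
    simp only [run_store, Expr.eval, Expr.cost, t19, t0, h21, hxc, hxc', toNat_sub_add_sub]
    norm_num
    refine ⟨h21, (ha.setMem _ _).setReg (by norm_num) _, hd, ?_, ?_⟩
    · intro a h
      rw [if_neg (by omega)]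
      exact hm a h
    · intro k
      rcases lt_trichotomy (k : ℕ) c with h | h | h
      · rw [if_neg h.ne, hr k]
        simp [h, h.le]
      · have hki : k = ⟨c, hc⟩ := Fin.ext h
        subst hki
        have := hr ⟨c, hc⟩
        simp only [lt_irrefl, false_and, if_false, Nat.add_zero] at this
        simp only [this, if_true, Cube.flip_apply]
        by_cases hci : (⟨c, hc⟩ : Fin n) = i
        · rw [← hci]; simp
        · simp [hci]
      · rw [if_neg h.ne', hr k]
        simp [show ¬ (k : ℕ) < c by omega, show ¬ (k : ℕ) ≤ c by omega]
  · exact ⟨MState.Agree.rfl.setReg (by norm_num) _, by simp, rfl, fun _ _ => rfl, by simp⟩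
  · rintro t τ ⟨ht, ha, -, hd, hm, hr⟩
    refine ⟨by omega, ha, hd, hm, fun k => ?_⟩
    rw [hr k]
    simp [k.2]

/-- The first endpoint and its label serve as the labelled example. The second endpoint is used only
to detect a sensitive direction. -/
theorem run_sampleEdges {σ : MState} {m : ℕ} (h0 : σ.reg 0 = n) (h9 : σ.reg 9 = m)
    (h10 : σ.reg 10 = 2 * n + 2) (hmem : ∀ a < n, σ.mem a = 0) (hdr : σ.draws = 0) :
    Run f ω sampleEdges σ fun t τ => t ≤ m * (n * 62 + 80) + 10 ∧ MState.Agree 19 σ τ ∧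
      HasSample f (2 * n + 2) m (fun j => (ω j).1.1) τ.mem ∧
      ∀ i : Fin n, τ.mem i ≠ 0 ↔ ∃ j < m, (ω j).1.2 = i ∧
        f (ω j).1.1 ≠ f ((ω j).1.1.flip i) := by
  rw [sampleEdges, run_seq, run_set]
  refine (run_forUp (N := m) (T := n * 62 + 70) (fun j τ => MState.Agree 19 σ τ ∧
    τ.reg 20 = j ∧ τ.reg 19 = n + j * (2 * n + 2) ∧ τ.draws = j ∧
    HasSample f (2 * n + 2) j (fun j => (ω j).1.1) τ.mem ∧
      ∀ i : Fin n, τ.mem i ≠ 0 ↔ ∃ j' < j, (ω j').1.2 = i ∧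
        f (ω j').1.1 ≠ f ((ω j').1.1.flip i)) ?_ ?_ ?_).mono ?_
  · rintro i - τ ⟨ha, h20, -⟩
    exact ⟨(ha _ (by norm_num)).trans h9, h20⟩
  · rintro j hj τ ⟨ha, h20, h19, hd, hs, hV⟩
    set p := n + j * (2 * n + 2) with hp
    set x := (ω j).1.1 with hxdef
    set i := (ω j).1.2 with hidef
    have t0 : τ.reg 0 = n := (ha _ (by norm_num)).trans h0
    have t10 : τ.reg 10 = 2 * n + 2 := (ha _ (by norm_num)).trans h10
    rw [run_seq, run_edge]
    simp only [Expr.eval, Expr.cost, h19, hd, ← hxdef, ← hidef]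
    set υ := ((τ.setBlock p (edgeBlock f x i)).tick) with hυ
    have hblk : ∀ k < 2 * n + 2, υ.mem (p + k) = (edgeBlock f x i).getD k 0 := by
      intro k hk
      rw [hυ, MState.tick_mem, MState.setBlock_mem, edgeBlock_length, if_pos (by omega),
        Nat.add_sub_cancel_left]
    have hlow : ∀ a < p, υ.mem a = τ.mem a := by
      intro a h
      rw [hυ, MState.tick_mem, MState.setBlock_mem, if_neg (by omega)]
    have hx : ∀ k : Fin n, υ.mem (p + k) = (x k).toNat := fun k => by
      rw [hblk _ (by omega), edgeBlock_point]
    have hy : υ.mem (p + n) = (f x).toNat := by rw [hblk _ (by omega), edgeBlock_label]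
    have hx' : ∀ k : Fin n, υ.mem (p + n + 1 + k) = (x.flip i k).toNat := fun k => by
      rw [show p + n + 1 + (k : ℕ) = p + (n + 1 + k) by ring, hblk _ (by omega),
        edgeBlock_point']
    have hy' : υ.mem (p + n + 1 + n) = (f (x.flip i)).toNat := by
      rw [show p + n + 1 + n = p + (n + 1 + n) by ring, hblk _ (by omega), edgeBlock_label']
    have hmark : Run f ω (.ite (.add (.sub (.load (.add (.reg 19) (.reg 0)))
        (.load (.add (.add (.add (.reg 19) (.reg 0)) (.const 1)) (.reg 0))))
        (.sub (.load (.add (.add (.add (.reg 19) (.reg 0)) (.const 1)) (.reg 0)))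
          (.load (.add (.reg 19) (.reg 0))))) markDirection .skip) υ fun t ρ =>
        t ≤ n * 60 + 40 ∧ MState.Agree 21 υ ρ ∧ ρ.draws = υ.draws ∧
        (∀ a, n ≤ a → ρ.mem a = υ.mem a) ∧
        ∀ k : Fin n, ρ.mem k = υ.mem k + if k = i ∧ f x ≠ f (x.flip i) then 1 else 0 := by
      have u0 : υ.reg 0 = n := t0
      have u19 : υ.reg 19 = p := h19
      rw [run_ite]
      simp only [Expr.eval, u0, u19, hy, hy', toNat_sub_add_sub]
      by_cases h2 : f x = f (x.flip i)
      · rw [if_neg (by simp [h2]), run_skip]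
        refine ⟨by simp only [Expr.cost]; omega, MState.Agree.rfl, rfl, fun _ _ => rfl, ?_⟩
        simp [h2]
      · rw [if_pos (by simp [h2])]
        refine (run_markDirection u0 u19 (by omega) hx hx').mono ?_
        rintro t ρ ⟨ht, ha', hd', hm', hr'⟩
        refine ⟨by simp only [Expr.cost]; omega, ha', hd', hm', fun k => ?_⟩
        rw [hr' k]
        simp [h2]
    rw [run_seq]
    refine hmark.mono ?_
    rintro t ρ ⟨ht, ha', hd', hm', hr'⟩
    have v19 : ρ.reg 19 = p := (ha' _ (by norm_num)).trans h19
    have v20 : ρ.reg 20 = j := (ha' _ (by norm_num)).trans h20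
    have v10 : ρ.reg 10 = 2 * n + 2 := (ha' _ (by norm_num)).trans t10
    simp only [run_set, Expr.eval, Expr.cost, v19, v10]
    refine ⟨by omega, by simpa using v20, ?_, by simp, ?_, ?_, ?_, ?_⟩
    · refine MState.Agree.setReg (MState.Agree.setReg ?_ (by norm_num) _) (by norm_num) _
      exact ha.trans (show MState.Agree 19 υ ρ from ha'.mono (by norm_num))
    · simp only [MState.setReg_reg, Nat.reduceEqDiff, reduceIte]
      rw [hp]; ring
    · simp only [MState.setReg_draws, hd', hυ, MState.tick_draws, MState.setBlock_draws, hd]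
    · refine hs.succ (by omega) (fun a h1 h2 => ?_) (fun k => ?_) ?_
      · simp only [MState.setReg_mem]
        rw [hm' a h1, hlow a (by omega)]
      · simp only [MState.setReg_mem]
        rw [hm' _ (by omega)]
        exact hx k
      · simp only [MState.setReg_mem]
        rw [hm' _ (by omega)]
        exact hy
    · intro k
      have := k.2
      simp only [MState.setReg_mem]
      rw [hr' k, hlow _ (by omega)]
      have hVk := hV k
      constructor
      · intro hne
        by_cases hj' : k = i ∧ f x ≠ f (x.flip i)
        · exact ⟨j, by omega, hj'.1.symm, by rw [hj'.1]; exact hj'.2⟩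
        · rw [if_neg hj'] at hne
          obtain ⟨j', h1, h2⟩ := hVk.1 (by omega)
          exact ⟨j', by omega, h2⟩
      · rintro ⟨j', h1, h2, h3⟩
        rcases Nat.lt_succ_iff_lt_or_eq.1 h1 with h | rfl
        · have := hVk.2 ⟨j', h, h2, h3⟩
          omega
        · rw [if_pos ⟨h2.symm, by rw [← h2] at h3; exact h3⟩]; omega
  · refine ⟨(MState.Agree.rfl.setReg (by norm_num) _).setReg (by norm_num) _, by simp,
      by simp [Expr.eval, h0], by simp [hdr], fun j hj => absurd hj (Nat.not_lt_zero _), ?_⟩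
    intro i
    simp [hmem i i.2]
  · rintro t τ ⟨ht, ha, -, -, -, hs, hV⟩
    refine ⟨?_, ha, hs, hV⟩
    have : m * (n * 62 + 70 + 8) ≤ m * (n * 62 + 80) := Nat.mul_le_mul_left _ (by omega)
    simp only [Expr.cost]
    omega

end Sampling

/-! ### Approximation by shallow trees on influential variables -/

section Analysis

variable {n : ℕ}

/-- The point that agrees with `y` on `T` and with `x` elsewhere. -/
def Cube.mix (T : Finset (Fin n)) (x y : Cube n) : Cube n := fun i => if i ∈ T then y i else x i

theorem Cube.flip_flip (x : Cube n) (i : Fin n) : (x.flip i).flip i = x := by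
  funext j
  simp only [Cube.flip_apply]
  by_cases h : j = i <;> simp [h]

/-- The number of points at which `f` and `g` differ. -/
def numDiff (f g : Cube n → Bool) : ℕ := (Finset.univ.filter fun x => f x ≠ g x).card

/-- The number of points at which `f` is sensitive in direction `i`. -/
def numSens (f : Cube n → Bool) (i : Fin n) : ℕ := numDiff f fun x => f (x.flip i)

theorem numDiff_triangle (f g h : Cube n → Bool) : numDiff f h ≤ numDiff f g + numDiff g h := by
  refine (Finset.card_le_card ?_).trans (Finset.card_union_le _ _)
  intro x
  simp only [Finset.mem_filter, Finset.mem_univ, true_and, Finset.mem_union]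
  intro h1
  by_contra h2
  push Not at h2
  exact h1 (h2.1.trans h2.2)

theorem numDiff_le (f g : Cube n → Bool) : numDiff f g ≤ 2 ^ n :=
  (Finset.card_le_univ _).trans_eq (by simp)

theorem errorRate_eq (f g : Cube n → Bool) : errorRate f g = numDiff f g / 2 ^ n := rfl

namespace DTree

/-- The tree with the variables in `T` fixed to their values in `y`. -/
def fix (T : Finset (Fin n)) (y : Cube n) : DTree n → DTree n
  | leaf b => leaf b
  | node i t₀ t₁ =>
    if i ∈ T then (if y i then t₁.fix T y else t₀.fix T y) else node i (t₀.fix T y) (t₁.fix T y)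

variable {T : Finset (Fin n)} {y : Cube n}

theorem eval_fix (t : DTree n) (x : Cube n) : (t.fix T y).eval x = t.eval (Cube.mix T x y) := by
  induction t with
  | leaf b => rfl
  | node i t₀ t₁ h₀ h₁ =>
    by_cases hi : i ∈ T
    · cases hy : y i <;> simp [fix, eval, Cube.mix, hi, hy, h₀, h₁]
    · simp [fix, eval, Cube.mix, hi, h₀, h₁]

theorem size_fix (t : DTree n) : (t.fix T y).size ≤ t.size := by
  induction t with
  | leaf b => exact le_rfl
  | node i t₀ t₁ h₀ h₁ =>
    simp only [fix]
    split_ifs <;> simp only [size] <;> omega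

theorem vars_fix (t : DTree n) : (t.fix T y).vars ⊆ t.vars \ T := by
  induction t with
  | leaf b => simp [fix, vars]
  | node i t₀ t₁ h₀ h₁ =>
    intro j
    have h₀ := @h₀ j
    have h₁ := @h₁ j
    simp only [Finset.mem_sdiff] at h₀ h₁
    simp only [fix]
    split_ifs with h2 h3 <;>
      simp only [vars, Finset.mem_sdiff, Finset.mem_insert, Finset.mem_union] <;> intro hj
    · exact ⟨Or.inr (Or.inr (h₁ hj).1), (h₁ hj).2⟩
    · exact ⟨Or.inr (Or.inl (h₀ hj).1), (h₀ hj).2⟩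
    · rcases hj with rfl | hj | hj
      · exact ⟨Or.inl rfl, h2⟩
      · exact ⟨Or.inr (Or.inl (h₀ hj).1), (h₀ hj).2⟩
      · exact ⟨Or.inr (Or.inr (h₁ hj).1), (h₁ hj).2⟩

end DTree

/-- A condition that does not depend on the `i`-th coordinate holds equally often on both
halves of the cube. -/
theorem two_mul_card_half (p : Cube n → Prop) [DecidablePred p] (i : Fin n) (b : Bool)
    (hp : ∀ x, p (x.flip i) ↔ p x) :
    2 * (Finset.univ.filter fun x : Cube n => x i = b ∧ p x).card =
      (Finset.univ.filter p).card := by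
  have h1 : (Finset.univ.filter fun x : Cube n => x i = b ∧ p x).card =
      (Finset.univ.filter fun x : Cube n => ¬ x i = b ∧ p x).card := by
    refine Finset.card_bij' (fun x _ => x.flip i) (fun x _ => x.flip i) ?_ ?_
      (fun x _ => x.flip_flip i) (fun x _ => x.flip_flip i)
    · intro x hx
      simp only [Finset.mem_filter, Finset.mem_univ, true_and, hp] at hx ⊢
      refine ⟨?_, hx.2⟩
      rw [Cube.flip_apply, if_pos rfl, hx.1]
      cases b <;> simp
    · intro x hx
      simp only [Finset.mem_filter, Finset.mem_univ, true_and, hp] at hx ⊢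
      refine ⟨?_, hx.2⟩
      rw [Cube.flip_apply, if_pos rfl]
      cases hxi : x i <;> cases b <;> simp_all
  have h2 := Finset.card_filter_add_card_filter_not (s := Finset.univ.filter p)
    (p := fun x : Cube n => x i = b)
  simp only [Finset.filter_filter, and_comm (a := p _)] at h2
  omega

/-- A decision tree can be cut off at depth `d` at the cost of an error of `size / 2 ^ d`. -/
theorem DTree.exists_truncation (g : DTree n) (d : ℕ) :
    ∃ h : DTree n, h.depth ≤ d ∧ h.vars ⊆ g.vars ∧
      numDiff h.eval g.eval * 2 ^ d ≤ g.size * 2 ^ n := by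
  induction d generalizing g with
  | zero =>
    -- At depth 0 an arbitrary leaf will do: it errs at most on the whole cube, and the size is at
    -- least 1.
    refine ⟨leaf true, le_rfl, by simp [vars], ?_⟩
    have := numDiff_le (leaf true : DTree n).eval g.eval
    have := g.size_pos
    nlinarith
  | succ d ih =>
    cases g with
    | leaf b =>
      refine ⟨leaf b, Nat.zero_le _, le_rfl, ?_⟩
      simp [numDiff]
    | node i t₀ t₁ =>
      -- The induction is applied to the subtrees with `i` fixed, so that none of the trees involved
      -- queries `i` again.
      obtain ⟨h₀, hd₀, hv₀, he₀⟩ := ih (t₀.fix {i} fun _ => false)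
      obtain ⟨h₁, hd₁, hv₁, he₁⟩ := ih (t₁.fix {i} fun _ => true)
      have hv₀' := hv₀.trans t₀.vars_fix
      have hv₁' := hv₁.trans t₁.vars_fix
      refine ⟨node i h₀ h₁, by simp only [depth]; omega, ?_, ?_⟩
      · simp only [vars]
        refine Finset.insert_subset_insert _ (Finset.union_subset_union ?_ ?_)
        · exact hv₀'.trans Finset.sdiff_subset
        · exact hv₁'.trans Finset.sdiff_subset
      have hfl : ∀ t : DTree n, i ∉ t.vars → ∀ x : Cube n, t.eval (x.flip i) = t.eval x := by
        intro t ht x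
        refine t.eval_congr fun j hj => ?_
        rw [Cube.flip_apply, if_neg]
        rintro rfl
        exact ht hj
      have hi₀ : i ∉ h₀.vars := fun h => by simpa using hv₀' h
      have hi₁ : i ∉ h₁.vars := fun h => by simpa using hv₁' h
      have hi₀' : i ∉ (t₀.fix {i} fun _ => false).vars := fun h => by
        simpa using t₀.vars_fix h
      have hi₁' : i ∉ (t₁.fix {i} fun _ => true).vars := fun h => by
        simpa using t₁.vars_fix h
      -- Disagreement does not depend on coordinate `i`, so exactly half of it lies in the half cube
      -- where this subtree is used. This gives the extra factor 2 of `2 ^ (d + 1)`.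
      have c₀ := two_mul_card_half (fun x => h₀.eval x ≠ (t₀.fix {i} fun _ => false).eval x) i false
        (fun x => by rw [hfl _ hi₀, hfl _ hi₀'])
      have c₁ := two_mul_card_half (fun x => h₁.eval x ≠ (t₁.fix {i} fun _ => true).eval x) i true
        (fun x => by rw [hfl _ hi₁, hfl _ hi₁'])
      have hle : numDiff (node i h₀ h₁).eval (node i t₀ t₁).eval ≤
          (Finset.univ.filter fun x : Cube n => x i = false ∧
            h₀.eval x ≠ (t₀.fix {i} fun _ => false).eval x).card +
          (Finset.univ.filter fun x : Cube n => x i = true ∧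
            h₁.eval x ≠ (t₁.fix {i} fun _ => true).eval x).card := by
        refine (Finset.card_le_card ?_).trans (Finset.card_union_le _ _)
        intro x hmem
        replace hmem := (Finset.mem_filter.1 hmem).2
        simp only [Finset.mem_filter, Finset.mem_univ, true_and, Finset.mem_union]
        simp only [eval] at hmem
        have hmix : ∀ b, x i = b → Cube.mix {i} x (fun _ => b) = x := by
          rintro b rfl
          funext j
          by_cases hj : j = i <;> simp [Cube.mix, hj]
        cases hx : x i
        · rw [eval_fix, hmix _ hx]
          simpa [hx] using hmem
        · rw [eval_fix _, eval_fix, hmix _ hx]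
          simpa [hx] using hmem
      change 2 * _ = numDiff _ _ at c₀ c₁
      have s₀ := t₀.size_fix (T := {i}) (y := fun _ => false)
      have s₁ := t₁.size_fix (T := {i}) (y := fun _ => true)
      simp only [size, pow_succ]
      have e₀ := he₀.trans (Nat.mul_le_mul_right (2 ^ n) s₀)
      have e₁ := he₁.trans (Nat.mul_le_mul_right (2 ^ n) s₁)
      rw [← c₀] at e₀
      rw [← c₁] at e₁
      calc _ ≤ _ := Nat.mul_le_mul_right _ hle
        _ ≤ _ := by linarith

theorem Cube.mix_mix (T : Finset (Fin n)) (x y : Cube n) :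
    Cube.mix T (Cube.mix T x y) (Cube.mix T y x) = x := by
  funext i
  by_cases h : i ∈ T <;> simp [Cube.mix, h]

/-- Exchanging the coordinates in `T` between two points is an involution of the pairs, so the
mixture of two independent uniform points is uniform. -/
theorem card_mix (T : Finset (Fin n)) (p : Cube n → Prop) [DecidablePred p] :
    (Finset.univ.filter fun z : Cube n × Cube n => p (Cube.mix T z.1 z.2)).card =
      (Finset.univ.filter p).card * 2 ^ n := by
  have : (Finset.univ.filter fun z : Cube n × Cube n => p (Cube.mix T z.1 z.2)).card =
      (Finset.univ.filter p ×ˢ (Finset.univ : Finset (Cube n))).card := by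
    refine Finset.card_bij' (fun z _ => (Cube.mix T z.1 z.2, Cube.mix T z.2 z.1))
      (fun z _ => (Cube.mix T z.1 z.2, Cube.mix T z.2 z.1)) ?_ ?_ ?_ ?_
    · intro z hz
      simpa using hz
    · intro z hz
      simpa [Cube.mix_mix] using hz
    · intro z _
      simp [Cube.mix_mix]
    · intro z _
      simp [Cube.mix_mix]
  rw [this, Finset.card_product]
  simp

/-- A hybrid argument: adding `j` to `T` either leaves the mixture unchanged or flips its `j`-th
coordinate. As the mixture is uniform, the latter changes `f` no more often than `numSens f j`
allows. -/
theorem card_mix_ne_le (f : Cube n → Bool) (T : Finset (Fin n)) :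
    (Finset.univ.filter fun z : Cube n × Cube n => f z.1 ≠ f (Cube.mix T z.1 z.2)).card ≤
      (∑ i ∈ T, numSens f i) * 2 ^ n := by
  induction T using Finset.induction_on with
  | empty =>
    have h0 : ∀ x y : Cube n, Cube.mix ∅ x y = x := fun x y => by funext i; simp [Cube.mix]
    simp [h0]
  | insert j T hj ih =>
    rw [Finset.sum_insert hj, Nat.add_mul, Nat.add_comm]
    refine le_trans ?_ (Nat.add_le_add ih (card_mix T fun x => f x ≠ f (x.flip j)).le)
    refine (Finset.card_le_card ?_).trans (Finset.card_union_le _ _)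
    intro z
    simp only [Finset.mem_filter, Finset.mem_univ, true_and, Finset.mem_union]
    intro h1
    by_contra h2
    push Not at h2
    refine h1 (h2.1.trans ?_)
    by_cases hz : z.2 j = z.1 j
    · congr 1
      funext k
      by_cases hk : k = j
      · subst hk; simp [Cube.mix, hj, hz]
      · simp [Cube.mix, hk]
    · rw [h2.2]
      congr 1
      funext k
      by_cases hk : k = j
      · subst hk
        simp only [Cube.flip_apply, Cube.mix, hj, if_true, if_false, Finset.mem_insert, true_or]
        cases h3 : z.2 k <;> cases h4 : z.1 k <;> simp_all
      · simp [Cube.mix, hk, Cube.flip_apply]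

/-- Some restriction of the variables in `T` changes `f` at no more points than the
influences of these variables allow. -/
theorem exists_mix (f : Cube n → Bool) (T : Finset (Fin n)) :
    ∃ y, numDiff f (fun x => f (Cube.mix T x y)) ≤ ∑ i ∈ T, numSens f i := by
  -- Averaging over `y`: if every restriction were too costly, the total over all pairs would exceed
  -- `card_mix_ne_le`.
  by_contra! hcon
  have h1 := card_mix_ne_le f T
  have h2 : (Finset.univ.filter fun z : Cube n × Cube n => f z.1 ≠ f (Cube.mix T z.1 z.2)).card =
      ∑ y, numDiff f (fun x => f (Cube.mix T x y)) := by
    simp only [numDiff, Finset.card_filter]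
    rw [Fintype.sum_prod_type_right]
  rw [h2] at h1
  have h3 : ∑ _y : Cube n, (∑ i ∈ T, numSens f i) <
      ∑ y, numDiff f (fun x => f (Cube.mix T x y)) :=
    Finset.sum_lt_sum_of_nonempty ⟨fun _ => true, Finset.mem_univ _⟩ fun y _ => hcon y
  simp at h3
  rw [Nat.mul_comm] at h3
  omega

/-- A decision tree is approximated by one of depth `d` on the variables in `V`, if the other
variables have small influence. -/
theorem DTree.exists_approx (g : DTree n) (d : ℕ) (V : Fin n → Prop) {s : ℕ} (hs : g.size ≤ s)
    {τ : ℝ} (hτ : 0 ≤ τ) (hV : ∀ i, ¬ V i → (numSens g.eval i : ℝ) ≤ τ * 2 ^ n) :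
    ∃ h : DTree n, h.depth ≤ d ∧ (∀ i ∈ h.vars, V i) ∧
      errorRate h.eval g.eval ≤ s * τ + s / 2 ^ d := by
  classical
  -- Only variables that `g` queries need to be fixed, so there are at most `s` of them, each
  -- costing at most `τ`.
  set T := g.vars.filter fun i => ¬ V i with hT
  obtain ⟨y, hy⟩ := exists_mix g.eval T
  obtain ⟨h, hd, hv, he⟩ := (g.fix T y).exists_truncation d
  refine ⟨h, hd, fun i hi => ?_, ?_⟩
  · have := g.vars_fix (hv hi)
    by_contra hcon
    simp [hT, hcon] at this
  have hfix : (g.fix T y).eval = fun x => g.eval (Cube.mix T x y) := funext g.eval_fix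
  have hsum : ((∑ i ∈ T, numSens g.eval i : ℕ) : ℝ) ≤ s * τ * 2 ^ n := by
    push_cast
    calc (∑ i ∈ T, (numSens g.eval i : ℝ)) ≤ ∑ _i ∈ T, τ * 2 ^ n :=
          Finset.sum_le_sum fun i hi => hV i (Finset.mem_filter.1 hi).2
      _ = T.card * (τ * 2 ^ n) := by simp
      _ ≤ s * (τ * 2 ^ n) := by
          have : T.card ≤ s := (Finset.card_filter_le _ _).trans (g.card_vars_lt.le.trans hs)
          gcongr
      _ = _ := by ring
  have htri := numDiff_triangle h.eval (g.fix T y).eval g.eval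
  have hsymm : numDiff (g.fix T y).eval g.eval = numDiff g.eval fun x => g.eval (Cube.mix T x y) := by
    rw [hfix]
    simp only [numDiff, ne_comm]
  rw [hsymm] at htri
  have h1 : (numDiff h.eval g.eval : ℝ) ≤
      numDiff h.eval (g.fix T y).eval + (∑ i ∈ T, numSens g.eval i : ℕ) := by
    exact_mod_cast htri.trans (Nat.add_le_add_left hy _)
  have h2 : (numDiff h.eval (g.fix T y).eval : ℝ) * 2 ^ d ≤ s * 2 ^ n := by
    exact_mod_cast he.trans (Nat.mul_le_mul_right _ ((g.size_fix).trans hs))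
  rw [errorRate_eq, div_le_iff₀ (by positivity)]
  have h3 : (numDiff h.eval (g.fix T y).eval : ℝ) ≤ s / 2 ^ d * 2 ^ n := by
    rw [div_mul_eq_mul_div, le_div_iff₀ (by positivity)]
    exact h2
  linarith

/-- The functions computed by decision trees of depth at most `d`. -/
def depthClass (n : ℕ) : ℕ → Finset (Cube n → Bool)
  | 0 => {fun _ => false, fun _ => true}
  | d + 1 => (Finset.univ ×ˢ (depthClass n d ×ˢ depthClass n d)).image
      fun z : Fin n × (Cube n → Bool) × (Cube n → Bool) =>
        fun x => if x z.1 then z.2.2 x else z.2.1 x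

theorem const_mem_depthClass [NeZero n] (b : Bool) (d : ℕ) : (fun _ => b) ∈ depthClass n d := by
  induction d with
  | zero => cases b <;> simp [depthClass]
  | succ d ih =>
    rw [depthClass, Finset.mem_image]
    exact ⟨(0, fun _ => b, fun _ => b), by simp [ih], by simp⟩

theorem DTree.eval_mem_depthClass [NeZero n] (t : DTree n) {d : ℕ} (h : t.depth ≤ d) :
    t.eval ∈ depthClass n d := by
  induction t generalizing d with
  | leaf b => exact const_mem_depthClass b d
  | node i t₀ t₁ h₀ h₁ =>
    simp only [depth] at h
    obtain ⟨d, rfl⟩ : ∃ e, d = e + 1 := ⟨d - 1, by omega⟩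
    rw [depthClass, Finset.mem_image]
    exact ⟨(i, t₀.eval, t₁.eval), by simp [h₀ (d := d) (by omega), h₁ (d := d) (by omega)], rfl⟩

/-- A root and two subtrees give at most `n` times the square of the previous count. Multiplied by
`n`, the recursion becomes plain squaring. -/
theorem mul_card_depthClass_le (d : ℕ) : n * (depthClass n d).card ≤ (2 * n) ^ 2 ^ d := by
  induction d with
  | zero =>
    have : (depthClass n 0).card ≤ 2 := Finset.card_le_two
    simp only [pow_zero, pow_one]
    nlinarith
  | succ d ih =>
    have h1 : (depthClass n (d + 1)).card ≤ n * ((depthClass n d).card * (depthClass n d).card) := by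
      refine Finset.card_image_le.trans ?_
      simp [Finset.card_product]
    calc n * (depthClass n (d + 1)).card
        ≤ n * (n * ((depthClass n d).card * (depthClass n d).card)) := Nat.mul_le_mul_left _ h1
      _ = (n * (depthClass n d).card) * (n * (depthClass n d).card) := by ring
      _ ≤ (2 * n) ^ 2 ^ d * (2 * n) ^ 2 ^ d := Nat.mul_le_mul ih ih
      _ = _ := by rw [← pow_add, pow_succ]; congr 1; ring

end Analysis

/-! ### Independent uniform samples and Markov's inequality -/

section Sampling

open scoped ENNReal

variable {Ω Ω' α β : Type*} [MeasurableSpace Ω] [MeasurableSpace Ω'] [Fintype α] [MeasurableSpace α]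
  [Fintype β] [MeasurableSpace β]

/-- The random variables `Y 0, Y 1, …` behave as independent uniform samples: products of
functions of them have the expected integrals. -/
structure IsUniformSample (μ : Measure Ω) (Y : ℕ → Ω → α) : Prop where
  measurable : ∀ j, Measurable (Y j)
  lintegral_prod : ∀ (m : ℕ) (φ : α → ℝ≥0∞),
    ∫⁻ ω, ∏ j ∈ Finset.range m, φ (Y j ω) ∂μ = ((∑ a, φ a) / Fintype.card α) ^ m

theorem isUniformSample_of_iIndepFun [MeasurableSingletonClass α] {μ : Measure Ω} {Y : ℕ → Ω → α}
    (hY : ∀ j, Measurable (Y j)) (hind : ProbabilityTheory.iIndepFun Y μ)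
    (hlaw : ∀ j a, μ (Y j ⁻¹' {a}) = (Fintype.card α : ℝ≥0∞)⁻¹) : IsUniformSample μ Y := by
  refine ⟨hY, fun m φ => ?_⟩
  have hφ : Measurable φ := measurable_of_finite φ
  rw [ProbabilityTheory.lintegral_prod_eq_prod_lintegral_of_indepFun (Finset.range m)
    (fun j ω => φ (Y j ω)) (hind.comp (fun _ => φ) fun _ => hφ) fun j => hφ.comp (hY j)]
  have : ∀ j, ∫⁻ ω, φ (Y j ω) ∂μ = (∑ a, φ a) / Fintype.card α := fun j => by
    rw [← lintegral_map hφ (hY j), lintegral_fintype, div_eq_mul_inv, Finset.sum_mul]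
    refine Finset.sum_congr rfl fun a _ => ?_
    rw [Measure.map_apply (hY j) (measurableSet_singleton a), hlaw]
  simp [this]

theorem IsUniformSample.comp {μ : Measure Ω} {μ' : Measure Ω'} {Y : ℕ → Ω' → α}
    (h : IsUniformSample μ' Y) {F : Ω → Ω'} (hF : Measurable F) (hμ : μ.map F = μ')
    [MeasurableSingletonClass α] : IsUniformSample μ fun j ω => Y j (F ω) := by
  refine ⟨fun j => (h.measurable j).comp hF, fun m φ => ?_⟩
  rw [← h.lintegral_prod m φ, ← hμ, lintegral_map ?_ hF]
  exact Finset.measurable_fun_prod _ fun j _ => (measurable_of_finite φ).comp (h.measurable j)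

theorem IsUniformSample.fst [Nonempty β] {μ : Measure Ω} {Y : ℕ → Ω → α × β}
    (h : IsUniformSample μ Y) : IsUniformSample μ fun j ω => (Y j ω).1 := by
  refine ⟨fun j => (h.measurable j).fst, fun m φ => ?_⟩
  have h0 : (Fintype.card β : ℝ≥0∞) ≠ 0 := by simp
  rw [h.lintegral_prod m fun z => φ z.1, Fintype.sum_prod_type, Fintype.card_prod]
  simp only [Finset.sum_const, Finset.card_univ, nsmul_eq_mul, ← Finset.mul_sum, Nat.cast_mul]
  rw [mul_comm (Fintype.card α : ℝ≥0∞), ENNReal.mul_div_mul_left _ _ h0 (by simp)]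

/-- Markov's inequality for a product of independent factors. Weights `b` on misclassified points
give Chernoff bounds; indicators with `c = 1` bound the probability that an event occurs in all `m`
draws. -/
theorem IsUniformSample.measureReal_le [MeasurableSingletonClass α] [Nonempty α] {μ : Measure Ω}
    {Y : ℕ → Ω → α} (h : IsUniformSample μ Y) (m : ℕ) (φ : α → ℝ) (hφ : ∀ a, 0 ≤ φ a) {c : ℝ}
    (hc : 0 < c) :
    μ.real {ω | c ≤ ∏ j ∈ Finset.range m, φ (Y j ω)} ≤ ((∑ a, φ a) / Fintype.card α) ^ m / c := by
  have hset : {ω | c ≤ ∏ j ∈ Finset.range m, φ (Y j ω)} =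
      {ω | ENNReal.ofReal c ≤ ∏ j ∈ Finset.range m, ENNReal.ofReal (φ (Y j ω))} := by
    ext ω
    simp only [Set.mem_ofPred_eq]
    rw [← ENNReal.ofReal_prod_of_nonneg fun j _ => hφ _,
      ENNReal.ofReal_le_ofReal_iff (Finset.prod_nonneg fun j _ => hφ _)]
  have hm : Measurable fun ω => ∏ j ∈ Finset.range m, ENNReal.ofReal (φ (Y j ω)) :=
    Finset.measurable_fun_prod _ fun j _ =>
      (measurable_of_finite fun a => ENNReal.ofReal (φ a)).comp (h.measurable j)
  have h1 := meas_ge_le_lintegral_div (μ := μ) hm.aemeasurable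
    (ε := ENNReal.ofReal c) (by simpa using hc) ENNReal.ofReal_ne_top
  rw [h.lintegral_prod m fun a => ENNReal.ofReal (φ a)] at h1
  have h2 : ((∑ a, ENNReal.ofReal (φ a)) / Fintype.card α) ^ m / ENNReal.ofReal c =
      ENNReal.ofReal (((∑ a, φ a) / Fintype.card α) ^ m / c) := by
    have h3 : 0 ≤ ∑ a, φ a := Finset.sum_nonneg fun a _ => hφ a
    rw [ENNReal.ofReal_div_of_pos hc, ENNReal.ofReal_pow (by positivity),
      ENNReal.ofReal_div_of_pos (by exact_mod_cast Fintype.card_pos),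
      ENNReal.ofReal_sum_of_nonneg fun a _ => hφ a, ENNReal.ofReal_natCast]
  rw [hset, measureReal_def]
  refine ENNReal.toReal_le_of_le_ofReal ?_ (h1.trans_eq h2)
  exact div_nonneg (pow_nonneg (div_nonneg (Finset.sum_nonneg fun a _ => hφ a) (by simp)) _) hc.le

theorem toMeasure_uniformOfFintype_singleton [Nonempty α] [MeasurableSingletonClass α] (a : α) :
    (PMF.uniformOfFintype α).toMeasure {a} = (Fintype.card α : ℝ≥0∞)⁻¹ := by
  rw [PMF.toMeasure_apply_singleton _ _ (measurableSet_singleton a), PMF.uniformOfFintype_apply]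

theorem isUniformSample_infinitePi [MeasurableSingletonClass α] {ν : Measure α}
    [IsProbabilityMeasure ν] (hν : ∀ a, ν {a} = (Fintype.card α : ℝ≥0∞)⁻¹) :
    IsUniformSample (Measure.infinitePi fun _ : ℕ => ν) fun j ω => ω j := by
  refine isUniformSample_of_iIndepFun (fun j => measurable_pi_apply j)
    (ProbabilityTheory.iIndepFun_infinitePi (X := fun _ x => x) fun _ => measurable_id)
    fun j a => ?_
  have h1 := congrArg (fun μ => μ {a}) (Measure.infinitePi_map_eval (fun _ : ℕ => ν) j)
  rw [Measure.map_apply (measurable_pi_apply j) (measurableSet_singleton a)] at h1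
  exact h1.trans (hν a)

variable {n : ℕ} [NeZero n]

instance : IsProbabilityMeasure (drawLaw n) := by
  unfold drawLaw; infer_instance

theorem isUniformSample_draw : IsUniformSample (drawLaw n) fun j ω => ω j :=
  isUniformSample_infinitePi toMeasure_uniformOfFintype_singleton

/-- Points of the cube put together from independent bits. -/
theorem isUniformSample_bits :
    IsUniformSample (drawLaw n) fun j ω => (fun k => (ω (j * n + k)).2 : Cube n) := by
  set ν : Measure Bool := (PMF.uniformOfFintype (Draw n)).toMeasure.map Prod.snd with hν
  have hprob : IsProbabilityMeasure ν := Measure.isProbabilityMeasure_map measurable_snd.aemeasurable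
  have hν1 : ∀ b, ν {b} = 2⁻¹ := by
    intro b
    let e : (Prod.snd ⁻¹' {b} : Set (Draw n)) ≃ Cube n × Fin n :=
      { toFun := fun z => z.1.1
        invFun := fun z => ⟨(z, b), rfl⟩
        left_inv := by
          rintro ⟨⟨z, c⟩, hz⟩
          obtain rfl : c = b := hz
          rfl
        right_inv := fun z => rfl }
    have : Fintype (Prod.snd ⁻¹' {b} : Set (Draw n)) := Fintype.ofFinite _
    rw [hν, Measure.map_apply measurable_snd (measurableSet_singleton b),
      PMF.toMeasure_uniformOfFintype_apply _ (measurable_snd (measurableSet_singleton b))]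
    have hc : Fintype.card (Prod.snd ⁻¹' {b} : Set (Draw n)) = 2 ^ n * n := by
      rw [Fintype.card_congr e]
      simp
    rw [hc]
    simp only [Fintype.card_prod, Fintype.card_pi, Fintype.card_bool, Finset.prod_const,
      Finset.card_univ, Fintype.card_fin]
    push_cast
    have hn : (n : ℝ≥0∞) ≠ 0 := by simpa using NeZero.ne n
    rw [ENNReal.div_eq_inv_mul, ENNReal.mul_inv (Or.inr (by simp)) (Or.inr (by simp)),
      mul_comm _ (2⁻¹ : ℝ≥0∞), mul_assoc, ENNReal.inv_mul_cancel, mul_one]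
    · exact mul_ne_zero (by simp) hn
    · exact ENNReal.mul_ne_top (by simp) (by simp)
  -- Different points use disjoint sets of coins, by division with remainder.
  have hinj : Function.Injective fun z : ℕ × Fin n => z.1 * n + z.2 := by
    intro z w h
    have h1 := Nat.div_add_mod (z.1 * n + z.2) n
    simp only at h
    have hd : ∀ z : ℕ × Fin n, (z.1 * n + z.2) / n = z.1 ∧ (z.1 * n + z.2) % n = z.2 := by
      intro z
      rw [Nat.mul_comm, Nat.mul_add_div (Nat.pos_of_ne_zero (NeZero.ne n)), Nat.mul_add_mod,
        Nat.mod_eq_of_lt z.2.2, Nat.div_eq_of_lt z.2.2]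
      simp
    have hz := hd z
    rw [h] at hz
    exact Prod.ext (hz.1.symm.trans (hd w).1) (Fin.ext (hz.2.symm.trans (hd w).2))
  have hbase := isUniformSample_infinitePi (α := Cube n)
    (ν := Measure.infinitePi fun _ : Fin n => ν) fun a => by
      rw [Measure.infinitePi_singleton_of_fintype]
      simp [hν1, ENNReal.inv_pow]
  have hF : Measurable fun (ω : ℕ → Draw n) (j : ℕ) (k : Fin n) => (ω (j * n + k)).2 := by
    fun_prop
  refine hbase.comp hF ?_
  -- Reindexing along the injection, projecting to the coins and currying transform the law of the
  -- draws into that of independent uniform points.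
  have h1 := Measure.map_infinitePi_infinitePi_of_inj
    (P := fun _ : ℕ => (PMF.uniformOfFintype (Draw n)).toMeasure) hinj
  have h2 := Measure.infinitePi_map_pi
    (μ := fun _ : ℕ × Fin n => (PMF.uniformOfFintype (Draw n)).toMeasure)
    (f := fun _ => Prod.snd) fun _ => measurable_snd
  have h3 := Measure.infinitePi_map_curry (fun (_ : ℕ) (_ : Fin n) => ν)
  rw [← h3, ← h2, ← h1, Measure.map_map, Measure.map_map]
  · rfl
  all_goals fun_prop

end Sampling

/-! ### Concentration of the empirical error and the union bound -/

section Bounds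

variable {n : ℕ} {Ω : Type*} [MeasurableSpace Ω] {μ : Measure Ω} {X : ℕ → Ω → Cube n}

/-- The number of the first `m` points at which `h` and `f` differ. -/
def misses (h f : Cube n → Bool) (m : ℕ) (x : ℕ → Cube n) : ℕ :=
  ∑ j ∈ Finset.range m, if h (x j) = f (x j) then 0 else 1

theorem prod_ite_eq_pow_misses (h f : Cube n → Bool) (m : ℕ) (x : ℕ → Cube n) (b : ℝ) :
    ∏ j ∈ Finset.range m, (if h (x j) = f (x j) then 1 else b) = b ^ misses h f m x := by
  rw [misses, ← Finset.prod_pow_eq_pow_sum]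
  refine Finset.prod_congr rfl fun j _ => ?_
  split_ifs <;> simp

theorem sum_ite_div_card (h f : Cube n → Bool) (b : ℝ) :
    (∑ x, if h x = f x then 1 else b) / (Fintype.card (Cube n) : ℝ) =
      1 + (b - 1) * errorRate h f := by
  have h1 : (∑ x, if h x = f x then 1 else b) =
      ∑ x : Cube n, (1 + (b - 1) * if h x ≠ f x then 1 else 0) := by
    refine Finset.sum_congr rfl fun x _ => ?_
    by_cases hx : h x = f x <;> simp [hx]
  rw [h1, Finset.sum_add_distrib, ← Finset.mul_sum, Finset.sum_boole, errorRate]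
  simp
  field_simp

/-- The expectation of `b ^ misses` is `(1 + (b - 1) * errorRate) ^ m`, to which `1 + x ≤ exp x`
applies. Taking `b > 1` or `b < 1` yields the two tails. -/
theorem measureReal_misses_le [NeZero n] (hX : IsUniformSample μ X) (h f : Cube n → Bool) (m : ℕ)
    {b c : ℝ} (hb : 0 < b) (hc : 0 < c) :
    μ.real {ω | c ≤ b ^ misses h f m fun j => X j ω} ≤
      Real.exp (m * ((b - 1) * errorRate h f)) / c := by
  have h1 := hX.measureReal_le m (fun x => if h x = f x then 1 else b)
    (fun x => by split_ifs <;> positivity) hc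
  simp only [prod_ite_eq_pow_misses h f m fun j => X j _, sum_ite_div_card] at h1
  refine h1.trans ?_
  have h2 : 0 ≤ 1 + (b - 1) * errorRate h f := by
    rw [← sum_ite_div_card]
    exact div_nonneg (Finset.sum_nonneg fun x _ => by split_ifs <;> positivity) (by simp)
  rw [Real.exp_nat_mul]
  gcongr
  linarith [Real.add_one_le_exp ((b - 1) * errorRate h f)]

/-- With base 2 the exponent is at most `(1/8 - log 2 / 4) * ε * m`, and the bracket is below
`-1/32`. -/
theorem measureReal_many_misses_le [NeZero n] [IsProbabilityMeasure μ] (hX : IsUniformSample μ X)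
    {h f : Cube n → Bool} (m : ℕ) {ε : ℝ} (hε : 0 ≤ ε) (he : errorRate h f ≤ ε / 8) :
    μ.real {ω | ε * m / 4 ≤ misses h f m fun j => X j ω} ≤ Real.exp (-(ε * m / 32)) := by
  have h1 := measureReal_misses_le hX h f m (b := 2) (c := Real.exp (Real.log 2 * (ε * m / 4)))
    two_pos (Real.exp_pos _)
  have hb : ∀ k : ℕ, (2 : ℝ) ^ k = Real.exp (Real.log 2 * k) := fun k => by
    rw [mul_comm, Real.exp_nat_mul, Real.exp_log two_pos]
  simp only [hb] at h1
  refine (measureReal_mono (fun ω hω => ?_)).trans (h1.trans ?_)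
  · exact Real.exp_le_exp.2 (mul_le_mul_of_nonneg_left hω (Real.log_nonneg one_le_two))
  · rw [← Real.exp_sub, Real.exp_le_exp]
    have h3 := mul_le_mul_of_nonneg_left he m.cast_nonneg
    have h4 := mul_le_mul_of_nonneg_right Real.log_two_gt_d9.le (by positivity : 0 ≤ ε * m / 4)
    have h5 : 0 ≤ ε * m := by positivity
    linarith

/-- With base 1/2 the exponent is at most `(log 2 / 4 - 1/2) * ε * m`, well below the common bound
`-ε * m / 32`. -/
theorem measureReal_few_misses_le [NeZero n] [IsProbabilityMeasure μ] (hX : IsUniformSample μ X)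
    {h f : Cube n → Bool} (m : ℕ) {ε : ℝ} (hε : 0 ≤ ε) (he : ε ≤ errorRate h f) :
    μ.real {ω | misses h f m (fun j => X j ω) ≤ ε * m / 4} ≤ Real.exp (-(ε * m / 32)) := by
  have h1 := measureReal_misses_le hX h f m (b := 2⁻¹)
    (c := Real.exp (-Real.log 2 * (ε * m / 4))) (by norm_num) (Real.exp_pos _)
  have hb : ∀ k : ℕ, (2⁻¹ : ℝ) ^ k = Real.exp (-Real.log 2 * k) := fun k => by
    rw [mul_comm, Real.exp_nat_mul, Real.exp_neg, Real.exp_log two_pos]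
  simp only [hb] at h1
  refine (measureReal_mono (fun ω hω => ?_)).trans (h1.trans ?_)
  · exact Real.exp_le_exp.2 (mul_le_mul_of_nonpos_left hω
      (neg_nonpos.2 (Real.log_nonneg one_le_two)))
  · rw [← Real.exp_sub, Real.exp_le_exp]
    have h3 := mul_le_mul_of_nonneg_left he m.cast_nonneg
    have h4 := mul_le_mul_of_nonneg_right Real.log_two_lt_d9.le (by positivity : 0 ≤ ε * m / 4)
    have h5 : 0 ≤ ε * m := by positivity
    linarith

/-- Empirical risk minimization over the trees of depth `d` on the variables in a random set `V`,
which contains all influential variables with high probability. -/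
theorem learning_bound [NeZero n] [IsProbabilityMeasure μ] (hX : IsUniformSample μ X)
    (V : Ω → Fin n → Prop) (g : DTree n) {s d l m P : ℕ} {ε δ : ℝ} (hgs : g.size ≤ s) (hs : 2 ≤ s)
    (hε : 0 < ε) (hε1 : ε ≤ 1)
    (hd : 16 * (s / ε) ≤ 2 ^ d) (hl : 1 / δ ≤ 2 ^ l) (hδ : 0 < δ)
    (hP : P = n * 2 ^ d) (hm : m = (P + P + l) * P)
    (hV : ∀ i, μ.real {ω | ¬ V ω i} ≤ (1 - numSens g.eval i / 2 ^ n / n) ^ m) :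
    1 - δ ≤ μ.real {ω | ∀ h : DTree n, h.depth ≤ d →
      (∀ t : DTree n, t.depth ≤ d → (∀ i ∈ t.vars, V ω i) →
        misses h.eval g.eval m (fun j => X j ω) ≤ misses t.eval g.eval m fun j => X j ω) →
      errorRate h.eval g.eval ≤ ε} := by
  classical
  have hn : (1 : ℝ) ≤ n := by exact_mod_cast Nat.one_le_iff_ne_zero.2 (NeZero.ne n)
  have hs' : (2 : ℝ) ≤ s := by exact_mod_cast hs
  set Q : ℝ := P + P + l with hQ
  set τ : ℝ := ε / (16 * s) with hτ
  have hmQ : (m : ℝ) = Q * P := by rw [hm, hQ]; push_cast; ring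
  have hPD : (P : ℝ) = n * 2 ^ d := by rw [hP]; push_cast; ring
  have hQ0 : 0 ≤ Q := by positivity
  have hDτ : 1 ≤ τ * 2 ^ d := by
    rw [hτ, div_mul_eq_mul_div, one_le_div (by positivity)]
    calc 16 * (s : ℝ) = ε * (16 * (s / ε)) := by field_simp
      _ ≤ _ := mul_le_mul_of_nonneg_left hd hε.le
  -- `m` is the product of the exponent `Q` needed for the union bound and a factor `P` that
  -- outweighs both `32 / ε` and `n / τ`. The former uses `2 ≤ s`, through `τ ≤ ε / 32`.
  have hm1 : Q ≤ ε * m / 32 := by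
    have h1 : 1 ≤ ε / 32 * 2 ^ d := by
      refine hDτ.trans (mul_le_mul_of_nonneg_right ?_ (by positivity))
      rw [hτ]
      gcongr
      linarith
    have h2 : 1 ≤ ε / 32 * P := by
      rw [hPD]
      nlinarith
    rw [hmQ]
    nlinarith
  have hm2 : Q ≤ m * (τ / n) := by
    have h2 : 1 ≤ τ / n * P := by
      rw [hPD]
      calc 1 ≤ τ * 2 ^ d := hDτ
        _ = _ := by field_simp
    rw [hmQ]
    nlinarith
  set S := {ω | ∀ h : DTree n, h.depth ≤ d →
      (∀ t : DTree n, t.depth ≤ d → (∀ i ∈ t.vars, V ω i) →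
        misses h.eval g.eval m (fun j => X j ω) ≤ misses t.eval g.eval m fun j => X j ω) →
      errorRate h.eval g.eval ≤ ε}
  set I := Finset.univ.filter fun i : Fin n => τ * 2 ^ n < numSens g.eval i
  set H₀ := (depthClass n d).filter fun h => errorRate h g.eval ≤ ε / 8
  set H₁ := (depthClass n d).filter fun h => ε ≤ errorRate h g.eval
  -- The bad events: an influential variable is missed, a good function looks bad, or a bad function
  -- looks good. Each single one has probability at most `exp (-Q)`.
  set B₀ := ⋃ i ∈ I, {ω | ¬ V ω i}
  set B₁ := ⋃ h ∈ H₀, {ω | ε * m / 4 ≤ misses h g.eval m fun j => X j ω}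
  set B₂ := ⋃ h ∈ H₁, {ω | misses h g.eval m (fun j => X j ω) ≤ ε * m / 4}
  have hB₀ : μ.real B₀ ≤ n * Real.exp (-Q) := by
    refine (measureReal_biUnion_finset_le _ _).trans ?_
    calc _ ≤ ∑ _i ∈ I, Real.exp (-Q) := Finset.sum_le_sum fun i hi => ?_
      _ = I.card * Real.exp (-Q) := by simp
      _ ≤ _ := by
        gcongr
        exact (Finset.card_le_univ _).trans_eq (Fintype.card_fin n)
    have hi := (Finset.mem_filter.1 hi).2
    refine (hV i).trans ?_
    have h1 : τ / n ≤ numSens g.eval i / 2 ^ n / n := by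
      gcongr
      rw [le_div_iff₀ (by positivity)]
      exact hi.le
    have h0 : (numSens g.eval i : ℝ) / 2 ^ n / n ≤ 1 := by
      have : (numSens g.eval i : ℝ) ≤ 2 ^ n := by exact_mod_cast numDiff_le _ _
      rw [div_div, div_le_one (by positivity)]
      nlinarith [(by positivity : (0 : ℝ) < 2 ^ n)]
    calc _ ≤ (Real.exp (-(τ / n))) ^ m := by
          refine pow_le_pow_left₀ (by linarith) ?_ m
          linarith [Real.add_one_le_exp (-(τ / n))]
      _ = Real.exp (-(m * (τ / n))) := by rw [← Real.exp_nat_mul]; ring_nf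
      _ ≤ _ := by rw [Real.exp_le_exp]; linarith
  have hexp : Real.exp (-(ε * m / 32)) ≤ Real.exp (-Q) := by rw [Real.exp_le_exp]; linarith
  have hB₁ : μ.real B₁ ≤ (depthClass n d).card * Real.exp (-Q) := by
    refine (measureReal_biUnion_finset_le _ _).trans ?_
    calc _ ≤ ∑ _i ∈ H₀, Real.exp (-Q) := Finset.sum_le_sum fun h hh =>
          (measureReal_many_misses_le hX m hε.le (Finset.mem_filter.1 hh).2).trans hexp
      _ = H₀.card * Real.exp (-Q) := by simp
      _ ≤ _ := by gcongr; exact Finset.filter_subset _ _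
  have hB₂ : μ.real B₂ ≤ (depthClass n d).card * Real.exp (-Q) := by
    refine (measureReal_biUnion_finset_le _ _).trans ?_
    calc _ ≤ ∑ _i ∈ H₁, Real.exp (-Q) := Finset.sum_le_sum fun h hh =>
          (measureReal_few_misses_le hX m hε.le (Finset.mem_filter.1 hh).2).trans hexp
      _ = H₁.card * Real.exp (-Q) := by simp
      _ ≤ _ := by gcongr; exact Finset.filter_subset _ _
  have hcover : (Set.univ : Set Ω) ⊆ S ∪ (B₀ ∪ (B₁ ∪ B₂)) := by
    intro ω _
    by_cases hbad : ω ∈ B₀ ∪ (B₁ ∪ B₂)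
    · exact Or.inr hbad
    refine Or.inl fun h hhd hmin => ?_
    by_contra! hcon
    have hb0 : ω ∉ B₀ := fun h => hbad (Or.inl h)
    have hb1 : ω ∉ B₁ := fun h => hbad (Or.inr (Or.inl h))
    have hb2 : ω ∉ B₂ := fun h => hbad (Or.inr (Or.inr h))
    -- Outside `B₀` all variables missing from `V ω` have small influence, so an accurate tree
    -- competes with `h` in the minimization.
    obtain ⟨t, htd, htV, hte⟩ := g.exists_approx d (V ω) hgs (τ := τ) (by positivity) fun i hi => by
      by_contra! hi2
      exact hb0 (Set.mem_biUnion (Finset.mem_filter.2 ⟨Finset.mem_univ i, hi2⟩) hi)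
    have hte' : errorRate t.eval g.eval ≤ ε / 8 := by
      refine hte.trans ?_
      have h1 : s * τ = ε / 16 := by rw [hτ]; field_simp
      have h2 : (s : ℝ) / 2 ^ d ≤ ε / 16 := by
        rw [div_le_iff₀ (by positivity)]
        calc (s : ℝ) = s * 1 := by ring
          _ ≤ s * (τ * 2 ^ d) := by gcongr
          _ = _ := by rw [← h1]; ring
      linarith
    have h1 : (misses t.eval g.eval m fun j => X j ω : ℝ) < ε * m / 4 := by
      by_contra! h2
      exact hb1 (Set.mem_biUnion (Finset.mem_filter.2 ⟨t.eval_mem_depthClass htd, hte'⟩) h2)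
    have h2 : ε * m / 4 < (misses h.eval g.eval m fun j => X j ω : ℝ) := by
      by_contra! h2
      exact hb2 (Set.mem_biUnion (Finset.mem_filter.2 ⟨h.eval_mem_depthClass hhd, hcon.le⟩) h2)
    have h3 : (misses h.eval g.eval m fun j => X j ω : ℝ) ≤
        (misses t.eval g.eval m fun j => X j ω : ℝ) := by exact_mod_cast hmin t htd htV
    linarith
  have hone : 1 ≤ μ.real S + (μ.real B₀ + (μ.real B₁ + μ.real B₂)) := by
    calc (1 : ℝ) = μ.real Set.univ := by simp
      _ ≤ μ.real (S ∪ (B₀ ∪ (B₁ ∪ B₂))) := measureReal_mono hcover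
      _ ≤ μ.real S + μ.real (B₀ ∪ (B₁ ∪ B₂)) := measureReal_union_le _ _
      _ ≤ μ.real S + (μ.real B₀ + μ.real (B₁ ∪ B₂)) := by
        gcongr; exact measureReal_union_le _ _
      _ ≤ _ := by gcongr; exact measureReal_union_le _ _
  -- The number of bad events. Each of the three terms is at most `(2n) ^ 2 ^ d`, and `2n ≤ exp (2n
  -- - 1)` saves a factor `exp (2 ^ d)` that absorbs the 3.
  have hcard : (n : ℝ) + 2 * (depthClass n d).card ≤ Real.exp (P + P) := by
    have h1 : (n : ℝ) * (depthClass n d).card ≤ (2 * n) ^ 2 ^ d := by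
      exact_mod_cast mul_card_depthClass_le (n := n) d
    have h2 : (2 * n : ℝ) ≤ (2 * n) ^ 2 ^ d := le_self_pow₀ (by linarith) (by positivity)
    have h3 : ((2 * n : ℝ)) ^ 2 ^ d ≤ Real.exp (P + P - 2 ^ d) := by
      calc ((2 * n : ℝ)) ^ 2 ^ d ≤ (Real.exp (2 * n - 1)) ^ 2 ^ d := by
            gcongr
            linarith [Real.add_one_le_exp (2 * n - 1 : ℝ)]
        _ = _ := by rw [← Real.exp_nat_mul, hPD]; push_cast; ring_nf
    have h4 : (depthClass n d).card ≤ (2 * n : ℝ) ^ 2 ^ d := by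
      nlinarith [Nat.cast_nonneg (α := ℝ) (depthClass n d).card]
    have h5 : (2 : ℝ) ≤ 2 ^ d := by
      have : 2 ≤ s / ε := by rw [le_div_iff₀ hε]; linarith
      linarith
    have h6 : 3 ≤ Real.exp (2 ^ d) := by linarith [Real.add_one_le_exp ((2 : ℝ) ^ d)]
    calc _ ≤ 3 * Real.exp (P + P - 2 ^ d) := by linarith
      _ ≤ Real.exp (2 ^ d) * Real.exp (P + P - 2 ^ d) := by gcongr
      _ = _ := by rw [← Real.exp_add]; ring_nf
  -- `Q` exceeds `P + P` by `l`, and `exp (-l) ≤ 2 ^ (-l) ≤ δ`.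
  have hfin : Real.exp (P + P) * Real.exp (-Q) ≤ δ := by
    rw [← Real.exp_add, hQ, show (P + P + -(P + P + l) : ℝ) = -l by ring, Real.exp_neg,
      inv_le_comm₀ (Real.exp_pos _) hδ, ← one_div]
    refine hl.trans ?_
    rw [← mul_one (l : ℝ), Real.exp_nat_mul]
    gcongr
    linarith [Real.add_one_le_exp (1 : ℝ)]
  have := mul_le_mul_of_nonneg_right hcard (Real.exp_pos (-Q)).le
  linarith

end Bounds

/-! ### The running time is polynomial in the permitted quantity -/

section Growth

/-- The quantities that govern the running time of the learner are polynomial in `B`. -/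
theorem growth_bounds {n s : ℕ} {ε δ B : ℝ} (hn : 1 ≤ n) (hs : 2 ≤ s) (hε : 0 < ε)
    (hε1 : ε < 1 / 2) (hδ : 0 < δ) (hδ1 : δ < 1)
    (hB : B = n + (s : ℝ) ^ (Real.logb 2 (s / ε) * Real.logb 2 (1 / ε)) + Real.logb 2 (1 / δ)) :
    2 ≤ B ∧ n ≤ B ∧ ⌈1 / ε⌉₊ ≤ B ^ 2 ∧ (2 : ℝ) ^ Nat.clog 2 (16 * (s * ⌈1 / ε⌉₊)) ≤ B ^ 8 ∧
      (2 * s : ℝ) ^ (Nat.clog 2 (16 * (s * ⌈1 / ε⌉₊)) + 1) ≤ B ^ 9 ∧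
      Nat.clog 2 ⌈1 / δ⌉₊ ≤ B := by
  have hn' : (1 : ℝ) ≤ n := by exact_mod_cast hn
  have hs' : (2 : ℝ) ≤ s := by exact_mod_cast hs
  set L := Real.logb 2 s with hL
  set E := Real.logb 2 (1 / ε) with hE
  set S := (s : ℝ) ^ (Real.logb 2 (s / ε) * E) with hS
  have h2s : (2 : ℝ) ^ L = s := Real.rpow_logb two_pos (by norm_num) (by linarith)
  have h2E : (2 : ℝ) ^ E = 1 / ε := Real.rpow_logb two_pos (by norm_num) (by positivity)
  have hL1 : 1 ≤ L := by
    rw [hL, Real.le_logb_iff_rpow_le one_lt_two (by linarith)]; simpa using hs'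
  have hε2 : 2 ≤ 1 / ε := by rw [le_div_iff₀ hε]; linarith
  have hE1 : 1 ≤ E := by
    rw [hE, Real.le_logb_iff_rpow_le one_lt_two (by positivity)]; simpa using hε2
  have hSeq : S = 2 ^ (L * ((L + E) * E)) := by
    rw [hS, Real.rpow_mul two_pos.le L, h2s, div_eq_mul_one_div, Real.logb_mul (by linarith)
      (by positivity)]
  -- All comparisons with powers of `S` become comparisons of exponents in `L` and `E`, both at
  -- least 1 because `2 ≤ s` and `ε < 1 / 2`.
  have hpow : ∀ (x c : ℝ), x ≤ c * (L * ((L + E) * E)) → (2 : ℝ) ^ x ≤ S ^ c := fun x c h => by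
    rw [hSeq, ← Real.rpow_mul two_pos.le]
    exact Real.rpow_le_rpow_of_exponent_le one_le_two (by linarith)
  have hLE : L + E ≤ (L + E) * E := le_mul_of_one_le_right (by linarith) hE1
  have hLLE : (L + E) * E ≤ L * ((L + E) * E) := le_mul_of_one_le_left (by positivity) hL1
  have hS1 : 1 ≤ S := by
    rw [hSeq]
    exact Real.one_le_rpow one_le_two (by positivity)
  have hD0 : 0 ≤ Real.logb 2 (1 / δ) :=
    Real.logb_nonneg one_lt_two (by rw [le_div_iff₀ hδ]; linarith)
  have hSB : S ≤ B := by linarith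
  have hB2 : 2 ≤ B := by linarith
  have hN : (⌈1 / ε⌉₊ : ℝ) ≤ 2 * (1 / ε) := by
    linarith [Nat.ceil_lt_add_one (show 0 ≤ 1 / ε by positivity)]
  have hN1 : 1 / ε ≤ ⌈1 / ε⌉₊ := Nat.le_ceil _
  have hsE : s * (1 / ε) ≤ S := by
    rw [← h2s, ← h2E, ← Real.rpow_add two_pos]
    simpa using hpow (L + E) 1 (by linarith)
  have hεS : 1 / ε ≤ S := by
    rw [← h2E]
    simpa using hpow E 1 (by linarith)
  -- Rounding `1 / ε` up and rounding to a power of two cost a factor 2 each, which turns 16 into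
  -- 64.
  have hd : (2 : ℝ) ^ Nat.clog 2 (16 * (s * ⌈1 / ε⌉₊)) ≤ 64 * (s * (1 / ε)) := by
    have hNs : 1 < 16 * (s * ⌈1 / ε⌉₊) := by
      have : 0 < ⌈1 / ε⌉₊ := Nat.ceil_pos.2 (by positivity)
      nlinarith
    have h1 := Nat.pow_pred_clog_lt_self one_lt_two hNs
    have h0 := Nat.clog_pos one_lt_two hNs
    have h2 : 2 ^ Nat.clog 2 (16 * (s * ⌈1 / ε⌉₊)) =
        2 * 2 ^ (Nat.clog 2 (16 * (s * ⌈1 / ε⌉₊))).pred := by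
      rw [← pow_succ', ← Nat.succ_eq_add_one, Nat.succ_pred_eq_of_pos h0]
    have h3 : (2 : ℝ) ^ Nat.clog 2 (16 * (s * ⌈1 / ε⌉₊)) ≤ 32 * (s * ⌈1 / ε⌉₊) := by
      exact_mod_cast (by omega :
        2 ^ Nat.clog 2 (16 * (s * ⌈1 / ε⌉₊)) ≤ 32 * (s * ⌈1 / ε⌉₊))
    calc _ ≤ 32 * (s * ⌈1 / ε⌉₊ : ℝ) := h3
      _ ≤ 32 * (s * (2 * (1 / ε))) := by gcongr
      _ = _ := by ring
  refine ⟨hB2, by linarith, ?_, ?_, ?_, ?_⟩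
  · calc (⌈1 / ε⌉₊ : ℝ) ≤ 2 * (1 / ε) := hN
      _ ≤ B * B := by gcongr; linarith
      _ = _ := by ring
  · calc _ ≤ 64 * (s * (1 / ε)) := hd
      _ ≤ 2 ^ 6 * B := by linarith
      _ ≤ B ^ 6 * B := by gcongr
      _ = B ^ 7 := by ring
      _ ≤ B ^ 8 := pow_le_pow_right₀ (by linarith) (by norm_num)
  · have hd' : (Nat.clog 2 (16 * (s * ⌈1 / ε⌉₊)) : ℝ) ≤ 6 + (L + E) := by
      have h1 : (2 : ℝ) ^ (Nat.clog 2 (16 * (s * ⌈1 / ε⌉₊)) : ℝ) ≤ 2 ^ (6 + (L + E)) := by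
        rw [Real.rpow_natCast, Real.rpow_add two_pos, Real.rpow_add two_pos, h2s, h2E]
        norm_num at hd ⊢
        exact hd
      exact (Real.rpow_le_rpow_left_iff one_lt_two).1 h1
    have h2 : (2 * s : ℝ) = 2 ^ (1 + L) := by rw [Real.rpow_add two_pos, h2s]; simp
    rw [h2, ← Real.rpow_natCast, ← Real.rpow_mul two_pos.le]
    push_cast
    -- The 9 is 2 · 4.5: `1 + L ≤ 2L`, and `7 + (L + E) ≤ 4.5 (L + E)` since `L + E ≥ 2`.
    have h3 := hpow ((1 + L) * (Nat.clog 2 (16 * (s * ⌈1 / ε⌉₊)) + 1)) 9 ?_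
    · refine h3.trans ?_
      rw [show (9 : ℝ) = (9 : ℕ) by norm_num, Real.rpow_natCast]
      gcongr
    · calc _ ≤ (2 * L) * (4.5 * ((L + E) * E)) := by
            gcongr
            · linarith
            · linarith
        _ = _ := by ring
  · have hΔ : 1 < ⌈1 / δ⌉₊ := by
      rw [Nat.lt_ceil, Nat.cast_one, lt_div_iff₀ hδ]; linarith
    have h1 := Nat.pow_pred_clog_lt_self one_lt_two hΔ
    have h0 := Nat.clog_pos one_lt_two hΔ
    have h3 : (2 : ℝ) ^ (Nat.clog 2 ⌈1 / δ⌉₊).pred < ⌈1 / δ⌉₊ := by exact_mod_cast h1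
    have h4 : (⌈1 / δ⌉₊ : ℝ) ≤ 2 * (1 / δ) := by
      have : 1 ≤ 1 / δ := by rw [le_div_iff₀ hδ]; linarith
      linarith [Nat.ceil_lt_add_one (show 0 ≤ 1 / δ by positivity)]
    have h5 : ((Nat.clog 2 ⌈1 / δ⌉₊).pred : ℝ) ≤ 1 + Real.logb 2 (1 / δ) := by
      rw [← Real.rpow_le_rpow_left_iff one_lt_two, Real.rpow_natCast, Real.rpow_add two_pos,
        Real.rpow_logb two_pos (by norm_num) (by positivity), Real.rpow_one]
      linarith
    have h6 : (Nat.clog 2 ⌈1 / δ⌉₊ : ℝ) = (Nat.clog 2 ⌈1 / δ⌉₊).pred + 1 := by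
      exact_mod_cast (Nat.succ_pred_eq_of_pos h0).symm
    linarith

/-- The running time of the learner, from the bounds of its parts. -/
theorem time_le {n s N d l P m t₁ t₂ t₃ : ℕ} {B : ℝ} (hB : 2 ≤ B) (hn : n ≤ B) (hN : N ≤ B ^ 2)
    (hD : (2 : ℝ) ^ d ≤ B ^ 8) (hZ : (2 * s : ℝ) ^ (d + 1) ≤ B ^ 9) (hl : l ≤ B)
    (hP : P = n * 2 ^ d) (hm : m = (P + P + l) * P)
    (h₁ : t₁ ≤ 12 * (N + d + l + 2 ^ d + (P + P + l) + m) + 200)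
    (h₂ : t₂ ≤ m * (n * (n + 70) + 80) + 10)
    (h₃ : t₃ ≤ 4000 * (n + m + 2 ^ d + (2 * s) ^ (d + 1)) ^ 3) :
    ((4 + (t₁ + (t₂ + t₃)) : ℕ) : ℝ) ≤ 5000 * B ^ 5000 := by
  have hB1 : 1 ≤ B := by linarith
  have hmono : ∀ {a b : ℕ}, a ≤ b → B ^ a ≤ B ^ b := fun h => pow_le_pow_right₀ hB1 h
  -- Since `2 ≤ B`, constant factors are absorbed into additional powers of `B`.
  have hc : ∀ {x : ℝ} {a b k : ℕ} {c : ℝ}, x ≤ c * B ^ a → c ≤ 2 ^ k → a + k ≤ b → x ≤ B ^ b := by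
    intro x a b k c h1 h2 h3
    calc x ≤ c * B ^ a := h1
      _ ≤ 2 ^ k * B ^ a := by gcongr
      _ ≤ B ^ k * B ^ a := by gcongr
      _ = B ^ (a + k) := by rw [← pow_add, add_comm]
      _ ≤ _ := hmono h3
  have hP' : (P : ℝ) ≤ B ^ 9 := by
    rw [hP]; push_cast
    calc (n : ℝ) * 2 ^ d ≤ B * B ^ 8 := by gcongr
      _ = _ := by ring
  have h19 : B ≤ B ^ 9 := by simpa using hmono (a := 1) (b := 9) (by norm_num)
  have hm' : (m : ℝ) ≤ B ^ 20 := by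
    rw [hm]; push_cast
    refine hc (a := 18) (k := 2) (c := 3) ?_ (by norm_num) (by norm_num)
    calc ((P : ℝ) + P + l) * P ≤ (B ^ 9 + B ^ 9 + B ^ 9) * B ^ 9 := by gcongr; exact hl.trans h19
      _ = _ := by ring
  have hd : (d : ℝ) ≤ B ^ 8 := by
    refine le_trans ?_ hD
    exact_mod_cast Nat.lt_two_pow_self.le
  have hY : ((n + m + 2 ^ d + (2 * s) ^ (d + 1) : ℕ) : ℝ) ≤ B ^ 22 := by
    push_cast
    refine hc (a := 20) (k := 2) (c := 4) ?_ (by norm_num) (by norm_num)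
    have e1 : B ≤ B ^ 20 := by simpa using hmono (a := 1) (b := 20) (by norm_num)
    have e2 := hmono (a := 8) (b := 20) (by norm_num)
    have e3 := hmono (a := 9) (b := 20) (by norm_num)
    linarith
  have g₁ : (t₁ : ℝ) ≤ 320 * B ^ 66 := by
    have h : (t₁ : ℝ) ≤ 12 * (N + d + l + 2 ^ d + (P + P + l) + m) + 200 := by exact_mod_cast h₁
    have e0 : 1 ≤ B ^ 66 := one_le_pow₀ hB1
    have e1 : B ≤ B ^ 66 := by simpa using hmono (a := 1) (b := 66) (by norm_num)
    have e2 := hmono (a := 2) (b := 66) (by norm_num)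
    have e3 := hmono (a := 8) (b := 66) (by norm_num)
    have e4 := hmono (a := 9) (b := 66) (by norm_num)
    have e5 := hmono (a := 20) (b := 66) (by norm_num)
    linarith
  have g₂ : (t₂ : ℝ) ≤ 161 * B ^ 66 := by
    have h : (t₂ : ℝ) ≤ m * (n * (n + 70) + 80) + 10 := by exact_mod_cast h₂
    have e0 : 1 ≤ B ^ 66 := one_le_pow₀ hB1
    have e1 : 1 ≤ B ^ 2 := one_le_pow₀ hB1
    have e2 : (n : ℝ) * (n + 70) + 80 ≤ 151 * B ^ 2 := by
      calc (n : ℝ) * (n + 70) + 80 ≤ B * (B + 70 * B) + 80 := by gcongr; linarith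
        _ ≤ _ := by linarith
    calc (t₂ : ℝ) ≤ _ := h
      _ ≤ B ^ 20 * (151 * B ^ 2) + 10 := by gcongr
      _ = 151 * B ^ 22 + 10 := by ring
      _ ≤ _ := by linarith [hmono (a := 22) (b := 66) (by norm_num)]
  have g₃ : (t₃ : ℝ) ≤ 4000 * B ^ 66 := by
    have h : (t₃ : ℝ) ≤ 4000 * ((n + m + 2 ^ d + (2 * s) ^ (d + 1) : ℕ) : ℝ) ^ 3 := by
      exact_mod_cast h₃
    calc (t₃ : ℝ) ≤ _ := h
      _ ≤ 4000 * (B ^ 22) ^ 3 := by gcongr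
      _ = _ := by ring
  have e0 : 1 ≤ B ^ 66 := one_le_pow₀ hB1
  -- The 4 is the cost of testing whether `s` is 1. Exponent 66 would do; 5000 appears because the
  -- theorem uses one number as factor and exponent.
  calc ((4 + (t₁ + (t₂ + t₃)) : ℕ) : ℝ) = 4 + (t₁ + (t₂ + t₃)) := by push_cast; ring
    _ ≤ 5000 * B ^ 66 := by linarith
    _ ≤ _ := mul_le_mul_of_nonneg_left (hmono (by norm_num)) (by norm_num)

end Growth

/-! ### Assembling the two learners -/

section Learner

local notation "R" => Expr.reg
local notation "C" => Expr.const
local infixl:65 " ∸ " => Expr.sub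
local infixr:30 " ;; " => Prog.seq

/-- Learn with the sampling procedure `sample`, or run `guess` if `s` is `1`. -/
def learner (sample guess : Prog) : Prog :=
  Prog.ite (R 1 ∸ C 1) (setParams ;; sample ;; learnFromSample) guess

/-- Return the label of the point `0`. -/
def guessByQuery : Prog := Prog.query 1 (C 0) ;; Prog.store (R 0) (R 1)

/-- Return the label of the first point of a random edge. -/
def guessByEdge : Prog := Prog.edge (C 0)

variable {n : ℕ} {f : Cube n → Bool} {ω : ℕ → Draw n}

theorem run_guessByQuery {σ : MState} {b : Bool} (h0 : σ.reg 0 = n) (hf : f = fun _ => b) :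
    Run f ω guessByQuery σ fun t τ => t ≤ 2 * n + 20 ∧ τ.HasBlock (τ.reg 0) [b.toNat] := by
  rw [guessByQuery, run_seq, run_query, run_store]
  refine ⟨by simp only [Expr.cost]; omega, ?_⟩
  intro k hk
  obtain rfl : k = 0 := by simpa using hk
  simp [Expr.eval, MState.setReg, MState.setMem, hf]

/-- The label of the first endpoint lands in cell `n`, the address that register `0` contains from
the outset, and a label is already the code of a leaf. -/
theorem run_guessByEdge {σ : MState} {b : Bool} (h0 : σ.reg 0 = n) (hf : f = fun _ => b) :
    Run f ω guessByEdge σ fun t τ => t ≤ 2 * n + 20 ∧ τ.HasBlock (τ.reg 0) [b.toNat] := by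
  rw [guessByEdge, run_edge]
  refine ⟨by simp only [Expr.cost]; omega, ?_⟩
  intro k hk
  obtain rfl : k = 0 := by simpa using hk
  simp only [Expr.eval, MState.tick, MState.setBlock, h0, add_zero, tsub_zero, zero_add]
  rw [if_pos ⟨Nat.zero_le _, by simp [edgeBlock]⟩, edgeBlock, hf,
    List.getD_append _ _ _ _ (by simp), List.getD_append_right _ _ _ _ (by simp)]
  simp

/-- What the learner needs from a sampling procedure: a uniform sample `X` of the labelled points,
and a set `V` of sensitive directions, which contains the influential ones. -/
structure Samples [NeZero n] (sample : Prog) (f : Cube n → Bool)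
    (X : ℕ → (ℕ → Draw n) → Cube n) (V : ℕ → (ℕ → Draw n) → Fin n → Prop) : Prop where
  run : ∀ (ω : ℕ → Draw n) (σ : MState) (m : ℕ), σ.reg 0 = n → σ.reg 9 = m →
    σ.reg 10 = 2 * n + 2 → (∀ a < n, σ.mem a = 0) → σ.draws = 0 →
    Run f ω sample σ fun t τ => t ≤ m * (n * (n + 70) + 80) + 10 ∧ MState.Agree 19 σ τ ∧
      HasSample f (2 * n + 2) m (X · ω) τ.mem ∧ ∀ i : Fin n, τ.mem i ≠ 0 ↔ V m ω i
  sensitive : ∀ m ω i, V m ω i → ∃ x : Cube n, f x ≠ f (x.flip i)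
  uniform : IsUniformSample (drawLaw n) X
  miss : ∀ m i, (drawLaw n).real {ω | ¬ V m ω i} ≤ (1 - numSens f i / 2 ^ n / n) ^ m

theorem samples_queries [NeZero n] (f : Cube n → Bool) :
    Samples sampleQueries f (fun j ω k => (ω (j * n + k)).2) fun m ω i => ∃ j < m,
      f (fun k => (ω (j * n + k)).2) ≠ f (Cube.flip (fun k => (ω (j * n + k)).2) i) where
  run ω σ m h0 h9 h10 hmem hdr := run_sampleQueries h0 h9 h10 hmem hdr _ fun _ _ => rfl
  sensitive m ω i := fun ⟨_, _, h⟩ => ⟨_, h⟩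
  uniform := isUniformSample_bits
  miss m i := by
    have h1 := isUniformSample_bits.measureReal_le m
      (fun x : Cube n => if f x = f (x.flip i) then 1 else 0) (fun x => by split_ifs <;> simp)
      one_pos
    rw [sum_ite_div_card f fun x => f (x.flip i)] at h1
    refine (measureReal_mono fun ω hω => ?_).trans (h1.trans ?_)
    · simp only [Set.mem_ofPred_eq, not_exists, not_and, not_not] at hω ⊢
      rw [Finset.prod_congr rfl fun j hj => if_pos (hω j (Finset.mem_range.1 hj))]
      simp
    · rw [errorRate_eq, div_one]
      have hn : (1 : ℝ) ≤ n := by exact_mod_cast Nat.one_le_iff_ne_zero.2 (NeZero.ne n)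
      have h2 : (numSens f i : ℝ) / 2 ^ n ≤ 1 := by
        rw [div_le_one (by positivity)]
        exact_mod_cast numDiff_le _ _
      -- Queries test all directions at each point, so the bound without the division by `n` holds.
      -- It is weakened to the form shared with random edges.
      have h3 : (numSens f i : ℝ) / 2 ^ n / n ≤ numSens f i / 2 ^ n := div_le_self (by positivity) hn
      change (1 + (0 - 1) * ((numSens f i : ℝ) / 2 ^ n)) ^ m ≤ _
      exact pow_le_pow_left₀ (by linarith) (by linarith) m

theorem samples_edges [NeZero n] (f : Cube n → Bool) :
    Samples sampleEdges f (fun j ω => (ω j).1.1) fun m ω i => ∃ j < m, (ω j).1.2 = i ∧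
      f (ω j).1.1 ≠ f ((ω j).1.1.flip i) where
  run ω σ m h0 h9 h10 hmem hdr := (run_sampleEdges h0 h9 h10 hmem hdr).mono
    fun t τ ⟨ht, h⟩ => ⟨ht.trans (by gcongr; omega), h⟩
  sensitive m ω i := fun ⟨_, _, _, h⟩ => ⟨_, h⟩
  uniform := isUniformSample_draw.fst.fst
  miss m i := by
    have h1 := (isUniformSample_draw (n := n)).fst.measureReal_le m
      (fun z : Cube n × Fin n => if z.2 = i ∧ f z.1 ≠ f (z.1.flip i) then 0 else 1)
      (fun x => by split_ifs <;> simp) one_pos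
    -- A random edge has direction `i` with probability `1 / n`, and is then sensitive with
    -- probability equal to the influence of `i`.
    have h2 : (∑ z : Cube n × Fin n, if z.2 = i ∧ f z.1 ≠ f (z.1.flip i) then (0 : ℝ) else 1) /
        Fintype.card (Cube n × Fin n) = 1 - numSens f i / 2 ^ n / n := by
      have h3 : (∑ z : Cube n × Fin n, if z.2 = i ∧ f z.1 ≠ f (z.1.flip i) then (0 : ℝ) else 1) =
          ∑ x : Cube n, ((n : ℝ) - if f x ≠ f (x.flip i) then 1 else 0) := by
        rw [Fintype.sum_prod_type]
        refine Finset.sum_congr rfl fun x _ => ?_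
        by_cases hx : f x = f (x.flip i)
        · simp [hx]
        · have h4 : ∀ k : Fin n, (if k = i ∧ f x ≠ f (x.flip i) then (0 : ℝ) else 1) =
              1 - if k = i then 1 else 0 := fun k => by by_cases hk : k = i <;> simp [hk, hx]
          simp only [h4]
          simp [hx]
      have hn : (n : ℝ) ≠ 0 := by exact_mod_cast NeZero.ne n
      rw [h3, Finset.sum_sub_distrib, Finset.sum_boole]
      simp [numSens, numDiff]
      field_simp
    rw [h2, div_one] at h1
    refine (measureReal_mono fun ω hω => ?_).trans h1
    simp only [Set.mem_ofPred_eq, not_exists, not_and] at hω ⊢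
    rw [Finset.prod_congr rfl fun j hj => if_neg (not_and.2 (hω j (Finset.mem_range.1 hj)))]
    simp

/-- A tree with one leaf is constant, so a single label is an exact answer. The case is separate
because the time bound for `s = 1` does not grow with `1 / ε`, whereas the sample size does. -/
theorem properlyLearns_of_size_one [NeZero n] {sample guess : Prog} {ε δ T : ℝ} (hε : 0 < ε)
    (hδ : 0 < δ)
    (hguess : ∀ (f : Cube n → Bool) (ω : ℕ → Draw n) (σ : MState) (b : Bool), σ.reg 0 = n →
      (f = fun _ => b) →
      Run f ω guess σ fun t τ => t ≤ 2 * n + 20 ∧ τ.HasBlock (τ.reg 0) [b.toNat])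
    (hT : (2 * n + 24 : ℝ) ≤ T) : ProperlyLearns (learner sample guess) n 1 ε δ T := by
  rintro f ⟨g, hg, rfl⟩
  obtain ⟨b, rfl⟩ : ∃ b, g = DTree.leaf b := by
    cases g with
    | leaf b => exact ⟨b, rfl⟩
    | node i t₀ t₁ =>
      have := t₀.size_pos
      have := t₁.size_pos
      simp only [DTree.size] at hg
      omega
  have key : ∀ ω, ∃ (t : ℕ) (h : DTree n),
      Returns (DTree.leaf b).eval ω (learner sample guess) 1 ε δ t h ∧ (t : ℝ) ≤ T ∧
        errorRate h.eval (DTree.leaf b).eval ≤ ε := by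
    intro ω
    have h1 : Run (DTree.leaf b).eval ω (learner sample guess) (initState n 1 ε δ) fun t τ =>
        t ≤ 2 * n + 24 ∧ τ.HasBlock (τ.reg 0) [b.toNat] := by
      rw [learner, run_ite, if_neg (by simp [Expr.eval, initState])]
      refine (hguess _ ω (initState n 1 ε δ) b (by simp [initState]) rfl).mono ?_
      rintro t τ ⟨h1, h2⟩
      exact ⟨by simp only [Expr.cost]; omega, h2⟩
    obtain ⟨t, τ, hex, ht, hblock⟩ := h1
    refine ⟨t, DTree.leaf b, ⟨τ, hex, hblock⟩, le_trans ?_ hT, by simp [errorRate, hε.le]⟩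
    exact_mod_cast ht
  refine ⟨fun ω => ?_, ?_⟩
  · obtain ⟨t, h, h1, h2, -⟩ := key ω
    exact ⟨t, h, h1, h2⟩
  · have huniv : {ω | ∃ (t : ℕ) (h : DTree n),
        Returns (DTree.leaf b).eval ω (learner sample guess) 1 ε δ t h ∧
          errorRate h.eval (DTree.leaf b).eval ≤ ε} = Set.univ := by
      refine Set.eq_univ_of_forall fun ω => ?_
      obtain ⟨t, h, h1, -, h2⟩ := key ω
      exact ⟨t, h, h1, h2⟩
    rw [huniv]
    simp [hδ.le]

/-- On every run the output minimizes the empirical error over trees on the sampled directions,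
within the time bound. Chance enters only through `learning_bound`. -/
theorem properlyLearns_of_samples [NeZero n] {sample guess : Prog} {s : ℕ} {ε δ B : ℝ} (hs : 2 ≤ s)
    (hε : 0 < ε) (hε1 : ε < 1 / 2) (hδ : 0 < δ) (hδ1 : δ < 1)
    (hsample : ∀ f : Cube n → Bool, ∃ X V, Samples sample f X V)
    (hB : B = n + (s : ℝ) ^ (Real.logb 2 (s / ε) * Real.logb 2 (1 / ε)) + Real.logb 2 (1 / δ)) :
    ProperlyLearns (learner sample guess) n s ε δ (5000 * B ^ 5000) := by
  classical
  rintro f ⟨g, hg, rfl⟩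
  obtain ⟨X, V, hXV⟩ := hsample g.eval
  set d := Nat.clog 2 (16 * (s * ⌈1 / ε⌉₊)) with hd
  set l := Nat.clog 2 ⌈1 / δ⌉₊ with hl
  set P := n * 2 ^ d with hP
  set m := (P + P + l) * P with hm
  obtain ⟨hB2, hnB, hNB, hDB, hZB, hlB⟩ :=
    growth_bounds (Nat.one_le_iff_ne_zero.2 (NeZero.ne n)) hs hε hε1 hδ hδ1 hB
  have key : ∀ ω, ∃ (t : ℕ) (h : DTree n),
      Returns g.eval ω (learner sample guess) s ε δ t h ∧ (t : ℝ) ≤ 5000 * B ^ 5000 ∧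
        h.depth ≤ d ∧ ∀ t : DTree n, t.depth ≤ d → (∀ i ∈ t.vars, V m ω i) →
          misses h.eval g.eval m (X · ω) ≤ misses t.eval g.eval m (X · ω) := by
    intro ω
    have h1 : Run g.eval ω (learner sample guess) (initState n s ε δ) fun t τ =>
        (t : ℝ) ≤ 5000 * B ^ 5000 ∧ ∃ h : DTree n, τ.HasBlock (τ.reg 0) h.code ∧ h.depth ≤ d ∧
        ∀ t : DTree n, t.depth ≤ d → (∀ i ∈ t.vars, V m ω i) →
          misses h.eval g.eval m (X · ω) ≤ misses t.eval g.eval m (X · ω) := by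
      rw [learner, run_ite, if_pos (by simp [Expr.eval, initState]; omega), run_seq]
      refine (run_setParams (n := n) (s := s) (N := ⌈1 / ε⌉₊) (Δ := ⌈1 / δ⌉₊) (d := d) (l := l)
        (P := P) (m := m) (by simp [initState]) (by simp [initState]) (by simp [initState])
        (by simp [initState]) (fun r hr => ?_) hd hl hP hm).mono ?_
      · simp only [initState]
        rw [List.getD_eq_default _ _ (by simpa using hr)]
      rintro t₁ σ ⟨ht₁, h0, h5, h6, h9, h10, h11, h12, hmem, hdr⟩
      rw [run_seq]
      refine (hXV.run ω σ m h0 h9 h10 (fun a _ => by rw [hmem]; rfl) (by rw [hdr]; rfl)).mono ?_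
      rintro t₂ τ ⟨ht₂, ha, hS, hV⟩
      -- A marked direction has a sensitive edge, hence is queried by `g`. The heap is therefore
      -- small for every outcome of the draws.
      have hcard : (Finset.univ.filter fun i : Fin n => τ.mem i ≠ 0).card ≤ s := by
        refine (Finset.card_le_card fun i hi => ?_).trans (g.card_vars_lt.le.trans hg)
        obtain ⟨x, hx⟩ := hXV.sensitive m ω i ((hV i).1 (Finset.mem_filter.1 hi).2)
        by_contra hcon
        refine hx (g.eval_congr fun j hj => ?_)
        rw [Cube.flip_apply, if_neg]
        rintro rfl
        exact hcon hj
      refine (run_learnFromSample (f := g.eval) (ω := ω) (d := d) (m := m) (w := 2 * n + 2)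
        (X · ω) (fun j => g.eval (X j ω))
        ((ha 0 (by norm_num)).trans h0) ((ha 5 (by norm_num)).trans h5)
        ((ha 6 (by norm_num)).trans h6) ((ha 9 (by norm_num)).trans h9)
        ((ha 10 (by norm_num)).trans h10) ((ha 11 (by norm_num)).trans h11)
        ((ha 12 (by norm_num)).trans h12) (by omega) (fun j hj => (hS j hj).1)
        (fun j hj => (hS j hj).2) (by omega : 1 ≤ s) hcard le_rfl).mono ?_
      rintro t₃ υ ⟨ht₃, h, hblock, hdepth, hmin⟩
      refine ⟨time_le hB2 hnB hNB hDB hZB hlB hP hm ht₁ ht₂ ht₃, h, hblock, hdepth,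
        fun t ht hv => hmin t ht fun i hi => (hV i).2 (hv i hi)⟩
    obtain ⟨t, τ, hex, ht, h, hblock, hh⟩ := h1
    exact ⟨t, h, ⟨τ, hex, hblock⟩, ht, hh⟩
  refine ⟨fun ω => ?_, ?_⟩
  · obtain ⟨t, h, h1, h2, -⟩ := key ω
    exact ⟨t, h, h1, h2⟩
  · have hdR : 16 * (s / ε) ≤ (2 : ℝ) ^ d := by
      have h1 : 16 * (s * ⌈1 / ε⌉₊) ≤ 2 ^ d := Nat.le_pow_clog one_lt_two _
      calc 16 * (s / ε) = 16 * (s * (1 / ε)) := by ring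
        _ ≤ 16 * (s * ⌈1 / ε⌉₊) := by gcongr; exact Nat.le_ceil _
        _ ≤ 2 ^ d := by exact_mod_cast h1
    have hlR : 1 / δ ≤ (2 : ℝ) ^ l := by
      have h1 : ⌈1 / δ⌉₊ ≤ 2 ^ l := Nat.le_pow_clog one_lt_two _
      exact (Nat.le_ceil _).trans (by exact_mod_cast h1)
    refine (learning_bound hXV.uniform (V m) g hg hs hε (by linarith) hdR hlR hδ hP hm
      (hXV.miss m)).trans (measureReal_mono fun ω hω => ?_)
    obtain ⟨t, h, h1, -, h2, h3⟩ := key ω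
    exact ⟨t, h, h1, hω h h2 h3⟩

theorem properlyLearns_learner [NeZero n] {sample guess : Prog} {s : ℕ} {ε δ : ℝ} (hs : 1 ≤ s)
    (hε : 0 < ε) (hε1 : ε < 1 / 2) (hδ : 0 < δ) (hδ1 : δ < 1)
    (hsample : ∀ f : Cube n → Bool, ∃ X V, Samples sample f X V)
    (hguess : ∀ (f : Cube n → Bool) (ω : ℕ → Draw n) (σ : MState) (b : Bool), σ.reg 0 = n →
      (f = fun _ => b) →
      Run f ω guess σ fun t τ => t ≤ 2 * n + 20 ∧ τ.HasBlock (τ.reg 0) [b.toNat]) :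
    ProperlyLearns (learner sample guess) n s ε δ
      ((5000 : ℕ) * ((n : ℝ) + (s : ℝ) ^ (Real.logb 2 (s / ε) * Real.logb 2 (1 / ε))
        + Real.logb 2 (1 / δ)) ^ 5000) := by
  obtain rfl | hs2 := hs.eq_or_lt
  · refine properlyLearns_of_size_one hε hδ hguess ?_
    have hL : 0 ≤ Real.logb 2 (1 / δ) :=
      Real.logb_nonneg one_lt_two (by rw [le_div_iff₀ hδ]; linarith)
    have hn : (1 : ℝ) ≤ n := by exact_mod_cast Nat.one_le_iff_ne_zero.2 (NeZero.ne n)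
    rw [Nat.cast_one, Real.one_rpow]
    generalize hx : (n : ℝ) + 1 + Real.logb 2 (1 / δ) = x
    have h1 : x ≤ x ^ 5000 := le_self_pow₀ (by linarith) (by norm_num)
    generalize x ^ 5000 = y at h1 ⊢
    push_cast
    linarith
  · rw [Nat.cast_ofNat]
    exact properlyLearns_of_samples hs2 hε hε1 hδ hδ1 hsample rfl

end Learner

theorem theorem6 :
    -- learning with membership queries
    (∃ P : Prog, P.UsesOnlyQueries ∧ ∃ C : ℕ, ∀ (n : ℕ) [NeZero n] (s : ℕ) (ε δ : ℝ),
      1 ≤ s → 0 < ε → ε < 1 / 2 → 0 < δ → δ < 1 →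
      ProperlyLearns P n s ε δ
        (C * ((n : ℝ) + (s : ℝ) ^ (Real.logb 2 (s / ε) * Real.logb 2 (1 / ε))
          + Real.logb 2 (1 / δ)) ^ C)) ∧
    -- learning from random edges only
    (∃ P : Prog, P.UsesOnlyEdges ∧ ∃ C : ℕ, ∀ (n : ℕ) [NeZero n] (s : ℕ) (ε δ : ℝ),
      1 ≤ s → 0 < ε → ε < 1 / 2 → 0 < δ → δ < 1 →
      ProperlyLearns P n s ε δ
        (C * ((n : ℝ) + (s : ℝ) ^ (Real.logb 2 (s / ε) * Real.logb 2 (1 / ε))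
          + Real.logb 2 (1 / δ)) ^ C)) := by
  refine ⟨⟨learner sampleQueries guessByQuery, ?_, 5000, ?_⟩,
    ⟨learner sampleEdges guessByEdge, ?_, 5000, ?_⟩⟩
  · repeat' constructor
  · intro n _ s ε δ hs hε hε1 hδ hδ1
    exact properlyLearns_learner hs hε hε1 hδ hδ1 (fun f => ⟨_, _, samples_queries f⟩)
      fun f ω σ b h0 hf => run_guessByQuery h0 hf
  · repeat' constructor
  · intro n _ s ε δ hs hε hε1 hδ hδ1
    exact properlyLearns_learner hs hε hε1 hδ hδ1 (fun f => ⟨_, _, samples_edges f⟩)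
      fun f ω σ b h0 hf => run_guessByEdge h0 hf
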